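/- **Conventions.** All graphs are finite and simple. In a drawing of a graph in the plane the vertices are distinct points, each edge is a simple arc joining its endpoints, and no edge passes through a vertex other than its endpoints; two distinct edges *cross* if they share a point that is not a vertex. The *outer cell* is the unbounded connected component of the complement of the drawing. A drawing is *outer-RAC* if every edge is a straight-line segment, every two crossing edges are perpendicular, and every vertex is incident to the outer cell (lies in its closure). A graph is *outer-RAC* if it admits an outer-RAC drawing. The *blocks* of a drawing are the connected components of its crossing graph (whose vertices are the edges of the graph, two being adjacent if they cross). A graph is a *bounded block graph* if it has a Hamiltonian cycle $H$ and a drawing such that the edges not in $H$ are drawn as straight-line segments, cross only at right angles and all belong to a single block, while the edges of $H$ (not necessarily straight) are crossing-free and their union is the boundary of the outer cell. **Theorem.** Let $G$ be an outer-RAC graph with $n\ge 2$ vertices and $m$ edges. Then $m\le \tfrac52 n-4$. Moreover, if $n\ge 3$ and $m=\tfrac52 n-4$, then $G$ is the union of a sequence of subgraphs $B_1,\dots,B_k$ such that each $B_i$ is a bounded block graph isomorphic to $K_4$ and, for every $2\le i\le k$, the intersection of $B_i$ with $B_1\cup\dots\cup B_{i-1}$ consists of exactly one edge together with its two endpoints.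 -/

import Mathlib

namespace OuterRAC

/-- The Euclidean plane. -/
abbrev Plane : Type := EuclideanSpace ℝ (Fin 2)

/-- `A` is a simple arc with endpoints `p` and `q`. -/
def IsArcBetween (p q : Plane) (A : Set Plane) : Prop :=
  ∃ γ : unitInterval → Plane, Continuous γ ∧ Function.Injective γ ∧
    γ 0 = p ∧ γ 1 = q ∧ Set.range γ = A

/-- A drawing of a simple graph in the plane: the vertices are distinct points, every edge is a
simple arc between its two endpoints, and no arc contains a vertex other than its endpoints.
(The value of `arc` on pairs that are not edges of `G` is irrelevant.) -/
structure Drawing {V : Type*} (G : SimpleGraph V) where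
  pos : V → Plane
  arc : Sym2 V → Set Plane
  pos_injective : Function.Injective pos
  isArc : ∀ u v : V, G.Adj u v → IsArcBetween (pos u) (pos v) (arc s(u, v))
  vertex_on_arc : ∀ u v w : V, G.Adj u v → pos w ∈ arc s(u, v) → w = u ∨ w = v

namespace Drawing

variable {V : Type*} {G : SimpleGraph V}

/-- The set of all points of the plane that are covered by the drawing. -/
def carrier (D : Drawing G) : Set Plane :=
  Set.range D.pos ∪ ⋃ e ∈ G.edgeSet, D.arc e

/-- The outer cell of a drawing of a finite graph: the unbounded connected component of the
complement of the drawing, given as the set of all points off the drawing whose connected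
component (in the complement) is unbounded. -/
def outerCell (D : Drawing G) : Set Plane :=
  {p | p ∈ D.carrierᶜ ∧ ¬ Bornology.IsBounded (connectedComponentIn D.carrierᶜ p)}

/-- The edge `e` is drawn as a straight-line segment. -/
def IsStraight (D : Drawing G) (e : Sym2 V) : Prop :=
  ∀ u v : V, e = s(u, v) → D.arc e = segment ℝ (D.pos u) (D.pos v)

/-- The crossing graph: its vertices are the edges of `G`, and two distinct edges are adjacent if
they cross, i.e. have a common point that is not a vertex. -/
def crossingGraph (D : Drawing G) : SimpleGraph G.edgeSet where
  Adj e f := e ≠ f ∧ ∃ p, p ∈ D.arc e ∧ p ∈ D.arc f ∧ p ∉ Set.range D.pos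
  symm := ⟨fun _ _ ⟨h, p, he, hf, hp⟩ => ⟨h.symm, p, hf, he, hp⟩⟩
  loopless := ⟨fun _ h => h.1 rfl⟩

/-- All crossings occur at a right angle. (Only used for drawings in which every edge that is
involved in a crossing is a straight-line segment.) -/
def RightAngleCrossings (D : Drawing G) : Prop :=
  ∀ (u v x y : V) (h : G.Adj u v) (h' : G.Adj x y),
    D.crossingGraph.Adj ⟨s(u, v), h⟩ ⟨s(x, y), h'⟩ →
      inner ℝ (D.pos v - D.pos u) (D.pos y - D.pos x) = 0

/-- A block of the drawing: a connected component of the crossing graph. -/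
abbrev Block (D : Drawing G) : Type _ := D.crossingGraph.ConnectedComponent

/-- Outer-RAC drawings: every edge is a straight-line segment, all crossings occur at a right
angle, and every vertex is incident to the outer cell. -/
structure IsOuterRAC (D : Drawing G) : Prop where
  straight : ∀ e ∈ G.edgeSet, D.IsStraight e
  right_angle : D.RightAngleCrossings
  outer : ∀ v : V, D.pos v ∈ closure D.outerCell

open scoped Classical in
/-- `D` is a bounded block drawing with respect to the Hamiltonian cycle `H`; here the edge set
`E_c` consists of all the edges of `G` that are not edges of `H`. -/
structure IsBoundedBlock (D : Drawing G) {a : V} (H : G.Walk a a) : Prop where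
  hamiltonian : H.IsHamiltonianCycle
  straight : ∀ e ∈ G.edgeSet, e ∉ H.edges → D.IsStraight e
  right_angle : D.RightAngleCrossings
  crossing_free : ∀ e f : G.edgeSet, (e : Sym2 V) ∈ H.edges → ¬ D.crossingGraph.Adj e f
  outer_boundary : frontier D.outerCell = ⋃ e ∈ H.edges, D.arc e
  single_block : ∃ B : D.Block, ∀ e : G.edgeSet, (e : Sym2 V) ∉ H.edges → e ∈ B.supp

end Drawing

/-- A graph is outer-RAC if it admits an outer-RAC drawing. -/
def IsOuterRACGraph {V : Type*} (G : SimpleGraph V) : Prop :=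
  ∃ D : Drawing G, D.IsOuterRAC

/-- A graph is a bounded block graph if it has a Hamiltonian cycle `H` and a bounded block drawing
with respect to `H`. -/
def IsBoundedBlockGraph {V : Type*} (G : SimpleGraph V) : Prop :=
  ∃ (a : V) (H : G.Walk a a) (D : Drawing G), D.IsBoundedBlock H

/-- `G` is decomposed into the bounded block graphs `B 0, …, B (k - 1)`: they are
subgraphs whose union is `G`, each of them is a bounded block graph isomorphic to `K₄`, and each of
them, except for the first one, intersects the union of the previous ones in exactly
one edge (with its two endpoints). -/
structure IsK4BlockDecomposition {V : Type*} (G : SimpleGraph V) {k : ℕ}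
    (B : Fin k → G.Subgraph) : Prop where
  union : ⨆ i, B i = ⊤
  bounded_block : ∀ i, IsBoundedBlockGraph (B i).coe
  iso_K4 : ∀ i, Nonempty ((B i).coe ≃g (⊤ : SimpleGraph (Fin 4)))
  share_edge : ∀ i : Fin k, 0 < i.val →
    ∃ (u v : V) (h : G.Adj u v), B i ⊓ (⨆ j : Fin k, ⨆ _ : j < i, B j) = G.subgraphOfAdj h

end OuterRAC

/-! Two properties of an outer-RAC drawing carry the proof. Since every vertex lies on the outer
cell, the vertices have a circular order, cut open to a linear one, in which edges with alternating
ends must meet (`exists_order`). Since crossings are perpendicular, no edge crosses two edges with a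
common end: both crossing points would be the foot of the perpendicular from that end, and one of
the two edges would pass through the far end of the other (`eq_of_crossAt`). The edges thus become a
fan-free set `E` of chords on `n` points of a line.

For the order, the vertices are joined to a large circle by disjoint nonseparating continua, and the
angles of the ends on the circle are compared. Separation is handled by Borsuk's criterion: a
compact set `K` leaves `p` in an unbounded component of the complement exactly when `z - p` has a
continuous logarithm on `K`. Logarithms on closed sets with connected intersection can be glued.

For the bound, a noncrossing `H ⊆ E` is chosen greedily by increasing left end, so every chord
outside `H` is crossed from the left by a chord of `H`. If `F` of the `n - 2` inner points are
"first" (`IsFirst`), then `|H| ≤ n - 1 + F`. A chord outside `H` is charged to its left end and to a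
second point: its right end if it blocks a chord of `H`, otherwise the right end of its outermost
blocker. Fan-freeness makes the charged points distinct, apart from the second charge of chords that
are not last through their outermost blocker. Those end at points that are not first, at most two at
each. So `2|E \ H| ≤ (n - 2) + 2(n - 2 - F)`, and `F` cancels in the sum: `2|E| ≤ 5n - 8`.

In the case of equality every inner point is first, so `H` is a triangulation with `2n - 3` chords.
Each remaining chord is then the diagonal of a quadrilateral of `H` whose sides are uncrossed.
Cutting along such a side leaves two extremal systems, and induction gives the chain of `K₄`s. Each
`K₄`, drawn as a square with its diagonals, is a bounded block graph. -/

namespace OuterRAC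

/-! ### Continuous logarithms and Borsuk's criterion. -/

open Set Topology Filter

/-- `F` has a continuous logarithm on `K`. -/
def HasLog (K : Set ℂ) (F : ℂ → ℂ) : Prop :=
  ∃ g : ℂ → ℂ, ContinuousOn g K ∧ ∀ z ∈ K, Complex.exp (g z) = F z

theorem HasLog.mono {K L : Set ℂ} {F : ℂ → ℂ} (h : HasLog L F) (hKL : K ⊆ L) : HasLog K F := by
  obtain ⟨g, hg, hg'⟩ := h
  exact ⟨g, hg.mono hKL, fun z hz => hg' z (hKL hz)⟩

theorem HasLog.congr {K : Set ℂ} {F G : ℂ → ℂ} (h : HasLog K F) (hFG : ∀ z ∈ K, F z = G z) :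
    HasLog K G := by
  obtain ⟨g, hg, hg'⟩ := h
  exact ⟨g, hg, fun z hz => (hg' z hz).trans (hFG z hz)⟩

theorem HasLog.mul {K : Set ℂ} {F G : ℂ → ℂ} (hF : HasLog K F) (hG : HasLog K G) :
    HasLog K (fun z => F z * G z) := by
  obtain ⟨f, hf, hf'⟩ := hF
  obtain ⟨g, hg, hg'⟩ := hG
  exact ⟨fun z => f z + g z, hf.add hg, fun z hz => by rw [Complex.exp_add, hf' z hz, hg' z hz]⟩

theorem HasLog.of_slitPlane {K : Set ℂ} {F : ℂ → ℂ} (hF : ContinuousOn F K)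
    (h : ∀ z ∈ K, F z ∈ Complex.slitPlane) : HasLog K F :=
  ⟨fun z => Complex.log (F z), hF.clog h,
    fun z hz => Complex.exp_log (Complex.slitPlane_ne_zero (h z hz))⟩

theorem HasLog.const (K : Set ℂ) {c : ℂ} (hc : c ≠ 0) : HasLog K (fun _ => c) :=
  ⟨fun _ => Complex.log c, continuousOn_const, fun _ _ => Complex.exp_log hc⟩

/-- A continuous function with constant exponential on a preconnected set is constant. -/
theorem eq_of_exp_eq_one {X : Type*} [TopologicalSpace X] {S : Set X} (hS : IsPreconnected S)
    {f : X → ℂ} (hf : ContinuousOn f S) (h : ∀ x ∈ S, Complex.exp (f x) = 1) {x y : X}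
    (hx : x ∈ S) (hy : y ∈ S) : f x = f y := by
  have hpi : (2 * Real.pi : ℝ) ≠ 0 := by positivity
  have key : ∀ x ∈ S, ∃ n : ℤ, f x = n * (2 * Real.pi * Complex.I) := fun x hx =>
    Complex.exp_eq_one_iff.1 (h x hx)
  -- The values of `f` lie in `2πiℤ`, so `g` is continuous and integer-valued, hence constant.
  let g : X → ℝ := fun x => (f x).im / (2 * Real.pi)
  have hg : ContinuousOn g S :=
    (Complex.continuous_im.comp_continuousOn hf).div_const _
  have hgn : ∀ x ∈ S, ∀ n : ℤ, f x = n * (2 * Real.pi * Complex.I) → g x = n := by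
    intro x _ n hn
    simp only [g, hn]
    have : ((n : ℂ) * (2 * Real.pi * Complex.I)).im = n * (2 * Real.pi) := by
      simp
    rw [this]; field_simp
  have hd : IsDiscrete (Set.range ((↑) : ℤ → ℝ)) := by
    rw [isDiscrete_iff_discreteTopology]
    exact Int.isClosedEmbedding_coe_real.isEmbedding.toHomeomorph.symm.isEmbedding.discreteTopology
  have hm : MapsTo g S (Set.range ((↑) : ℤ → ℝ)) := fun x hx => by
    obtain ⟨n, hn⟩ := key x hx
    exact ⟨n, (hgn x hx n hn).symm⟩
  have hgxy := hS.constant_of_mapsTo hd hg hm hx hy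
  obtain ⟨n, hn⟩ := key x hx
  obtain ⟨m, hm⟩ := key y hy
  rw [hgn x hx n hn, hgn y hy m hm] at hgxy
  rw [hn, hm, Int.cast_injective hgxy]

/-- Logarithms on two closed sets with preconnected intersection can be glued. -/
theorem HasLog.union {K L : Set ℂ} {F : ℂ → ℂ} (hK : IsClosed K) (hL : IsClosed L)
    (hKL : IsPreconnected (K ∩ L)) (h1 : HasLog K F) (h2 : HasLog L F) :
    HasLog (K ∪ L) F := by
  classical
  obtain ⟨f, hf, hf'⟩ := h1
  obtain ⟨g, hg, hg'⟩ := h2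
  -- On the preconnected intersection the two logarithms differ by a single period `c`, so `f` and
  -- `g + c` agree there.
  obtain ⟨c, hc1, hc⟩ : ∃ c : ℂ, Complex.exp c = 1 ∧ ∀ z ∈ K ∩ L, f z = g z + c := by
    rcases (K ∩ L).eq_empty_or_nonempty with h | ⟨w, hw⟩
    · exact ⟨0, Complex.exp_zero, by simp [h]⟩
    · have h1 : ∀ z ∈ K ∩ L, Complex.exp (f z - g z) = 1 := fun z hz => by
        rw [Complex.exp_sub, hf' z hz.1, hg' z hz.2, div_self]
        rw [← hf' z hz.1]; exact Complex.exp_ne_zero _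
      refine ⟨f w - g w, h1 w hw, fun z hz => ?_⟩
      have := eq_of_exp_eq_one hKL (f := fun z => f z - g z)
        ((hf.mono inter_subset_left).sub (hg.mono inter_subset_right)) h1 hz hw
      rw [← this]; ring
  have hEqL : EqOn (K.piecewise f (fun z => g z + c)) (fun z => g z + c) L := fun z hz => by
    by_cases hzK : z ∈ K
    · rw [piecewise_eq_of_mem _ _ _ hzK, hc z ⟨hzK, hz⟩]
    · rw [piecewise_eq_of_notMem _ _ _ hzK]
  refine ⟨K.piecewise f (fun z => g z + c), ContinuousOn.union_of_isClosed
    (hf.congr (piecewise_eqOn _ _ _)) ((hg.add continuousOn_const).congr hEqL) hK hL, ?_⟩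
  rintro z (hz | hz)
  · rw [piecewise_eq_of_mem _ _ _ hz, hf' z hz]
  · rw [hEqL hz, Complex.exp_add, hg' z hz, hc1, mul_one]

/-- The quotient differs from `1` by `(q - p) / (z - q)`, of norm below `1`, so the principal branch
applies. -/
theorem hasLog_div_of_dist_lt {K : Set ℂ} {p q : ℂ} (h : ∀ z ∈ K, dist p q < dist z q) :
    HasLog K (fun z => (z - p) / (z - q)) := by
  have hne : ∀ z ∈ K, z - q ≠ 0 := fun z hz h0 => by
    have h1 := h z hz
    rw [sub_eq_zero.1 h0, dist_self] at h1
    exact absurd h1 (not_lt.2 dist_nonneg)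
  refine HasLog.of_slitPlane ?_ fun z hz => ?_
  · exact ContinuousOn.div (by fun_prop) (by fun_prop) hne
  · apply Complex.ball_one_subset_slitPlane
    have h1 : (z - p) / (z - q) - 1 = (q - p) / (z - q) := by
      field_simp [hne z hz]; ring
    rw [Metric.mem_ball, dist_eq_norm, h1, norm_div, div_lt_one (norm_pos_iff.2 (hne z hz)),
      ← dist_eq_norm, ← dist_eq_norm, dist_comm]
    exact h z hz

/-- Two points that are not separated by `K`: the quotient has a logarithm. -/
theorem hasLog_div_of_isPreconnected {K S : Set ℂ} (hK : IsClosed K) (hS : IsPreconnected S)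
    (hSK : Disjoint S K) {p q : ℂ} (hp : p ∈ S) (hq : q ∈ S) :
    HasLog K (fun z => (z - p) / (z - q)) := by
  -- Moving a point slightly off `K` changes `z - a` by a factor with a logarithm, so having a
  -- logarithm is an open and closed condition on the points off `K`. The radius `ε / 2` makes the
  -- estimate work in both directions.
  have hloc : ∀ a ∉ K, ∃ ε > 0, ∀ b ∈ Metric.ball a ε, b ∉ K ∧
      HasLog K (fun z => (z - b) / (z - a)) ∧ HasLog K (fun z => (z - a) / (z - b)) := by
    intro a ha
    obtain ⟨ε, hε, hb⟩ := Metric.isOpen_iff.1 hK.isOpen_compl a ha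
    refine ⟨ε / 2, by positivity, fun b hb' => ⟨hb (Metric.ball_subset_ball (by linarith) hb'),
      ?_, ?_⟩⟩
    · refine hasLog_div_of_dist_lt fun z hz => ?_
      have : ¬ dist z a < ε := fun h => hb h hz
      rw [Metric.mem_ball] at hb'
      linarith
    · refine hasLog_div_of_dist_lt fun z hz => ?_
      have : ¬ dist z a < ε := fun h => hb h hz
      rw [Metric.mem_ball] at hb'
      have := dist_triangle z b a
      rw [dist_comm a b]
      linarith
  have htrans : ∀ a b c : ℂ, b ∉ K → HasLog K (fun z => (z - a) / (z - b)) →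
      HasLog K (fun z => (z - b) / (z - c)) → HasLog K (fun z => (z - a) / (z - c)) := by
    intro a b c hb h1 h2
    refine (h1.mul h2).congr fun z hz => ?_
    have : z - b ≠ 0 := fun h => hb (by rwa [← sub_eq_zero.1 h])
    field_simp
  have hSc : S ⊆ Kᶜ := fun x hx hxK => hSK.ne_of_mem hx hxK rfl
  let A : Set ℂ := {b | b ∈ Kᶜ ∧ HasLog K (fun z => (z - b) / (z - q))}
  let B : Set ℂ := {b | b ∈ Kᶜ ∧ ¬ HasLog K (fun z => (z - b) / (z - q))}
  have hA : IsOpen A := Metric.isOpen_iff.2 fun a ha => by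
    obtain ⟨ε, hε, h⟩ := hloc a ha.1
    exact ⟨ε, hε, fun b hb => ⟨(h b hb).1, htrans b a q ha.1 (h b hb).2.1 ha.2⟩⟩
  have hB : IsOpen B := Metric.isOpen_iff.2 fun a ha => by
    obtain ⟨ε, hε, h⟩ := hloc a ha.1
    exact ⟨ε, hε, fun b hb => ⟨(h b hb).1, fun hb' =>
      ha.2 (htrans a b q (h b hb).1 (h b hb).2.2 hb')⟩⟩
  have hAB : Disjoint A B := Set.disjoint_left.2 fun x hx hx' => hx'.2 hx.2
  have hqA : q ∈ A := ⟨hSc hq, (HasLog.const K one_ne_zero).congr fun z hz => by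
    rw [div_self]; exact fun h => hSc hq (by rwa [← sub_eq_zero.1 h])⟩
  have hsub : S ⊆ A := hS.subset_left_of_subset_union hA hB hAB
    (fun x hx => by
      by_cases h : HasLog K (fun z => (z - x) / (z - q))
      · exact Or.inl ⟨hSc hx, h⟩
      · exact Or.inr ⟨hSc hx, h⟩) ⟨q, hq, hqA⟩
  exact (hsub hp).2

/-- After division by `-q` the function is `1 - z / q`, which stays in the unit disc about `1`. -/
theorem hasLog_of_norm_lt {K : Set ℂ} {q : ℂ} (h : ∀ z ∈ K, ‖z‖ < ‖q‖) :
    HasLog K (fun z => z - q) := by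
  rcases K.eq_empty_or_nonempty with rfl | ⟨w, hw⟩
  · exact ⟨fun _ => 0, continuousOn_const, by simp⟩
  have hq : q ≠ 0 := norm_pos_iff.1 ((norm_nonneg w).trans_lt (h w hw))
  have h1 : HasLog K (fun z => (z - q) / (-q)) := by
    refine HasLog.of_slitPlane (by fun_prop) fun z hz => ?_
    apply Complex.ball_one_subset_slitPlane
    have : (z - q) / (-q) - 1 = - (z / q) := by field_simp; ring
    rw [Metric.mem_ball, dist_eq_norm, this, norm_neg, norm_div, div_lt_one (norm_pos_iff.2 hq)]
    exact h z hz
  refine (h1.mul (HasLog.const K (neg_ne_zero.2 hq))).congr fun z _ => ?_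
  field_simp

/-- If `p` is joined to points of arbitrarily large norm off `K`, then `z - p` has a logarithm
on `K`. -/
theorem hasLog_of_not_isBounded {K S : Set ℂ} (hK : IsCompact K) (hS : IsPreconnected S)
    (hSK : Disjoint S K) (hSb : ¬ Bornology.IsBounded S) {p : ℂ} (hp : p ∈ S) :
    HasLog K (fun z => z - p) := by
  obtain ⟨R, hR⟩ := hK.isBounded.exists_norm_le
  obtain ⟨q, hq, hqR⟩ : ∃ q ∈ S, R < ‖q‖ := by
    by_contra! h
    exact hSb (isBounded_iff_forall_norm_le.2 ⟨R, h⟩)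
  refine ((hasLog_div_of_isPreconnected hK.isClosed hS hSK hp hq).mul
    (hasLog_of_norm_lt (K := K) (q := q) fun z hz => (hR z hz).trans_lt hqR)).congr
    fun z hz => ?_
  have : z - q ≠ 0 := fun h => hSK.ne_of_mem hq hz (sub_eq_zero.1 h).symm
  field_simp

/-- On a circle around `p` the function `z - p` has no continuous logarithm. -/
theorem not_hasLog_sphere {R : ℝ} {p : ℂ} (hp : ‖p‖ < R) :
    ¬ HasLog (Metric.sphere (0 : ℂ) R) (fun z => z - p) := by
  intro h
  have hR : 0 < R := (norm_nonneg p).trans_lt hp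
  -- Both `p` and the centre lie in the open disc, which misses the circle, so `p` may be replaced
  -- by `0`.
  have h0 : HasLog (Metric.sphere (0 : ℂ) R) (fun z => z) := by
    have h1 : HasLog (Metric.sphere (0 : ℂ) R) (fun z => (z - 0) / (z - p)) := by
      refine hasLog_div_of_isPreconnected Metric.isClosed_sphere
        (convex_ball (0 : ℂ) R).isPreconnected ?_ (Metric.mem_ball_self hR)
        (mem_ball_zero_iff.2 hp)
      exact Metric.sphere_disjoint_ball.symm
    refine (h1.mul h).congr fun z hz => ?_
    have : z - p ≠ 0 := fun h => by
      rw [mem_sphere_zero_iff_norm, sub_eq_zero.1 h] at hz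
      exact hp.ne hz
    field_simp; simp
  obtain ⟨g, hg, hg'⟩ := h0
  let c : ℝ → ℂ := fun t => R * Complex.exp (t * Complex.I)
  have hc : ∀ t, c t ∈ Metric.sphere (0 : ℂ) R := fun t => by
    simp [c, Complex.norm_exp_ofReal_mul_I, abs_of_pos hR]
  have hcc : Continuous c := by fun_prop
  -- This function would be constant, but the term `t * I` changes by `2πi` over one turn while `g
  -- (c t)` returns to its value.
  have hcont : ContinuousOn (fun t : ℝ => g (c t) - t * Complex.I - Complex.log R) univ := by
    apply Continuous.continuousOn
    have h1 : Continuous fun t => g (c t) := hg.comp_continuous hcc hc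
    exact (h1.sub (by fun_prop)).sub continuous_const
  have hR' : (R : ℂ) ≠ 0 := by exact_mod_cast hR.ne'
  have hone : ∀ t ∈ (univ : Set ℝ),
      Complex.exp (g (c t) - t * Complex.I - Complex.log R) = 1 := fun t _ => by
    rw [Complex.exp_sub, Complex.exp_sub, hg' _ (hc t), Complex.exp_log hR']
    simp only [c]
    have := Complex.exp_ne_zero (t * Complex.I)
    field_simp
  have := eq_of_exp_eq_one isPreconnected_univ hcont hone (mem_univ 0) (mem_univ (2 * Real.pi))
  have hcp : c (2 * Real.pi) = c 0 := by
    simp [c, Complex.exp_two_pi_mul_I]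
  simp only [hcp] at this
  simp only [Complex.ofReal_zero, zero_mul, sub_zero, Complex.ofReal_mul,
    Complex.ofReal_ofNat] at this
  exact Complex.two_pi_I_ne_zero (by linear_combination this)

/-- Borsuk's criterion: if `z - p` has a continuous logarithm on the compact set `K`, then `K` does
not separate `p` from infinity. -/
theorem not_isBounded_of_hasLog {K : Set ℂ} (hK : IsCompact K) {p : ℂ} (hp : p ∉ K)
    (h : HasLog K (fun z => z - p)) :
    ¬ Bornology.IsBounded (connectedComponentIn Kᶜ p) := by
  classical
  intro hb
  set Q := connectedComponentIn Kᶜ p with hQ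
  have hQo : IsOpen Q := hK.isClosed.isOpen_compl.connectedComponentIn
  have hQK : closure Q \ Q ⊆ K := by
    rintro x ⟨hx, hxQ⟩
    by_contra hxK
    have h2 : IsPreconnected (insert x Q) :=
      isPreconnected_connectedComponentIn.subset_closure (subset_insert _ _)
        (insert_subset hx subset_closure)
    exact hxQ (h2.subset_connectedComponentIn (mem_insert_of_mem _ (mem_connectedComponentIn hp))
      (insert_subset hxK (connectedComponentIn_subset _ _)) (mem_insert _ _))
  obtain ⟨g, hg, hg'⟩ := h
  obtain ⟨G, hG⟩ := ContinuousMap.exists_restrict_eq hK.isClosed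
    (⟨K.domRestrict g, continuousOn_iff_continuous_domRestrict.1 hg⟩ : C(K, ℂ))
  have hGg : ∀ z ∈ K, G z = g z := fun z hz => congr($hG ⟨z, hz⟩)
  -- Here `G` is a Tietze extension of the logarithm. The two formulas agree on the frontier of `Q`,
  -- which lies in `K`, and `z - p` vanishes only inside `Q`. So `F` is continuous without zeros on
  -- the whole plane and has a logarithm, although it equals `z - p` on a large circle around `p`.
  let F : ℂ → ℂ := (closure Q).piecewise (fun z => Complex.exp (G z)) (fun z => z - p)
  have hF : Continuous F := by
    refine Continuous.piecewise (fun z hz => ?_) (by fun_prop) (by fun_prop)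
    have hzK : z ∈ K := hQK ⟨isClosed_closure.frontier_subset hz, fun hzQ => by
      rw [← closure_sdiff_interior] at hz
      exact hz.2 (interior_mono subset_closure (by rwa [hQo.interior_eq]))⟩
    rw [hGg z hzK, hg' z hzK]
  have hF0 : (0 : ℂ) ∉ F '' univ := by
    rintro ⟨z, -, hz⟩
    by_cases hzQ : z ∈ closure Q
    · simp only [F, piecewise_eq_of_mem _ _ _ hzQ] at hz
      exact Complex.exp_ne_zero _ hz
    · simp only [F, piecewise_eq_of_notMem _ _ _ hzQ] at hz
      exact hzQ (subset_closure (by rw [sub_eq_zero.1 hz]; exact mem_connectedComponentIn hp))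
  obtain ⟨f, hf, hf'⟩ := Complex.exists_continuousOn_eqOn_exp_comp
    (U := univ) 
    ((Homeomorph.Set.univ ℂ).toHomotopyEquiv.simplyConnectedSpace_iff.2 inferInstance)
    isOpen_univ hF.continuousOn hF0
  obtain ⟨R, hR⟩ := hb.exists_norm_le
  have hpR : ‖p‖ ≤ R := hR p (mem_connectedComponentIn hp)
  refine not_hasLog_sphere (R := R + 1) (p := p) (by linarith)
    ⟨f, hf.mono (subset_univ _), fun z hz => ?_⟩
  have hzQ : z ∉ closure Q := fun hz' => by
    have : closure Q ⊆ Metric.closedBall 0 R :=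
      closure_minimal (fun w hw => mem_closedBall_zero_iff.2 (hR w hw)) Metric.isClosed_closedBall
    have := mem_closedBall_zero_iff.1 (this hz')
    rw [mem_sphere_zero_iff_norm] at hz
    linarith
  have := hf' (mem_univ z)
  simpa [F, piecewise_eq_of_notMem _ _ _ hzQ] using this

end OuterRAC

/-! ### Nonseparating continua as a substitute for arcs. -/

namespace OuterRAC

open Set Topology Filter

theorem isCompact_segment (a b : ℂ) : IsCompact (segment ℝ a b) := by
  rw [segment_eq_image_lineMap]
  exact isCompact_Icc.image AffineMap.lineMap_continuous

/-- The quotient `(z - p) / (a - p)` is real and nonpositive only if `p` lies between `a` and `z`,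
so on the segment it stays in the slit plane. -/
theorem hasLog_segment {a b p : ℂ} (hp : p ∉ segment ℝ a b) :
    HasLog (segment ℝ a b) (fun z => z - p) := by
  have hap : a - p ≠ 0 := fun h => hp (by rw [← sub_eq_zero.1 h]; exact left_mem_segment ℝ a b)
  have h1 : HasLog (segment ℝ a b) (fun z => (z - p) / (a - p)) := by
    refine HasLog.of_slitPlane (by fun_prop) fun z hz => ?_
    by_contra hsl
    rw [Complex.mem_slitPlane_iff_not_le_zero, not_not, Complex.le_def] at hsl
    obtain ⟨hre, him⟩ := hsl
    set r := (z - p) / (a - p) with hr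
    have hrr : r = (r.re : ℂ) := Complex.ext rfl (by simpa using him)
    have hz' : z - p = r.re * (a - p) := by
      rw [← hrr, hr]; field_simp
    simp only [Complex.zero_re] at hre
    have hpz : p ∈ segment ℝ a z := by
      refine ⟨-r.re / (1 - r.re), 1 / (1 - r.re), div_nonneg (by linarith) (by linarith),
        div_nonneg zero_le_one (by linarith), ?_, ?_⟩
      · have : 1 - r.re ≠ 0 := by linarith
        field_simp; ring
      · have h1 : (1 - r.re : ℂ) ≠ 0 := by
          have : (1 - r.re : ℝ) ≠ 0 := by linarith
          exact_mod_cast this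
        simp only [Complex.real_smul]
        push_cast
        field_simp
        linear_combination hz'
    exact hp ((convex_segment a b).segment_subset (left_mem_segment ℝ a b) hz hpz)
  refine (h1.mul (HasLog.const _ hap)).congr fun z _ => ?_
  field_simp

/-- A continuum in the plane that does not separate the plane. -/
structure IsTree (T : Set ℂ) : Prop where
  isCompact : IsCompact T
  isConnected : IsConnected T
  hasLog : ∀ p ∉ T, HasLog T (fun z => z - p)

theorem isTree_segment (a b : ℂ) : IsTree (segment ℝ a b) :=
  ⟨isCompact_segment a b, ⟨⟨a, left_mem_segment ℝ a b⟩, (convex_segment a b).isPreconnected⟩,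
    fun _ hp => hasLog_segment hp⟩

theorem isTree_singleton (a : ℂ) : IsTree {a} := by
  simpa using isTree_segment a a

/-- On the way from `b` to a point of the closed set `T` there is a first point of `T`. -/
theorem exists_segment_inter_eq_singleton {T : Set ℂ} (hT : IsClosed T) {a : ℂ} (ha : a ∈ T)
    (b : ℂ) : ∃ x ∈ segment ℝ b a, segment ℝ b x ∩ T = {x} := by
  let S : Set ℝ := Icc 0 1 ∩ (AffineMap.lineMap b a : ℝ → ℂ) ⁻¹' T
  have hS : IsCompact S :=
    isCompact_Icc.inter_right (hT.preimage AffineMap.lineMap_continuous)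
  have hne : S.Nonempty := ⟨1, by simp [S, ha]⟩
  obtain ⟨t, ⟨ht, htT⟩, hmin⟩ := hS.exists_isLeast hne
  refine ⟨AffineMap.lineMap b a t, ?_, ?_⟩
  · rw [segment_eq_image_lineMap]; exact ⟨t, ht, rfl⟩
  · apply Subset.antisymm
    · rintro y ⟨hy, hyT⟩
      rw [segment_eq_image_lineMap] at hy
      obtain ⟨s, hs, rfl⟩ := hy
      rw [AffineMap.lineMap_lineMap_right] at hyT ⊢
      have h1 : t ≤ t * s ∨ s = 1 ∨ t = 0 := Or.inl (by
        rw [mul_comm]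
        exact hmin ⟨⟨mul_nonneg hs.1 ht.1, mul_le_one₀ hs.2 ht.1 ht.2⟩, hyT⟩)
      have h2 : s * t = t := by
        rcases h1 with h | rfl | rfl
        · have := mul_le_of_le_one_right ht.1 hs.2
          linarith [mul_comm s t]
        · simp
        · simp
      rw [h2]; rfl
    · rintro y rfl
      exact ⟨right_mem_segment _ _ _, htT⟩

/-- A single common point is a connected intersection, so logarithms glue and the union still does
not separate the plane. -/
theorem IsTree.union {S T : Set ℂ} (hS : IsTree S) (hT : IsTree T) {x : ℂ}
    (hx : S ∩ T = {x}) : IsTree (S ∪ T) where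
  isCompact := hS.isCompact.union hT.isCompact
  isConnected := hS.isConnected.union (by rw [hx]; exact singleton_nonempty x) hT.isConnected
  hasLog p hp := HasLog.union hS.isCompact.isClosed hT.isCompact.isClosed
    (by rw [hx]; exact isPreconnected_singleton) (hS.hasLog p fun h => hp (Or.inl h))
    (hT.hasLog p fun h => hp (Or.inr h))

/-- A tree can be extended along a segment, up to the first hit. -/
theorem IsTree.exists_extend {T : Set ℂ} (hT : IsTree T) {a : ℂ} (ha : a ∈ T) (b : ℂ) :
    ∃ x ∈ segment ℝ b a, x ∈ T ∧ IsTree (segment ℝ b x ∪ T) := by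
  obtain ⟨x, hx, hxT⟩ := exists_segment_inter_eq_singleton hT.isCompact.isClosed ha b
  have : x ∈ segment ℝ b x ∩ T := by rw [hxT]; rfl
  exact ⟨x, hx, this.2, (isTree_segment b x).union hT hxT⟩

theorem segment_subset_of_mem {a b x : ℂ} (h : x ∈ segment ℝ b a) :
    segment ℝ b x ⊆ segment ℝ b a :=
  (convex_segment b a).segment_subset (left_mem_segment ℝ b a) h

/-- Two points in the same component of an open set are joined by a tree. -/
theorem exists_isTree_of_mem_connectedComponentIn {U : Set ℂ} (hU : IsOpen U) {p q : ℂ}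
    (hp : p ∈ U) (hq : q ∈ connectedComponentIn U p) :
    ∃ T, IsTree T ∧ T ⊆ U ∧ p ∈ T ∧ q ∈ T := by
  let R : ℂ → Prop := fun q => ∃ T, IsTree T ∧ T ⊆ U ∧ p ∈ T ∧ q ∈ T
  have hstep : ∀ a b, R a → segment ℝ b a ⊆ U → R b := by
    rintro a b ⟨T, hT, hTU, hpT, haT⟩ hab
    obtain ⟨x, hx, -, hT'⟩ := hT.exists_extend haT b
    exact ⟨_, hT', union_subset ((segment_subset_of_mem hx).trans hab) hTU, Or.inr hpT,
      Or.inl (left_mem_segment ℝ b x)⟩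
  -- Within a ball inside `U` the property `R` is constant, so it cannot change along the component
  -- of `p`.
  have hball : ∀ a ∈ U, ∃ ε > 0, Metric.ball a ε ⊆ U ∧ ∀ b ∈ Metric.ball a ε,
      (R a ↔ R b) := by
    intro a ha
    obtain ⟨ε, hε, hb⟩ := Metric.isOpen_iff.1 hU a ha
    refine ⟨ε, hε, hb, fun b hb' => ⟨fun h => hstep a b h ?_, fun h => hstep b a h ?_⟩⟩
    · exact ((convex_ball a ε).segment_subset hb' (Metric.mem_ball_self hε)).trans hb
    · exact ((convex_ball a ε).segment_subset (Metric.mem_ball_self hε) hb').trans hb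
  have hA : IsOpen {b | b ∈ U ∧ R b} := Metric.isOpen_iff.2 fun a ha => by
    obtain ⟨ε, hε, h1, h2⟩ := hball a ha.1
    exact ⟨ε, hε, fun b hb => ⟨h1 hb, (h2 b hb).1 ha.2⟩⟩
  have hB : IsOpen {b | b ∈ U ∧ ¬ R b} := Metric.isOpen_iff.2 fun a ha => by
    obtain ⟨ε, hε, h1, h2⟩ := hball a ha.1
    exact ⟨ε, hε, fun b hb => ⟨h1 hb, fun h => ha.2 ((h2 b hb).2 h)⟩⟩
  have hpR : R p := ⟨{p}, isTree_singleton p, by simpa using hp, rfl, rfl⟩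
  have := isPreconnected_connectedComponentIn.subset_left_of_subset_union hA hB
    (Set.disjoint_left.2 fun x hx hx' => hx'.2 hx.2)
    (fun x hx => by
      have hxU := connectedComponentIn_subset U p hx
      by_cases h : R x
      · exact Or.inl ⟨hxU, h⟩
      · exact Or.inr ⟨hxU, h⟩)
    ⟨p, mem_connectedComponentIn hp, hp, hpR⟩
  exact (this hq).2

/-- The points off `K` that are not separated from infinity by `K`. -/
def unboundedPart (K : Set ℂ) : Set ℂ :=
  {p | p ∈ Kᶜ ∧ ¬ Bornology.IsBounded (connectedComponentIn Kᶜ p)}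

theorem hasLog_of_mem_unboundedPart {K : Set ℂ} (hK : IsCompact K) {p : ℂ}
    (hp : p ∈ unboundedPart K) : HasLog K (fun z => z - p) :=
  hasLog_of_not_isBounded hK isPreconnected_connectedComponentIn
    (Set.disjoint_left.2 fun _ hx => connectedComponentIn_subset _ _ hx) hp.2
    (mem_connectedComponentIn hp.1)

/-- A tree that meets `K` in a single point does not enclose any new points. -/
theorem mem_unboundedPart_union {K T : Set ℂ} (hK : IsCompact K) (hT : IsTree T) {v : ℂ}
    (hv : K ∩ T = {v}) {p : ℂ} (hp : p ∈ unboundedPart K) (hpT : p ∉ T) :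
    p ∈ unboundedPart (K ∪ T) := by
  have hpKT : p ∉ K ∪ T := fun h => h.elim hp.1 hpT
  exact ⟨hpKT, not_isBounded_of_hasLog (hK.union hT.isCompact) hpKT
    (HasLog.union hK.isClosed hT.isCompact.isClosed (by rw [hv]; exact isPreconnected_singleton)
      (hasLog_of_mem_unboundedPart hK hp) (hT.hasLog p hpT))⟩

theorem segment_subset_ball_union {p c : ℂ} {R : ℝ} (hp : ‖p‖ = R) (hc : ‖c‖ < R) :
    segment ℝ p c ⊆ Metric.ball 0 R ∪ {p} := by
  rintro z ⟨s, t, hs, ht, hst, rfl⟩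
  rcases ht.eq_or_lt with rfl | ht'
  · right
    have : s = 1 := by linarith
    simp [this]
  · left
    rw [mem_ball_zero_iff]
    calc ‖s • p + t • c‖ ≤ ‖s • p‖ + ‖t • c‖ := norm_add_le _ _
      _ = s * R + t * ‖c‖ := by rw [norm_smul, norm_smul, Real.norm_of_nonneg hs,
          Real.norm_of_nonneg ht, hp]
      _ < s * R + t * R := by gcongr
      _ = R := by rw [← add_mul, hst, one_mul]

/-- Points of the unbounded part are joined to a large circle by a tree. -/
theorem exists_isTree_to_sphere {K : Set ℂ} {R : ℝ} (hK : IsCompact K) {q : ℂ}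
    (hq : q ∈ unboundedPart K) (hqR : ‖q‖ < R) :
    ∃ T p, IsTree T ∧ q ∈ T ∧ p ∈ T ∧ ‖p‖ = R ∧ T ⊆ Metric.ball 0 R ∪ {p} ∧ Disjoint T K := by
  set U := Metric.ball (0 : ℂ) R ∩ Kᶜ with hU
  have hUo : IsOpen U := Metric.isOpen_ball.inter hK.isClosed.isOpen_compl
  have hqU : q ∈ U := ⟨mem_ball_zero_iff.2 hqR, hq.1⟩
  set C := connectedComponentIn U q with hC
  have hCU : C ⊆ U := connectedComponentIn_subset U q
  have hqC : q ∈ C := mem_connectedComponentIn hqU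
  have hCo : IsOpen C := hUo.connectedComponentIn
  have hclos : ∀ x ∈ closure C, x ∈ U → x ∈ C := fun x hx hxU =>
    (isPreconnected_connectedComponentIn.subset_closure (subset_insert x C)
      (insert_subset hx subset_closure)).subset_connectedComponentIn (mem_insert_of_mem _ hqC)
      (insert_subset hxU hCU) (mem_insert _ _)
  -- If the closure of `C` met the circle only in `K`, then `C` would contain the whole component of
  -- `q` off `K`, which is unbounded.
  obtain ⟨p, hpC, hpR, hpK⟩ : ∃ p ∈ closure C, ‖p‖ = R ∧ p ∉ K := by
    by_contra! h
    have hsub : connectedComponentIn Kᶜ q ⊆ C := by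
      refine isPreconnected_connectedComponentIn.subset_left_of_subset_union
        (v := (closure C)ᶜ) hCo isClosed_closure.isOpen_compl
        (disjoint_compl_right_iff_subset.2 subset_closure) (fun x hx => ?_)
        ⟨q, mem_connectedComponentIn hq.1, hqC⟩
      by_cases hxC : x ∈ closure C
      · left
        have hxK := connectedComponentIn_subset _ _ hx
        refine hclos x hxC ⟨?_, hxK⟩
        have : ‖x‖ ≤ R := mem_closedBall_zero_iff.1
          (closure_minimal ((hCU.trans inter_subset_left).trans Metric.ball_subset_closedBall)
            Metric.isClosed_closedBall hxC)
        rw [mem_ball_zero_iff]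
        exact this.lt_of_ne fun h' => hxK (h x hxC h')
      · exact Or.inr hxC
    exact hq.2 ((Metric.isBounded_ball (x := (0 : ℂ)) (r := R)).subset
      (hsub.trans (hCU.trans inter_subset_left)))
  obtain ⟨ε, hε, hball⟩ := Metric.isOpen_iff.1 hK.isClosed.isOpen_compl p hpK
  obtain ⟨c, hcC, hcp⟩ := Metric.mem_closure_iff.1 hpC ε hε
  rw [dist_comm] at hcp
  obtain ⟨T, hT, hTU, hqT, hcT⟩ := exists_isTree_of_mem_connectedComponentIn hUo hqU hcC
  obtain ⟨x, hx, -, hT'⟩ := hT.exists_extend hcT p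
  have hcR : ‖c‖ < R := mem_ball_zero_iff.1 (hCU hcC).1
  have hseg := segment_subset_of_mem hx
  refine ⟨_, p, hT', Or.inr hqT, Or.inl (left_mem_segment ℝ p x), hpR,
    union_subset (hseg.trans (segment_subset_ball_union hpR hcR))
      ((hTU.trans inter_subset_left).trans subset_union_left), ?_⟩
  refine Set.disjoint_left.2 ?_
  rintro z (hz | hz) hzK
  · exact hball ((convex_ball p ε).segment_subset (Metric.mem_ball_self hε) hcp (hseg hz)) hzK
  · exact (hTU hz).2 hzK

end OuterRAC

/-! ### The circular order of accessible points. -/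

namespace OuterRAC

open Set Topology Filter

theorem exists_int_of_ray_eq {r s α β : ℝ} (hr : 0 < r) (hs : 0 < s)
    (h : (r : ℂ) * Complex.exp (α * Complex.I) = s * Complex.exp (β * Complex.I)) :
    ∃ n : ℤ, α = β + n * (2 * Real.pi) := by
  have hrs : r = s := by
    have := congrArg norm h
    simpa [Complex.norm_exp_ofReal_mul_I, abs_of_pos hr, abs_of_pos hs] using this
  subst hrs
  have hr' : (r : ℂ) ≠ 0 := by exact_mod_cast hr.ne'
  obtain ⟨n, hn⟩ := Complex.exp_eq_exp_iff_exists_int.1 (mul_left_cancel₀ hr' h)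
  refine ⟨n, ?_⟩
  have := congrArg Complex.im hn
  simpa using this

theorem ray_ne {r s α β : ℝ} (hr : 0 < r) (hs : 0 < s) (h1 : α < β) (h2 : β < α + 2 * Real.pi) :
    (r : ℂ) * Complex.exp (α * Complex.I) ≠ s * Complex.exp (β * Complex.I) := by
  intro h
  obtain ⟨n, hn⟩ := exists_int_of_ray_eq hr hs h
  have hpi := Real.pi_pos
  have h3 : (n : ℝ) < 0 := by nlinarith
  have h4 : (-1 : ℝ) < n := by nlinarith
  have h3' : n < 0 := by exact_mod_cast h3
  have h4' : -1 < n := by exact_mod_cast h4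
  omega

/-- Two disjoint continua in a disc cannot reach the boundary circle in alternating positions. -/
theorem not_disjoint_of_alternating {A B : Set ℂ} {R α β γ δ : ℝ} (hR : 0 < R)
    (hαγ : α < γ) (hγβ : γ < β) (hβδ : β < δ) (hδα : δ < α + 2 * Real.pi)
    (hA : IsCompact A) (hAc : IsPreconnected A) (hBc : IsPreconnected B)
    (haA : (R : ℂ) * Complex.exp (α * Complex.I) ∈ A)
    (hbA : (R : ℂ) * Complex.exp (β * Complex.I) ∈ A)
    (hcB : (R : ℂ) * Complex.exp (γ * Complex.I) ∈ B)
    (hdB : (R : ℂ) * Complex.exp (δ * Complex.I) ∈ B)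
    (hAR : A ⊆ Metric.ball 0 R ∪
      {(R : ℂ) * Complex.exp (α * Complex.I), (R : ℂ) * Complex.exp (β * Complex.I)})
    (hBR : B ⊆ Metric.ball 0 R ∪
      {(R : ℂ) * Complex.exp (γ * Complex.I), (R : ℂ) * Complex.exp (δ * Complex.I)}) :
    ¬ Disjoint A B := by
  intro hAB
  let ray : ℝ → ℝ → ℂ := fun r θ => (r : ℂ) * Complex.exp (θ * Complex.I)
  have hnorm : ∀ r θ, 0 < r → ‖ray r θ‖ = r := fun r θ hr => by
    simp [ray, Complex.norm_exp_ofReal_mul_I, abs_of_pos hr]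
  have hc1 : ∀ θ, Continuous fun r => ray r θ := fun θ => by fun_prop
  have hc2 : ∀ r, Continuous fun θ => ray r θ := fun r => by fun_prop
  let E : ℝ → Set ℂ := fun θ => (fun r => ray r θ) '' Icc R (2 * R)
  let S : ℝ → Set ℂ := fun θ => (fun r => ray r θ) '' Ici R
  have hEc : ∀ θ, IsCompact (E θ) := fun θ => isCompact_Icc.image (hc1 θ)
  have hEp : ∀ θ, IsPreconnected (E θ) := fun θ => isPreconnected_Icc.image _ (hc1 θ).continuousOn
  have hSp : ∀ θ, IsPreconnected (S θ) := fun θ => isPreconnected_Ici.image _ (hc1 θ).continuousOn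
  have hSb : ∀ θ, ¬ Bornology.IsBounded (S θ) := fun θ h => by
    obtain ⟨M, hM⟩ := h.exists_norm_le
    have h1 : R ≤ max R (M + 1) := le_max_left _ _
    have := hM _ ⟨max R (M + 1), h1, rfl⟩
    rw [hnorm _ _ (hR.trans_le h1)] at this
    linarith [le_max_right R (M + 1)]
  have hRE : ∀ θ, ray R θ ∈ E θ := fun θ => ⟨R, ⟨le_rfl, by linarith⟩, rfl⟩
  have h2RE : ∀ θ, ray (2 * R) θ ∈ E θ := fun θ => ⟨2 * R, ⟨by linarith, le_rfl⟩, rfl⟩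
  have hRS : ∀ θ, ray R θ ∈ S θ := fun θ => ⟨R, self_mem_Ici, rfl⟩
  -- The set `A` is prolonged radially to the circle of radius `2R`, which its two ends cut into the
  -- arc `CL` facing `γ` and the arc `CR` facing `δ`.
  set CL : Set ℂ := (fun θ => ray (2 * R) θ) '' Icc α β with hCL
  set CR : Set ℂ := (fun θ => ray (2 * R) θ) '' Icc β (α + 2 * Real.pi) with hCR
  have hCLc : IsCompact CL := isCompact_Icc.image (hc2 _)
  have hCRc : IsCompact CR := isCompact_Icc.image (hc2 _)
  set A' := A ∪ E α ∪ E β with hA'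
  have hA'c : IsCompact A' := (hA.union (hEc α)).union (hEc β)
  have hA'p : IsPreconnected A' :=
    (hAc.union _ haA (hRE α) (hEp α)).union _ (Or.inl hbA) (hRE β) (hEp β)
  have hSA : ∀ θ, (∀ r s, 0 < r → 0 < s → ray r θ ≠ ray s α) →
      (∀ r s, 0 < r → 0 < s → ray r θ ≠ ray s β) → Disjoint (S θ) A' := by
    intro θ h1 h2
    refine Set.disjoint_left.2 ?_
    rintro _ ⟨r, hr, rfl⟩ ((h | ⟨s, hs, h⟩) | ⟨s, hs, h⟩)
    · have hr0 : 0 < r := hR.trans_le hr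
      rcases hAR h with h | h | h
      · rw [mem_ball_zero_iff] at h
        change ‖ray r θ‖ < R at h
        rw [hnorm r θ hr0] at h
        exact absurd h (not_lt.2 hr)
      · exact h1 r R hr0 hR h
      · exact h2 r R hr0 hR h
    · exact h1 r s (hR.trans_le hr) (hR.trans_le hs.1) h.symm
    · exact h2 r s (hR.trans_le hr) (hR.trans_le hs.1) h.symm
  have h2R : 0 < 2 * R := by linarith
  -- The outward ray at angle `γ` reaches infinity without meeting `A'` or `CR`. Likewise the ray at
  -- `δ` avoids `A'` and `CL`.
  have hlogc : HasLog (A' ∪ CR) (fun z => z - ray R γ) := by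
    refine hasLog_of_not_isBounded (hA'c.union hCRc) (hSp γ) ?_ (hSb γ) (hRS γ)
    refine Set.disjoint_union_right.2 ⟨hSA γ (fun r s hr hs h =>
      ray_ne hs hr hαγ (by linarith) h.symm) (fun r s hr hs h =>
      ray_ne hr hs hγβ (by linarith) h), Set.disjoint_left.2 ?_⟩
    rintro _ ⟨r, hr, rfl⟩ ⟨θ, hθ, h⟩
    exact ray_ne (hR.trans_le hr) h2R (hγβ.trans_le hθ.1) (by linarith [hθ.2]) h.symm
  have hlogd : HasLog (A' ∪ CL) (fun z => z - ray R δ) := by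
    refine hasLog_of_not_isBounded (hA'c.union hCLc) (hSp δ) ?_ (hSb δ) (hRS δ)
    refine Set.disjoint_union_right.2 ⟨hSA δ (fun r s hr hs h =>
      ray_ne hs hr (by linarith) (by linarith) h.symm) (fun r s hr hs h =>
      ray_ne hs hr hβδ (by linarith) h.symm), Set.disjoint_left.2 ?_⟩
    rintro _ ⟨r, hr, rfl⟩ ⟨θ, hθ, h⟩
    exact ray_ne h2R (hR.trans_le hr) (hθ.2.trans_lt hβδ) (by linarith [hθ.1]) h
  have hBdisj : Disjoint B (A' ∪ CL) := by
    refine Set.disjoint_left.2 ?_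
    intro z hzB hz
    have hzR : ‖z‖ ≤ R := by
      rcases hBR hzB with h | rfl | rfl
      · exact (mem_ball_zero_iff.1 h).le
      · exact (hnorm R γ hR).le
      · exact (hnorm R δ hR).le
    have key : ∀ s θ, R ≤ s → z = ray s θ → z = ray R γ ∨ z = ray R δ := by
      intro s θ hs h
      rcases hBR hzB with h' | h' | h'
      · rw [mem_ball_zero_iff, h, hnorm s θ (hR.trans_le hs)] at h'
        exact absurd h' (not_lt.2 hs)
      · exact Or.inl h'
      · exact Or.inr h'
    rcases hz with ((hz | ⟨s, hs, hz⟩) | ⟨s, hs, hz⟩) | ⟨θ, hθ, hz⟩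
    · exact hAB.ne_of_mem hz hzB rfl
    · have hs0 := hR.trans_le hs.1
      rcases key s α hs.1 hz.symm with h | h
      · exact ray_ne hs0 hR hαγ (by linarith) (hz.trans h)
      · exact ray_ne hs0 hR (hαγ.trans (hγβ.trans hβδ)) hδα (hz.trans h)
    · have hs0 := hR.trans_le hs.1
      rcases key s β hs.1 hz.symm with h | h
      · exact ray_ne hR hs0 hγβ (by linarith) (h.symm.trans hz.symm)
      · exact ray_ne hs0 hR hβδ (by linarith) (hz.trans h)
    · change ray (2 * R) θ = z at hz
      rw [← hz, hnorm _ _ h2R] at hzR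
      linarith
  -- Since `B` joins the two points off `A' ∪ CL`, the logarithm for `δ` yields one for `γ`. The two
  -- closed sets meet in the connected set `A'`, so `z - ray R γ` would have a logarithm on the full
  -- circle of radius `2R`.
  have hlogc' : HasLog (A' ∪ CL) (fun z => z - ray R γ) := by
    refine ((hasLog_div_of_isPreconnected (hA'c.union hCLc).isClosed hBc hBdisj hcB hdB).mul
      hlogd).congr fun z hz => ?_
    have : z - ray R δ ≠ 0 := fun h => hBdisj.ne_of_mem hdB hz (sub_eq_zero.1 h).symm
    exact div_mul_cancel₀ _ this
  have hinter : (A' ∪ CR) ∩ (A' ∪ CL) = A' := by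
    rw [← Set.union_inter_distrib_left]
    refine Set.union_eq_self_of_subset_right ?_
    rintro z ⟨⟨θ', hθ', rfl⟩, ⟨θ, hθ, h⟩⟩
    have hor : θ = θ' ∨ θ' = θ + 2 * Real.pi := by
      by_contra! hne
      have h1 : θ < θ' := lt_of_le_of_ne (hθ.2.trans hθ'.1) hne.1
      have h2 : θ' < θ + 2 * Real.pi := lt_of_le_of_ne (by linarith [hθ'.2, hθ.1]) hne.2
      exact ray_ne h2R h2R h1 h2 h
    rcases hor with rfl | rfl
    · have : θ = β := le_antisymm hθ.2 hθ'.1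
      rw [this]
      exact Or.inr (h2RE β)
    · have : θ = α := le_antisymm (by linarith [hθ'.2]) hθ.1
      rw [← h, this]
      exact Or.inl (Or.inr (h2RE α))
  refine not_hasLog_sphere (R := 2 * R) (p := ray R γ) (by rw [hnorm R γ hR]; linarith)
    ((HasLog.union (hA'c.union hCRc).isClosed (hA'c.union hCLc).isClosed
      (by rw [hinter]; exact hA'p) hlogc hlogc').mono ?_)
  intro z hz
  rw [mem_sphere_zero_iff_norm] at hz
  obtain ⟨n, hn, -⟩ := existsUnique_add_zsmul_mem_Ico Real.two_pi_pos (Complex.arg z) α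
  have hzn : z = ray (2 * R) (Complex.arg z + n • (2 * Real.pi)) := by
    have h1 : Complex.exp (((Complex.arg z + n • (2 * Real.pi) : ℝ) : ℂ) * Complex.I) =
        Complex.exp (Complex.arg z * Complex.I) := by
      rw [Complex.exp_eq_exp_iff_exists_int]
      exact ⟨n, by push_cast [zsmul_eq_mul]; ring⟩
    simp only [ray]
    rw [h1, ← hz, Complex.norm_mul_exp_arg_mul_I]
  rw [hzn]
  rcases le_total (Complex.arg z + n • (2 * Real.pi)) β with h | h
  · exact Or.inr (Or.inr ⟨_, ⟨hn.1, h⟩, rfl⟩)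
  · exact Or.inl (Or.inr ⟨_, ⟨h, hn.2.le⟩, rfl⟩)

/-- `v` can be left along a segment whose points are not enclosed by `K`. -/
def IsAccessible (K : Set ℂ) (v : ℂ) : Prop :=
  ∃ q, q ≠ v ∧ ∀ x ∈ segment ℝ v q, x ≠ v → x ∈ unboundedPart K

theorem IsAccessible.exists_near {K : Set ℂ} {v : ℂ} (h : IsAccessible K v) {N : Set ℂ}
    (hN : N ∈ 𝓝 v) :
    ∃ q, q ≠ v ∧ segment ℝ v q ⊆ N ∧ ∀ x ∈ segment ℝ v q, x ≠ v → x ∈ unboundedPart K := by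
  obtain ⟨q, hqv, hq⟩ := h
  obtain ⟨ε, hε, hεN⟩ := Metric.mem_nhds_iff.1 hN
  have hd : 0 < dist v q := dist_pos.2 hqv.symm
  -- This ratio is at most `1` and satisfies `t * dist v q < ε`.
  let t : ℝ := ε / (ε + dist v q)
  have ht0 : 0 < t := by positivity
  have ht1 : t ≤ 1 := by rw [div_le_one (by positivity)]; linarith
  have htd : t * dist v q < ε := by
    have h1 : t * (ε + dist v q) = ε := by simp only [t]; field_simp
    nlinarith
  let x : ℂ := AffineMap.lineMap v q t
  have hx : x ∈ segment ℝ v q := by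
    rw [segment_eq_image_lineMap]; exact ⟨t, ⟨ht0.le, ht1⟩, rfl⟩
  have hdx : dist x v = t * dist v q := by
    simp only [x, dist_lineMap_left, Real.norm_of_nonneg ht0.le]
  refine ⟨x, fun h => ?_, ?_, fun y hy hyv => hq y (segment_subset_of_mem hx hy) hyv⟩
  · rw [h, dist_self] at hdx
    exact (mul_pos ht0 hd).ne hdx
  · refine ((convex_ball v ε).segment_subset (Metric.mem_ball_self hε) ?_).trans hεN
    rw [Metric.mem_ball, hdx]; exact htd

/-- A tree off `K` leads from the accessible side to the circle. The access segment is followed from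
`v` only up to its first hit of that tree. -/
theorem IsAccessible.exists_isTree {K : Set ℂ} (hK : IsCompact K) {v : ℂ} (hvK : v ∈ K)
    (h : IsAccessible K v) {R : ℝ} (hv : ‖v‖ < R) :
    ∃ T p, IsTree T ∧ p ∈ T ∧ ‖p‖ = R ∧ T ⊆ Metric.ball 0 R ∪ {p} ∧ K ∩ T = {v} := by
  obtain ⟨q, hqv, hqR, hq⟩ := h.exists_near
    (Metric.isOpen_ball.mem_nhds (mem_ball_zero_iff.2 hv))
  obtain ⟨T, p, hT, hqT, hpT, hpR, hTR, hTK⟩ := exists_isTree_to_sphere hK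
    (hq q (right_mem_segment ℝ v q) hqv) (mem_ball_zero_iff.1 (hqR (right_mem_segment ℝ v q)))
  obtain ⟨x, hx, -, hT'⟩ := hT.exists_extend hqT v
  refine ⟨_, p, hT', Or.inr hpT, hpR, union_subset
    (((segment_subset_of_mem hx).trans hqR).trans subset_union_left) hTR, ?_⟩
  apply Subset.antisymm
  · rintro y ⟨hyK, hy | hy⟩
    · by_contra hyv
      exact (hq y (segment_subset_of_mem hx hy) hyv).1 hyK
    · exact absurd rfl (hTK.ne_of_mem hy hyK)
  · rintro y rfl
    exact ⟨hvK, Or.inl (left_mem_segment ℝ y x)⟩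

/-- Accessible points of a compact set are joined to a large circle by disjoint trees. -/
theorem exists_disjoint_trees {V : Type*} {K : Set ℂ} (hK : IsCompact K) {R : ℝ}
    (hKR : K ⊆ Metric.ball 0 R) {pos : V → ℂ} (hinj : Function.Injective pos)
    (hpos : ∀ v, pos v ∈ K) (hacc : ∀ v, IsAccessible K (pos v)) (s : Finset V) :
    ∃ (T : V → Set ℂ) (p : V → ℂ),
      (∀ v ∈ s, IsTree (T v) ∧ p v ∈ T v ∧ ‖p v‖ = R ∧ T v ⊆ Metric.ball 0 R ∪ {p v} ∧
        K ∩ T v = {pos v}) ∧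
      (∀ v ∈ s, ∀ w ∈ s, v ≠ w → Disjoint (T v) (T w)) ∧
      ∀ q ∈ unboundedPart K, (∀ v ∈ s, q ∉ T v) → q ∈ unboundedPart (K ∪ ⋃ v ∈ s, T v) := by
  classical
  induction s using Finset.induction_on with
  | empty => exact ⟨fun _ => ∅, fun _ => 0, by simp, by simp, by simp⟩
  | insert a s ha ih =>
    obtain ⟨T, p, hT, hdisj, hub⟩ := ih
    have hUc : IsCompact (⋃ v ∈ s, T v) := s.isCompact_biUnion fun v hv => (hT v hv).1.isCompact
    set L := K ∪ ⋃ v ∈ s, T v with hL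
    have hLc : IsCompact L := hK.union hUc
    have haT : ∀ v ∈ s, pos a ∉ T v := fun v hv h => by
      have : pos a ∈ K ∩ T v := ⟨hpos a, h⟩
      rw [(hT v hv).2.2.2.2] at this
      exact ha (hinj this ▸ hv)
    have hnhds : (⋃ v ∈ s, T v)ᶜ ∈ 𝓝 (pos a) := by
      refine hUc.isClosed.isOpen_compl.mem_nhds ?_
      simpa using haT
    -- The last clause of the induction hypothesis says that the trees already attached enclose no
    -- new points, so `pos a` stays accessible.
    have hacc' : IsAccessible L (pos a) := by
      obtain ⟨q, hqa, hqN, hq⟩ := (hacc a).exists_near hnhds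
      refine ⟨q, hqa, fun x hx hxa => hub x (hq x hx hxa) fun v hv hxT => ?_⟩
      exact hqN hx (mem_biUnion hv hxT)
    obtain ⟨Ta, pa, hTa, hpa, hpaR, hTaR, hLTa⟩ := hacc'.exists_isTree hLc (Or.inl (hpos a))
      (mem_ball_zero_iff.1 (hKR (hpos a)))
    have hKTa : K ∩ Ta = {pos a} := by
      apply Subset.antisymm
      · rw [← hLTa]; exact inter_subset_inter_left _ subset_union_left
      · rintro y rfl
        have : pos a ∈ L ∩ Ta := by rw [hLTa]; rfl
        exact ⟨hpos a, this.2⟩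
    have hTTa : ∀ v ∈ s, Disjoint (T v) Ta := fun v hv => Set.disjoint_left.2 fun x hx hxa => by
      have : x ∈ L ∩ Ta := ⟨Or.inr (mem_biUnion hv hx), hxa⟩
      rw [hLTa] at this
      rw [this] at hx
      exact haT v hv hx
    have hup : ∀ v ∈ s, Function.update T a Ta v = T v := fun v hv =>
      Function.update_of_ne (by rintro rfl; exact ha hv) _ _
    have hup' : ∀ v ∈ s, Function.update p a pa v = p v := fun v hv =>
      Function.update_of_ne (by rintro rfl; exact ha hv) _ _
    refine ⟨Function.update T a Ta, Function.update p a pa, ?_, ?_, ?_⟩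
    · intro v hv
      rcases Finset.mem_insert.1 hv with rfl | hv
      · simp only [Function.update_self]
        exact ⟨hTa, hpa, hpaR, hTaR, hKTa⟩
      · rw [hup v hv, hup' v hv]; exact hT v hv
    · intro v hv w hw hvw
      rcases Finset.mem_insert.1 hv with rfl | hv' <;>
        rcases Finset.mem_insert.1 hw with rfl | hw'
      · exact absurd rfl hvw
      · rw [hup w hw', Function.update_self]; exact (hTTa w hw').symm
      · rw [hup v hv', Function.update_self]; exact hTTa v hv'
      · rw [hup v hv', hup w hw']; exact hdisj v hv' w hw' hvw
    · intro q hq hqT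
      have h1 : ⋃ v ∈ insert a s, Function.update T a Ta v = (⋃ v ∈ s, T v) ∪ Ta := by
        rw [Finset.set_biUnion_insert, Function.update_self, union_comm]
        congr 1
        exact iUnion₂_congr hup
      rw [h1, ← union_assoc]
      refine mem_unboundedPart_union hLc hTa hLTa (hub q hq fun v hv => ?_) ?_
      · have := hqT v (Finset.mem_insert_of_mem hv)
        rwa [hup v hv] at this
      · simpa using hqT a (Finset.mem_insert_self a s)

/-- The circular order of the accessible points: connected subsets of `K` that join alternating
pairs of these points and avoid the other pair cannot be disjoint. -/
theorem exists_circular_order {V : Type*} [Fintype V] {K : Set ℂ} (hK : IsCompact K)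
    {pos : V → ℂ} (hinj : Function.Injective pos)
    (hpos : ∀ v, pos v ∈ K) (hacc : ∀ v, IsAccessible K (pos v)) :
    ∃ f : V → ℝ, Function.Injective f ∧ ∀ a b c d : V, ∀ A B : Set ℂ,
      f a < f c → f c < f b → f b < f d → IsCompact A → IsPreconnected A → IsPreconnected B →
      A ⊆ K → B ⊆ K → pos a ∈ A → pos b ∈ A → pos c ∈ B → pos d ∈ B →
      pos c ∉ A → pos d ∉ A → pos a ∉ B → pos b ∉ B → ¬ Disjoint A B := by
  obtain ⟨R, hR0, hKR⟩ := hK.isBounded.subset_ball_lt 0 (0 : ℂ)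
  obtain ⟨T, p, hT, hdisj, -⟩ := exists_disjoint_trees hK hKR hinj hpos hacc Finset.univ
  replace hT := fun v => hT v (Finset.mem_univ v)
  replace hdisj := fun v w => hdisj v (Finset.mem_univ v) w (Finset.mem_univ w)
  have hp : ∀ v, p v = (R : ℂ) * Complex.exp (Complex.arg (p v) * Complex.I) := fun v => by
    rw [← (hT v).2.2.1, Complex.norm_mul_exp_arg_mul_I]
  have hposT : ∀ v, pos v ∈ T v := fun v => by
    have : pos v ∈ K ∩ T v := by rw [(hT v).2.2.2.2]; rfl
    exact this.2
  -- Vertices are ordered by the angle at which their trees reach the circle; the circle is cut at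
  -- angle `π`.
  refine ⟨fun v => Complex.arg (p v), fun v w hvw => ?_, ?_⟩
  · by_contra hne
    refine (hdisj v w hne).ne_of_mem (hT v).2.1 (hT w).2.1 ?_
    simp only at hvw
    rw [hp v, hp w, hvw]
  intro a b c d A B hac hcb hbd hA hAc hBc hAK hBK haA hbA hcB hdB hcA hdA haB hbB hAB
  have hAT : ∀ v, pos v ∉ A → Disjoint A (T v) := fun v hv => Set.disjoint_left.2 fun x hx hxT => by
    have : x ∈ K ∩ T v := ⟨hAK hx, hxT⟩
    rw [(hT v).2.2.2.2] at this
    rw [this] at hx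
    exact hv hx
  have hBT : ∀ v, pos v ∉ B → Disjoint B (T v) := fun v hv => Set.disjoint_left.2 fun x hx hxT => by
    have : x ∈ K ∩ T v := ⟨hBK hx, hxT⟩
    rw [(hT v).2.2.2.2] at this
    rw [this] at hx
    exact hv hx
  have hne : ∀ {v w}, pos v ∈ A → pos w ∈ B → pos v ∉ B → v ≠ w := by
    rintro v w - hw hv rfl; exact hv hw
  have hsub : ∀ {S : Set ℂ} (v w : V), S ⊆ K →
      S ∪ T v ∪ T w ⊆ Metric.ball 0 R ∪ {p v, p w} := by
    intro S v w hS
    refine union_subset (union_subset ((hS.trans hKR).trans subset_union_left) ?_) ?_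
    · exact (hT v).2.2.2.1.trans (union_subset_union_right _ (by simp))
    · exact (hT w).2.2.2.1.trans (union_subset_union_right _ (by simp))
  -- With the trees of their ends attached, `A` and `B` reach the circle in alternating positions
  -- and would remain disjoint.
  refine not_disjoint_of_alternating (A := A ∪ T a ∪ T b) (B := B ∪ T c ∪ T d) hR0 hac hcb hbd
    (by linarith [Complex.arg_le_pi (p d), Complex.neg_pi_lt_arg (p a)])
    ((hA.union (hT a).1.isCompact).union (hT b).1.isCompact)
    ((hAc.union _ haA (hposT a) (hT a).1.isConnected.isPreconnected).union _ (Or.inl hbA)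
      (hposT b) (hT b).1.isConnected.isPreconnected)
    ((hBc.union _ hcB (hposT c) (hT c).1.isConnected.isPreconnected).union _ (Or.inl hdB)
      (hposT d) (hT d).1.isConnected.isPreconnected)
    (by rw [← hp]; exact Or.inl (Or.inr (hT a).2.1)) (by rw [← hp]; exact Or.inr (hT b).2.1)
    (by rw [← hp]; exact Or.inl (Or.inr (hT c).2.1)) (by rw [← hp]; exact Or.inr (hT d).2.1)
    (by rw [← hp, ← hp]; exact hsub a b hAK) (by rw [← hp, ← hp]; exact hsub c d hBK) ?_
  simp only [Set.disjoint_union_left, Set.disjoint_union_right]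
  exact ⟨⟨⟨⟨hAB, (hBT a haB).symm⟩, (hBT b hbB).symm⟩,
    ⟨hAT c hcA, hdisj a c (hne haA hcB haB)⟩, hdisj b c (hne hbA hcB hbB)⟩,
    ⟨hAT d hdA, hdisj a d (hne haA hdB haB)⟩, hdisj b d (hne hbA hdB hbB)⟩

end OuterRAC

/-! ### Fan-free chords and the greedy noncrossing subset. -/

namespace OuterRAC

section Combinatorics

variable {α : Type*} [LinearOrder α]

/-- The chord `h` separates the left end of `e` from its right end, from the left. -/
def Blocks (h e : α × α) : Prop := h.1 < e.1 ∧ e.1 < h.2 ∧ h.2 < e.2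

/-- Two chords with alternating ends. -/
def Alternate (e f : α × α) : Prop := Blocks e f ∨ Blocks f e

/-- A set of chords on `W` such that no chord crosses two chords with a common end. -/
structure IsFanFree (W : Finset α) (E : Finset (α × α)) : Prop where
  lt : ∀ e ∈ E, e.1 < e.2
  left_mem : ∀ e ∈ E, e.1 ∈ W
  right_mem : ∀ e ∈ E, e.2 ∈ W
  fan : ∀ e ∈ E, ∀ f ∈ E, ∀ g ∈ E, Alternate e f → Alternate e g →
    ∀ v, (v = f.1 ∨ v = f.2) → (v = g.1 ∨ v = g.2) → f = g

/-- `w` is the first inner vertex of a face below a chord. -/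
def IsFirst (H : Finset (α × α)) (w : α) : Prop :=
  ∃ l r, (l, w) ∈ H ∧ (l, r) ∈ H ∧ w < r

/-- The elements of `W` that are neither minimal nor maximal. -/
def inner' (W : Finset α) : Finset α :=
  W.filter fun w => (∃ a ∈ W, a < w) ∧ ∃ b ∈ W, w < b

theorem card_inner' {W : Finset α} (hW : 2 ≤ W.card) : (inner' W).card + 2 = W.card := by
  have hne : W.Nonempty := Finset.card_pos.1 (by omega)
  have hlt : W.min' hne < W.max' hne := Finset.min'_lt_max'_of_card W (by omega)
  have h : inner' W = (W.erase (W.min' hne)).erase (W.max' hne) := by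
    ext w
    simp only [inner', Finset.mem_filter, Finset.mem_erase]
    constructor
    · rintro ⟨hw, ⟨a, ha, haw⟩, b, hb, hwb⟩
      exact ⟨((hwb.trans_le (W.le_max' b hb))).ne, ((W.min'_le a ha).trans_lt haw).ne', hw⟩
    · rintro ⟨h1, h2, hw⟩
      exact ⟨hw, ⟨_, W.min'_mem hne, lt_of_le_of_ne (W.min'_le w hw) (Ne.symm h2)⟩,
        _, W.max'_mem hne, lt_of_le_of_ne (W.le_max' w hw) h1⟩
  rw [h, Finset.card_erase_of_mem, Finset.card_erase_of_mem (W.min'_mem hne)]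
  · omega
  · exact Finset.mem_erase.2 ⟨hlt.ne', W.max'_mem hne⟩

/-- A set of pairwise non-crossing chords on `W`. -/
structure IsNoncrossing (W : Finset α) (H : Finset (α × α)) : Prop where
  lt : ∀ e ∈ H, e.1 < e.2
  left_mem : ∀ e ∈ H, e.1 ∈ W
  right_mem : ∀ e ∈ H, e.2 ∈ W
  not_blocks : ∀ e ∈ H, ∀ f ∈ H, ¬ Blocks e f

namespace IsNoncrossing

-- A chord that is not the longest at its left end is determined by its right end, which is a first
-- point: two with the same right end would force a crossing. The longest ones are determined by
-- their left ends, never the maximum of `W`.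
open scoped Classical in
theorem card_le {W : Finset α} {H : Finset (α × α)} (hH : IsNoncrossing W H) (hW : 2 ≤ W.card) :
    H.card + 1 ≤ W.card + ((inner' W).filter (IsFirst H)).card := by
  have hne : W.Nonempty := Finset.card_pos.1 (by omega)
  rw [← Finset.card_filter_add_card_filter_not (s := H) (fun e => ∃ r, (e.1, r) ∈ H ∧ e.2 < r)]
  have h1 : (H.filter fun e => ∃ r, (e.1, r) ∈ H ∧ e.2 < r).card ≤
      ((inner' W).filter (IsFirst H)).card := by
    refine Finset.card_le_card_of_injOn Prod.snd ?_ ?_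
    · rintro ⟨l, w⟩ he
      obtain ⟨he, r, hr, hwr⟩ := Finset.mem_filter.1 he
      refine Finset.mem_coe.2 (Finset.mem_filter.2 ⟨Finset.mem_filter.2
        ⟨hH.right_mem _ he, ⟨l, hH.left_mem _ he, hH.lt _ he⟩, r, hH.right_mem _ hr, hwr⟩,
        l, r, he, hr, hwr⟩)
    · rintro ⟨l, w⟩ he ⟨l', w'⟩ he' (rfl : w = w')
      obtain ⟨he, r, hr, hwr⟩ := Finset.mem_filter.1 he
      obtain ⟨he', r', hr', hwr'⟩ := Finset.mem_filter.1 he'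
      have := hH.lt _ he
      have := hH.lt _ he'
      simp only at *
      rcases lt_trichotomy l l' with h | rfl | h
      · exact absurd ⟨h, by assumption, hwr'⟩ (hH.not_blocks _ he _ hr')
      · rfl
      · exact absurd ⟨h, by assumption, hwr⟩ (hH.not_blocks _ he' _ hr)
  have h2 : (H.filter fun e => ¬ ∃ r, (e.1, r) ∈ H ∧ e.2 < r).card ≤
      (W.erase (W.max' hne)).card := by
    refine Finset.card_le_card_of_injOn Prod.fst ?_ ?_
    · rintro ⟨l, w⟩ he
      obtain ⟨he, -⟩ := Finset.mem_filter.1 he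
      exact Finset.mem_coe.2 (Finset.mem_erase.2
        ⟨((hH.lt _ he).trans_le (W.le_max' _ (hH.right_mem _ he))).ne, hH.left_mem _ he⟩)
    · rintro ⟨l, w⟩ he ⟨l', w'⟩ he' (rfl : l = l')
      obtain ⟨he, hr⟩ := Finset.mem_filter.1 he
      obtain ⟨he', hr'⟩ := Finset.mem_filter.1 he'
      rcases lt_trichotomy w w' with h | rfl | h
      · exact absurd ⟨w', he', h⟩ hr
      · rfl
      · exact absurd ⟨w, he, h⟩ hr'
  rw [Finset.card_erase_of_mem (W.max'_mem hne)] at h2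
  omega

theorem card_add_three_le {W : Finset α} {H : Finset (α × α)} (hH : IsNoncrossing W H)
    (hW : 2 ≤ W.card) : H.card + 3 ≤ 2 * W.card := by
  classical
  have h1 := hH.card_le hW
  have h2 := Finset.card_filter_le (inner' W) (IsFirst H)
  have h3 := card_inner' hW
  omega

end IsNoncrossing

/-- The chords of `H` are chosen greedily from `E`, by increasing left end. -/
structure IsGreedy (W : Finset α) (E H : Finset (α × α)) : Prop extends IsFanFree W E where
  subset : H ⊆ E
  mem_iff : ∀ e ∈ E, e ∈ H ↔ ∀ h ∈ H, ¬ Blocks h e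

/-- Membership of a chord depends only on chords with smaller left end, so it is defined by
well-founded recursion on the left end. -/
theorem IsFanFree.exists_isGreedy [Finite α] {W : Finset α} {E : Finset (α × α)}
    (hE : IsFanFree W E) : ∃ H, IsGreedy W E H := by
  classical
  let F : (u : α) → ((a : α) → a < u → α → Prop) → α → Prop := fun u ih v =>
    (u, v) ∈ E ∧ ∀ a (h : a < u) b, u < b → b < v → ¬ ih a h b
  let P : α → α → Prop := (wellFounded_lt (α := α)).fix F
  have hP : ∀ u v, P u v ↔ (u, v) ∈ E ∧ ∀ a, a < u → ∀ b, u < b → b < v → ¬ P a b := fun u v => by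
    simp only [P]
    rw [WellFounded.fix_eq]
  refine ⟨E.filter fun e => P e.1 e.2, { hE with
    subset := Finset.filter_subset _ _
    mem_iff := ?_ }⟩
  rintro ⟨u, v⟩ he
  rw [Finset.mem_filter, hP]
  constructor
  · rintro ⟨-, -, h⟩ ⟨a, b⟩ hab ⟨h1, h2, h3⟩
    exact h a h1 b h2 h3 (Finset.mem_filter.1 hab).2
  · intro h
    exact ⟨he, he, fun a h1 b h2 h3 hab =>
      h (a, b) (Finset.mem_filter.2 ⟨((hP a b).1 hab).1, hab⟩) ⟨h1, h2, h3⟩⟩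

namespace IsGreedy

variable {W : Finset α} {E H : Finset (α × α)} (hG : IsGreedy W E H)

include hG

theorem isNoncrossing : IsNoncrossing W H where
  lt e he := hG.lt e (hG.subset he)
  left_mem e he := hG.left_mem e (hG.subset he)
  right_mem e he := hG.right_mem e (hG.subset he)
  not_blocks e he f hf := (hG.mem_iff f (hG.subset hf)).1 hf e he

theorem not_blocks {e f : α × α} (he : e ∈ H) (hf : f ∈ H) : ¬ Blocks e f :=
  hG.isNoncrossing.not_blocks e he f hf

/-- A chord that blocks the shorter of the two also blocks the longer. -/
theorem eq_of_left_eq {e f : α × α} (he : e ∈ E) (heH : e ∉ H) (hf : f ∈ E) (hfH : f ∉ H)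
    (h : e.1 = f.1) : e = f := by
  wlog hle : e.2 ≤ f.2 generalizing e f
  · exact (this hf hfH he heH h.symm (le_of_not_ge hle)).symm
  obtain ⟨b, hb, h1, h2, h3⟩ : ∃ b ∈ H, Blocks b e := by
    by_contra! h'; exact heH ((hG.mem_iff e he).2 h')
  exact hG.fan b (hG.subset hb) e he f hf (Or.inl ⟨h1, h2, h3⟩)
    (Or.inl ⟨h ▸ h1, h ▸ h2, h3.trans_le hle⟩) e.1 (Or.inl rfl) (Or.inl h)

/-- Of `b` and `c`, the one with the larger left end is crossed by both `e` and `f`. -/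
theorem eq_of_right_eq {e f : α × α} (he : e ∈ E) (hf : f ∈ E) {b c : α × α} (hb : b ∈ H)
    (hbe : Blocks e b) (hc : c ∈ H) (hcf : Blocks f c) (h : e.2 = f.2) : e = f := by
  wlog hle : b.1 ≤ c.1 generalizing e f b c
  · exact (this hf he hc hcf hb hbe h.symm (le_of_not_ge hle)).symm
  exact hG.fan c (hG.subset hc) e he f hf
    (Or.inr ⟨hbe.1.trans_le hle, h ▸ hcf.2.1, h ▸ hcf.2.2⟩) (Or.inr hcf) e.2 (Or.inr rfl)
    (Or.inr h)

/-- At a common point, the chord `c` and a blocker `b` of `e` both pass over it; the one with the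
larger left end crosses `e` and `f`. -/
theorem left_ne_right {e f : α × α} (he : e ∈ E) (heH : e ∉ H) (hf : f ∈ E)
    {c : α × α} (hc : c ∈ H) (hcf : Blocks f c) : e.1 ≠ f.2 := by
  intro h
  obtain ⟨b, hb, h1, h2, h3⟩ : ∃ b ∈ H, Blocks b e := by
    by_contra! h'; exact heH ((hG.mem_iff e he).2 h')
  have hlt := hG.lt f hf
  have key : ∀ d ∈ H, Blocks d e → Blocks f d → False := fun d hd hde hfd => by
    have := hG.fan d (hG.subset hd) e he f hf (Or.inl hde) (Or.inr hfd) e.1 (Or.inl rfl) (Or.inr h)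
    rw [this] at h
    exact hlt.ne h
  obtain ⟨k1, k2, k3⟩ := hcf
  rcases le_or_gt c.1 b.1 with hle | hlt'
  · exact key b hb ⟨h1, h2, h3⟩ ⟨k1.trans_le hle, h ▸ h1, h ▸ h2⟩
  · refine key c hc ⟨h ▸ k2, h ▸ k3, lt_of_le_of_lt ?_ h3⟩ ⟨k1, k2, k3⟩
    by_contra hgt
    exact hG.not_blocks hb hc ⟨hlt', by order, not_le.1 hgt⟩

end IsGreedy

/-- `s` is the outermost chord of `H` that blocks `e` from the left. -/
structure IsOuter (H : Finset (α × α)) (e s : α × α) : Prop where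
  mem : s ∈ H
  blocks : Blocks s e
  le : ∀ h ∈ H, Blocks h e → h.2 ≤ s.2

namespace IsGreedy

variable {W : Finset α} {E H : Finset (α × α)} (hG : IsGreedy W E H)

include hG

theorem exists_isOuter {e : α × α} (he : e ∈ E) (heH : e ∉ H) : ∃ s, IsOuter H e s := by
  classical
  obtain ⟨b, hb, hbe⟩ : ∃ b ∈ H, Blocks b e := by
    by_contra! h'; exact heH ((hG.mem_iff e he).2 h')
  obtain ⟨s, hs, hmax⟩ := (H.filter fun h => Blocks h e).exists_max_image Prod.snd
    ⟨b, Finset.mem_filter.2 ⟨hb, hbe⟩⟩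
  rw [Finset.mem_filter] at hs
  exact ⟨s, hs.1, hs.2, fun h hh hhe => hmax h (Finset.mem_filter.2 ⟨hh, hhe⟩)⟩

variable {e f s t : α × α} (he : e ∈ E) (heH : e ∉ H) (hs : IsOuter H e s)

include he hs

omit he in
/-- A chord of `H` around the right end of the outermost blocking chord also contains `e`. -/
theorem around_outer {h : α × α} (hh : h ∈ H) (h1 : h.1 < s.2) (h2 : s.2 < h.2) :
    h.1 ≤ s.1 ∧ e.2 ≤ h.2 := by
  obtain ⟨k1, k2, k3⟩ := hs.blocks
  have h3 : h.1 ≤ s.1 := by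
    by_contra h3
    exact hG.not_blocks hs.mem hh ⟨not_le.1 h3, h1, h2⟩
  refine ⟨h3, ?_⟩
  by_contra h4
  have := hs.le h hh ⟨by order, by order, not_le.1 h4⟩
  order

/-- A blocker of `f` would pass over `s.2`, hence reach at least to `e.2` by `around_outer`. Then
`f` ends beyond `e`, and `e` crosses both `s` and `f` at their common end. -/
theorem outer_ne_left (hf : f ∈ E) (hfH : f ∉ H) : s.2 ≠ f.1 := by
  intro h
  obtain ⟨b, hb, h1, h2, h3⟩ : ∃ b ∈ H, Blocks b f := by
    by_contra! h'; exact hfH ((hG.mem_iff f hf).2 h')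
  obtain ⟨k1, k2, k3⟩ := hs.blocks
  have h4 := hG.around_outer hs hb (h ▸ h1) (h ▸ h2)
  have := hG.fan e he s (hG.subset hs.mem) f hf (Or.inr hs.blocks)
    (Or.inl ⟨by order, by order, by order⟩) s.2 (Or.inr rfl) (Or.inl h)
  exact hfH (this ▸ hs.mem)

/-- By `around_outer` the chord `c` starts no later than `s`, so `f` starts before `s`, and `e`
crosses both although they share their right end. -/
theorem outer_ne_right (hf : f ∈ E) (hfH : f ∉ H) {c : α × α} (hc : c ∈ H)
    (hcf : Blocks f c) : s.2 ≠ f.2 := by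
  intro h
  obtain ⟨k1, k2, k3⟩ := hs.blocks
  obtain ⟨l1, l2, l3⟩ := hcf
  have h4 := hG.around_outer hs hc (h ▸ l2) (h ▸ l3)
  have := hG.fan e he s (hG.subset hs.mem) f hf (Or.inr hs.blocks)
    (Or.inr ⟨by order, by order, by order⟩) s.2 (Or.inr rfl) (Or.inr h)
  exact hfH (this ▸ hs.mem)

/-- If `s` starts no earlier than `t`, then `e` crosses both, so fan-freeness identifies them. -/
theorem outer_eq (hf : f ∈ E) (ht : IsOuter H f t) (h : s.2 = t.2) : s = t := by
  wlog hle : t.1 ≤ s.1 generalizing e f s t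
  · exact (this hf ht he hs h.symm (le_of_not_ge hle)).symm
  obtain ⟨k1, k2, k3⟩ := hs.blocks
  exact hG.fan e he s (hG.subset hs.mem) t (hG.subset ht.mem) (Or.inr hs.blocks)
    (Or.inr ⟨by order, by order, by order⟩) s.2 (Or.inr rfl) (Or.inr h)

theorem eq_of_outer_eq (hf : f ∈ E) (ht : IsOuter H f t) (h : s.2 = t.2) (h' : e.2 = f.2) :
    e = f := by
  have hst := hG.outer_eq he hs hf ht h
  subst hst
  exact hG.fan s (hG.subset hs.mem) e he f hf (Or.inl hs.blocks) (Or.inl ht.blocks) e.2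
    (Or.inr rfl) (Or.inr h')

/-- The right end of a chord that is not the last one through its outermost blocking chord
is not the first inner vertex of a face. -/
theorem not_isFirst (heA : ∀ h ∈ H, ¬ Blocks e h) (hf : f ∈ E) (ht : IsOuter H f t)
    (h : s.2 = t.2) (hlt : e.2 < f.2) : ¬ IsFirst H e.2 := by
  have hst := hG.outer_eq he hs hf ht h
  subst hst
  rintro ⟨l, r, hl, hr, hqr⟩
  obtain ⟨k1, k2, k3⟩ := hs.blocks
  obtain ⟨l1, l2, l3⟩ := ht.blocks
  -- If `l` is not right of `s.1`, then `(l, e.2)` blocks `f` further out than `s`. If `l` lies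
  -- under `s`, it crosses `s`. Otherwise `e` blocks `(l, r)`.
  rcases le_or_gt l s.1 with h1 | h1
  · have := ht.le _ hl ⟨h1.trans_lt l1, l2.trans k3, hlt⟩
    exact absurd k3 (not_lt.2 this)
  · rcases lt_or_ge l s.2 with h2 | h2
    · exact hG.not_blocks hs.mem hl ⟨h1, h2, k3⟩
    · exact heA _ hr ⟨k2.trans_le h2, hG.isNoncrossing.lt _ hl, hqr⟩

-- The outermost blockers of chords with a common right end lie side by side: nesting contradicts
-- outermostness, overlap contradicts noncrossing.
omit he in
theorem outer_le (ht : IsOuter H f t) (h : e.2 = f.2) (hlt : s.2 < t.2) :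
    s.2 ≤ t.1 := by
  obtain ⟨k1, k2, k3⟩ := hs.blocks
  obtain ⟨l1, l2, l3⟩ := ht.blocks
  by_contra hcon
  rcases le_or_gt t.1 s.1 with h1 | h1
  · have := hs.le t ht.mem ⟨by order, by order, by order⟩
    order
  · exact hG.not_blocks hs.mem ht.mem ⟨h1, not_le.1 hcon, hlt⟩

/-- Among the chords with a common right end at most two are not the last ones through their
outermost blocking chords. -/
theorem no_three (hf : f ∈ E) (ht : IsOuter H f t) {g g' u : α × α}
    (hu : IsOuter H g u) (h1 : e.2 = g.2) (h2 : f.2 = g.2) (hst : s.2 < t.2) (htu : t.2 < u.2)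
    (hg' : g' ∈ E) (hu' : IsOuter H g' u) : ¬ g.2 < g'.2 := by
  intro hlt
  have h3 := hG.outer_le ht hu h2 htu
  obtain ⟨k1, k2, k3⟩ := hs.blocks
  obtain ⟨l1, l2, l3⟩ := ht.blocks
  obtain ⟨m1, m2, m3⟩ := hu.blocks
  obtain ⟨n1, n2, n3⟩ := hu'.blocks
  have h4 := hG.outer_le hs ht (h1.trans h2.symm) hst
  -- The blockers lie side by side, so `g'` starts to the right of `e` and `f` and ends beyond their
  -- common right end. It therefore crosses both.
  have : e = f := hG.fan g' hg' e he f hf (Or.inr ⟨by order, by order, by order⟩)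
    (Or.inr ⟨by order, by order, by order⟩) e.2 (Or.inr rfl) (Or.inr (h1.trans h2.symm))
  subst this
  have := hs.le t ht.mem ht.blocks
  order

-- Chords `(l, t.2)` and `(l, r)` witnessing that `t.2` is first would have `l` between `s.2` and
-- `t.1`. Then `(l, r)` blocks `f` or `f'` further out than `t`, or `e` blocks `(l, r)`.
omit he in
theorem not_isFirst_outer (heA : ∀ h ∈ H, ¬ Blocks e h) (ht : IsOuter H f t)
    (h : e.2 = f.2) (hst : s.2 < t.2) {f' : α × α} (ht' : IsOuter H f' t)
    (hlt : f.2 < f'.2) : ¬ IsFirst H t.2 := by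
  have h3 := hG.outer_le hs ht h hst
  obtain ⟨k1, k2, k3⟩ := hs.blocks
  obtain ⟨l1, l2, l3⟩ := ht.blocks
  obtain ⟨m1, m2, m3⟩ := ht'.blocks
  rintro ⟨l, r, hl, hr, hqr⟩
  have hlt2 := hG.isNoncrossing.lt _ hl
  simp only at hlt2
  rcases le_or_gt l s.1 with h1 | h1
  · have := hs.le _ hl ⟨by order, by order, by order⟩
    order
  rcases lt_or_ge l s.2 with h2 | h2
  · exact hG.not_blocks hs.mem hl ⟨h1, h2, hst⟩
  have h4 : l ≤ t.1 := by
    by_contra h4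
    exact hG.not_blocks ht.mem hr ⟨not_le.1 h4, hlt2, hqr⟩
  rcases lt_trichotomy r f.2 with h5 | h5 | h5
  · have := ht.le _ hr ⟨by order, by order, by order⟩
    order
  · have := ht'.le _ hr ⟨by order, by order, by order⟩
    order
  · exact heA _ hr ⟨by order, by order, by order⟩

-- Suppose `g` ends at `t.2`. If it starts before `f`, then `f` crosses both `g` and `t`; if it
-- starts with `f`, then `g = f`, which ends beyond `t`; if it starts later, `t` blocks `g'` further
-- out than `u`.
omit he hs in
theorem not_last_outer (hf : f ∈ E) (hfH : f ∉ H) (ht : IsOuter H f t) {g g' u : α × α}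
    (hg : g ∈ E) (hgH : g ∉ H) (hu : IsOuter H g u) (hu' : IsOuter H g' u) (hlt : g.2 < g'.2) :
    g.2 ≠ t.2 := by
  intro h
  obtain ⟨l1, l2, l3⟩ := ht.blocks
  obtain ⟨m1, m2, m3⟩ := hu.blocks
  obtain ⟨n1, n2, n3⟩ := hu'.blocks
  rcases lt_trichotomy g.1 f.1 with h1 | h1 | h1
  · have := hG.fan f hf g hg t (hG.subset ht.mem) (Or.inr ⟨by order, by order, by order⟩)
      (Or.inr ht.blocks) g.2 (Or.inr rfl) (Or.inr h)
    exact hgH (this ▸ ht.mem)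
  · have := hG.eq_of_left_eq hg hgH hf hfH h1
    rw [this] at h
    order
  · have h2 : t.1 ≤ u.1 := by
      by_contra h2
      exact hG.not_blocks hu.mem ht.mem ⟨not_le.1 h2, by order, by order⟩
    have := hu'.le _ ht.mem ⟨by order, by order, by order⟩
    order

end IsGreedy
end Combinatorics
end OuterRAC

/-! ### Counting: the bound for fan-free chords. -/

namespace OuterRAC

section Combinatorics

variable {α : Type*} [LinearOrder α]

/-- `e` is not the last chord through its outermost blocking chord. -/
def NotLast (E H : Finset (α × α)) (e : α × α) : Prop :=
  ∃ f ∈ E, f ∉ H ∧ ∃ s t, IsOuter H e s ∧ IsOuter H f t ∧ s.2 = t.2 ∧ e.2 < f.2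

namespace IsGreedy

variable {W : Finset α} {E H : Finset (α × α)} (hG : IsGreedy W E H)

include hG

open scoped Classical in
/-- The chords not in `H` whose right ends are not reached from above. -/
theorem card_fiber_le (q : α) :
    ((((E \ H).filter fun e => ∀ h ∈ H, ¬ Blocks e h).filter (NotLast E H)).filter
      fun e => e.2 = q).card ≤ 2 := by
  set S := (((E \ H).filter fun e => ∀ h ∈ H, ¬ Blocks e h).filter (NotLast E H)).filter
      fun e => e.2 = q with hS
  have hmem : ∀ e ∈ S, e ∈ E ∧ e ∉ H ∧ NotLast E H e ∧ e.2 = q := fun e he => by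
    simp only [hS, Finset.mem_filter, Finset.mem_sdiff] at he
    exact ⟨he.1.1.1.1, he.1.1.1.2, he.1.2, he.2⟩
  by_contra! hcard
  -- Here `y e` is the right end of the outermost blocker of `e`, with `e.1` as a default value
  -- outside `S`.
  have : ∀ e : α × α, ∃ y : α, e ∈ S → ∃ s, IsOuter H e s ∧ s.2 = y := fun e => by
    by_cases he : e ∈ S
    · obtain ⟨s, hs⟩ := hG.exists_isOuter (hmem e he).1 (hmem e he).2.1
      exact ⟨s.2, fun _ => ⟨s, hs, rfl⟩⟩
    · exact ⟨e.1, fun h => absurd h he⟩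
  choose y hy using this
  have hinj : ∀ e ∈ S, ∀ f ∈ S, y e = y f → e = f := fun e he f hf h => by
    obtain ⟨s, hs, hsy⟩ := hy e he
    obtain ⟨t, ht, hty⟩ := hy f hf
    exact hG.eq_of_outer_eq (hmem e he).1 hs (hmem f hf).1 ht (by rw [hsy, hty, h])
      ((hmem e he).2.2.2.trans (hmem f hf).2.2.2.symm)
  obtain ⟨g, hg, hmax⟩ := S.exists_max_image y (Finset.card_pos.1 (by omega))
  have h1 : 1 < (S.erase g).card := by rw [Finset.card_erase_of_mem hg]; omega
  obtain ⟨e, he, f, hf, hef⟩ := Finset.one_lt_card.1 h1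
  rw [Finset.mem_erase] at he hf
  wlog hlt : y e < y f generalizing e f
  · exact this f hf e he hef.symm
      (lt_of_le_of_ne (not_lt.1 hlt) fun h => hef (hinj e he.2 f hf.2 h.symm))
  have hfg : y f < y g := lt_of_le_of_ne (hmax f hf.2) fun h => hf.1 (hinj f hf.2 g hg h)
  obtain ⟨s, hs, hsy⟩ := hy e he.2
  obtain ⟨t, ht, hty⟩ := hy f hf.2
  obtain ⟨g', hg', hg'H, u, u', hu, hu', huu, hgg⟩ := (hmem g hg).2.2.1
  obtain ⟨u₀, hu₀, huy⟩ := hy g hg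
  have hu2 : u.2 = u₀.2 := le_antisymm (hu₀.le _ hu.mem hu.blocks) (hu.le _ hu₀.mem hu₀.blocks)
  have huu' : u = u' := hG.outer_eq (hmem g hg).1 hu hg' hu' huu
  subst huu'
  exact hG.no_three (hmem e he.2).1 hs (hmem f hf.2).1 ht hu
    ((hmem e he.2).2.2.2.trans (hmem g hg).2.2.2.symm)
    ((hmem f hf.2).2.2.2.trans (hmem g hg).2.2.2.symm) (by rw [hsy, hty]; exact hlt)
    (by rw [hu2, hty, huy]; exact hfg) hg' hu' hgg

theorem mem_inner'_left {e : α × α} (he : e ∈ E) (heH : e ∉ H) : e.1 ∈ inner' W := by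
  obtain ⟨s, hs⟩ := hG.exists_isOuter he heH
  exact Finset.mem_filter.2 ⟨hG.left_mem e he, ⟨s.1, hG.left_mem s (hG.subset hs.mem),
    hs.blocks.1⟩, e.2, hG.right_mem e he, hG.lt e he⟩

theorem mem_inner'_outer {e s : α × α} (he : e ∈ E) (hs : IsOuter H e s) : s.2 ∈ inner' W :=
  Finset.mem_filter.2 ⟨hG.right_mem s (hG.subset hs.mem), ⟨e.1, hG.left_mem e he,
    hs.blocks.2.1⟩, e.2, hG.right_mem e he, hs.blocks.2.2⟩

open scoped Classical in
/-- Counting the ends of the chords that are not in `H`. -/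
theorem two_mul_card_sdiff_le :
    2 * (E \ H).card ≤ (inner' W).card +
      (((E \ H).filter fun e => ∀ h ∈ H, ¬ Blocks e h).filter (NotLast E H)).card := by
  -- Left ends of all chords outside `H`, right ends of those in `B`, and blocker ends `y` of those
  -- in `A` form disjoint sets of inner points. Only the chords of `A` that are not last can collide
  -- in `y`.
  set A := (E \ H).filter fun e => ∀ h ∈ H, ¬ Blocks e h with hA
  set B := (E \ H).filter fun e => ¬ ∀ h ∈ H, ¬ Blocks e h with hB
  have hN : ∀ e ∈ E \ H, e ∈ E ∧ e ∉ H := fun e he => Finset.mem_sdiff.1 he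
  have hAN : ∀ e ∈ A, e ∈ E ∧ e ∉ H := fun e he => hN e (Finset.mem_filter.1 he).1
  have hBN : ∀ e ∈ B, e ∈ E ∧ e ∉ H ∧ ∃ h ∈ H, Blocks e h := fun e he => by
    obtain ⟨h1, h2⟩ := Finset.mem_filter.1 he
    push Not at h2
    exact ⟨(hN e h1).1, (hN e h1).2, h2⟩
  have : ∀ e : α × α, ∃ y : α, (e ∈ E ∧ e ∉ H) → ∃ s, IsOuter H e s ∧ s.2 = y := fun e => by
    by_cases he : e ∈ E ∧ e ∉ H
    · obtain ⟨s, hs⟩ := hG.exists_isOuter he.1 he.2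
      exact ⟨s.2, fun _ => ⟨s, hs, rfl⟩⟩
    · exact ⟨e.1, fun h => absurd h he⟩
  choose y hy using this
  have h1 : ((E \ H).image Prod.fst).card = (E \ H).card :=
    Finset.card_image_of_injOn fun e he f hf h =>
      hG.eq_of_left_eq (hN e he).1 (hN e he).2 (hN f hf).1 (hN f hf).2 h
  have h2 : (B.image Prod.snd).card = B.card :=
    Finset.card_image_of_injOn fun e he f hf h => by
      obtain ⟨he, -, b, hb, hbe⟩ := hBN e he
      obtain ⟨hf, -, c, hc, hcf⟩ := hBN f hf
      exact hG.eq_of_right_eq he hf hb hbe hc hcf h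
  have h3 : (A.filter fun e => ¬ NotLast E H e).card ≤ (A.image y).card := by
    refine Finset.card_le_card_of_injOn y
      (fun e he => Finset.mem_image_of_mem y (Finset.mem_filter.1 he).1) ?_
    intro e he f hf h
    obtain ⟨he, hel⟩ := Finset.mem_filter.1 he
    obtain ⟨hf, hfl⟩ := Finset.mem_filter.1 hf
    obtain ⟨s, hs, hsy⟩ := hy e (hAN e he)
    obtain ⟨t, ht, hty⟩ := hy f (hAN f hf)
    have hst : s.2 = t.2 := by rw [hsy, hty, h]
    refine hG.eq_of_outer_eq (hAN e he).1 hs (hAN f hf).1 ht hst ?_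
    rcases lt_trichotomy e.2 f.2 with h | h | h
    · exact absurd ⟨f, (hAN f hf).1, (hAN f hf).2, s, t, hs, ht, hst, h⟩ hel
    · exact h
    · exact absurd ⟨e, (hAN e he).1, (hAN e he).2, t, s, ht, hs, hst.symm, h⟩ hfl
  have hd1 : Disjoint ((E \ H).image Prod.fst) (B.image Prod.snd) := by
    rw [Finset.disjoint_left]
    intro w hw hw'
    obtain ⟨e, he, rfl⟩ := Finset.mem_image.1 hw
    obtain ⟨f, hf, hfe⟩ := Finset.mem_image.1 hw'
    obtain ⟨hf, -, c, hc, hcf⟩ := hBN f hf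
    exact hG.left_ne_right (hN e he).1 (hN e he).2 hf hc hcf hfe.symm
  have hd2 : Disjoint ((E \ H).image Prod.fst ∪ B.image Prod.snd) (A.image y) := by
    rw [Finset.disjoint_left]
    intro w hw hw'
    obtain ⟨e, he, rfl⟩ := Finset.mem_image.1 hw'
    obtain ⟨s, hs, hsy⟩ := hy e (hAN e he)
    rcases Finset.mem_union.1 hw with hw | hw
    · obtain ⟨f, hf, hfe⟩ := Finset.mem_image.1 hw
      exact hG.outer_ne_left (hAN e he).1 hs (hN f hf).1 (hN f hf).2 (hsy.trans hfe.symm)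
    · obtain ⟨f, hf, hfe⟩ := Finset.mem_image.1 hw
      obtain ⟨hf, hfH, c, hc, hcf⟩ := hBN f hf
      exact hG.outer_ne_right (hAN e he).1 hs hf hfH hc hcf (hsy.trans hfe.symm)
  have hsub : ((E \ H).image Prod.fst ∪ B.image Prod.snd) ∪ A.image y ⊆ inner' W := by
    intro w hw
    rcases Finset.mem_union.1 hw with hw | hw
    · rcases Finset.mem_union.1 hw with hw | hw
      · obtain ⟨e, he, rfl⟩ := Finset.mem_image.1 hw
        exact hG.mem_inner'_left (hN e he).1 (hN e he).2
      · obtain ⟨e, he, rfl⟩ := Finset.mem_image.1 hw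
        obtain ⟨he, -, c, hc, hce⟩ := hBN e he
        exact Finset.mem_filter.2 ⟨hG.right_mem e he, ⟨e.1, hG.left_mem e he, hG.lt e he⟩,
          c.2, hG.right_mem c (hG.subset hc), hce.2.2⟩
    · obtain ⟨e, he, rfl⟩ := Finset.mem_image.1 hw
      obtain ⟨s, hs, hsy⟩ := hy e (hAN e he)
      exact hsy ▸ hG.mem_inner'_outer (hAN e he).1 hs
  have hcard := Finset.card_le_card hsub
  rw [Finset.card_union_of_disjoint hd2, Finset.card_union_of_disjoint hd1, h1, h2] at hcard
  have h4 : A.card + B.card = (E \ H).card :=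
    Finset.card_filter_add_card_filter_not (s := E \ H) (fun e => ∀ h ∈ H, ¬ Blocks e h)
  have h5 : (A.filter (NotLast E H)).card + (A.filter fun e => ¬ NotLast E H e).card = A.card :=
    Finset.card_filter_add_card_filter_not (s := A) (NotLast E H)
  omega

open scoped Classical in
theorem maps_notLast : ∀ e ∈ ((E \ H).filter fun e => ∀ h ∈ H, ¬ Blocks e h).filter
    (NotLast E H), e.2 ∈ (inner' W).filter fun w => ¬ IsFirst H w := by
  intro e he
  simp only [Finset.mem_filter, Finset.mem_sdiff] at he
  obtain ⟨⟨⟨heE, -⟩, heA⟩, f, hf, -, s, t, hs, ht, hst, hlt⟩ := he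
  exact Finset.mem_filter.2 ⟨Finset.mem_filter.2 ⟨hG.right_mem e heE,
    ⟨e.1, hG.left_mem e heE, hG.lt e heE⟩, f.2, hG.right_mem f hf, hlt⟩,
    hG.not_isFirst heE hs heA hf ht hst hlt⟩

open scoped Classical in
theorem card_notLast_le :
    (((E \ H).filter fun e => ∀ h ∈ H, ¬ Blocks e h).filter (NotLast E H)).card ≤
      2 * ((inner' W).filter fun w => ¬ IsFirst H w).card := by
  rw [mul_comm, ← smul_eq_mul, Finset.card_eq_sum_card_fiberwise (f := Prod.snd)
    (t := (inner' W).filter fun w => ¬ IsFirst H w) hG.maps_notLast, ← Finset.sum_const]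
  exact Finset.sum_le_sum fun q _ => hG.card_fiber_le q

-- If every inner point that is not first carried two of these chords, take two over one point and
-- let `t` be the blocker with the larger right end. Then `t.2` is again not first, but by
-- `not_last_outer` it carries none.
open scoped Classical in
theorem exists_card_fiber_lt
    (hne : ((inner' W).filter fun w => ¬ IsFirst H w).Nonempty) :
    (((E \ H).filter fun e => ∀ h ∈ H, ¬ Blocks e h).filter (NotLast E H)).card <
      2 * ((inner' W).filter fun w => ¬ IsFirst H w).card := by
  rw [mul_comm, ← smul_eq_mul, Finset.card_eq_sum_card_fiberwise (f := Prod.snd)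
    (t := (inner' W).filter fun w => ¬ IsFirst H w) hG.maps_notLast, ← Finset.sum_const]
  refine Finset.sum_lt_sum (fun q _ => hG.card_fiber_le q) ?_
  obtain ⟨q, hq⟩ := hne
  by_contra! hcon
  have hmem : ∀ q e, e ∈ (((E \ H).filter fun e => ∀ h ∈ H, ¬ Blocks e h).filter
      (NotLast E H)).filter (fun e => e.2 = q) →
      e ∈ E ∧ e ∉ H ∧ (∀ h ∈ H, ¬ Blocks e h) ∧ NotLast E H e ∧ e.2 = q := fun q e he => by
    simp only [Finset.mem_filter, Finset.mem_sdiff] at he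
    exact ⟨he.1.1.1.1, he.1.1.1.2, he.1.1.2, he.1.2, he.2⟩
  obtain ⟨e, he, f, hf, hef⟩ := Finset.one_lt_card.1 (Nat.lt_of_succ_le (hcon q hq))
  obtain ⟨heE, heH, heA, ⟨e', heE', heH', s, s', hs, hs', hss, hee⟩, heq⟩ := hmem q e he
  obtain ⟨hfE, hfH, hfA, ⟨f', hfE', hfH', t, t', ht, ht', htt, hff⟩, hfq⟩ := hmem q f hf
  have hss' := hG.outer_eq heE hs heE' hs' hss
  have htt' := hG.outer_eq hfE ht hfE' ht' htt
  subst hss' htt'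
  have key : ∀ {e f f' s t : α × α}, e ∈ E → (∀ h ∈ H, ¬ Blocks e h) → IsOuter H e s →
      f ∈ E → f ∉ H → IsOuter H f t → IsOuter H f' t → f.2 < f'.2 → e.2 = f.2 →
      s.2 < t.2 → False := by
    intro e f f' s t he heA hs hf hfH ht ht' hff h hst
    have h1 := hG.not_isFirst_outer hs heA ht h hst ht' hff
    have h2 : t.2 ∈ (inner' W).filter fun w => ¬ IsFirst H w :=
      Finset.mem_filter.2 ⟨hG.mem_inner'_outer hf ht, h1⟩
    obtain ⟨g, hg⟩ := Finset.card_pos.1 ((Nat.zero_lt_two).trans_le (hcon _ h2))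
    obtain ⟨hgE, hgH, -, ⟨g', hgE', -, u, u', hu, hu', huu, hgg⟩, hgt⟩ := hmem _ g hg
    have huu' := hG.outer_eq hgE hu hgE' hu' huu
    subst huu'
    exact hG.not_last_outer hf hfH ht hgE hgH hu hu' hgg hgt
  have hne : s.2 ≠ t.2 := fun h => hef (hG.eq_of_outer_eq heE hs hfE ht h (heq.trans hfq.symm))
  rcases lt_or_gt_of_ne hne with h | h
  · exact key heE heA hs hfE hfH ht ht' hff (heq.trans hfq.symm) h
  · exact key hfE hfA ht heE heH hs hs' hee (hfq.trans heq.symm) h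

/-- First points raise the bound on `|H|` by one each, other inner points raise the bound on `|E \
H|` by one each; together they number `|W| - 2`. -/
theorem card_le (hW : 2 ≤ W.card) : 2 * E.card + 8 ≤ 5 * W.card := by
  classical
  have h1 := hG.two_mul_card_sdiff_le
  have h2 := hG.card_notLast_le
  have h3 := hG.isNoncrossing.card_le hW
  have h4 := card_inner' hW
  have h5 := Finset.card_filter_add_card_filter_not (s := inner' W) (IsFirst H)
  have h6 := Finset.card_sdiff_add_card_eq_card hG.subset
  omega

/-- In the extremal case `H` is a triangulation. -/
theorem card_add_three_eq (hW : 2 ≤ W.card) (hE : 2 * E.card + 8 = 5 * W.card) :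
    H.card + 3 = 2 * W.card := by
  classical
  have h1 := hG.two_mul_card_sdiff_le
  have h2 := hG.card_notLast_le
  have h3 := hG.isNoncrossing.card_le hW
  have h4 := card_inner' hW
  have h5 := Finset.card_filter_add_card_filter_not (s := inner' W) (IsFirst H)
  have h6 := Finset.card_sdiff_add_card_eq_card hG.subset
  rcases ((inner' W).filter fun w => ¬ IsFirst H w).eq_empty_or_nonempty with h | h
  · rw [h, Finset.card_empty] at h5 h2
    omega
  · have := hG.exists_card_fiber_lt h
    omega

end IsGreedy

end Combinatorics
end OuterRAC

/-! ### The extremal case: triangulations and gluing of `K₄`s. -/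

namespace OuterRAC

section Combinatorics

variable {α : Type*} [LinearOrder α]

theorem Alternate.symm {e f : α × α} (h : Alternate e f) : Alternate f e := Or.symm h

namespace IsNoncrossing

variable {W : Finset α} {H : Finset (α × α)} (hH : IsNoncrossing W H)
include hH

/-- A triangulation contains every chord that it does not cross. -/
theorem mem_of_forall_not_alternate (hW : 2 ≤ W.card) (hcard : H.card + 3 = 2 * W.card)
    {a b : α} (ha : a ∈ W) (hb : b ∈ W) (hab : a < b)
    (h : ∀ e ∈ H, ¬ Alternate e (a, b)) : (a, b) ∈ H := by
  classical
  by_contra hmem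
  have hH' : IsNoncrossing W (insert (a, b) H) := by
    refine ⟨?_, ?_, ?_, ?_⟩
    · simpa [hab] using fun c d => hH.lt (c, d)
    · simpa [ha] using fun c d => hH.left_mem (c, d)
    · simpa [hb] using fun c d => hH.right_mem (c, d)
    · intro e he f hf hef
      rcases Finset.mem_insert.1 he with rfl | he <;> rcases Finset.mem_insert.1 hf with rfl | hf
      · exact absurd hef.1 (lt_irrefl _)
      · exact h f hf (Or.inr hef)
      · exact h e he (Or.inl hef)
      · exact hH.not_blocks e he f hf hef
  have := hH'.card_add_three_le hW
  rw [Finset.card_insert_of_notMem hmem] at this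
  omega

theorem not_blocks' {a b c d : α} (h1 : (a, b) ∈ H) (h2 : (c, d) ∈ H) (h3 : a < c) (h4 : c < b)
    (h5 : b < d) : False :=
  hH.not_blocks _ h1 _ h2 ⟨h3, h4, h5⟩

variable (hW : 2 ≤ W.card) (hcard : H.card + 3 = 2 * W.card)
include hW hcard

/-- In a triangulation there is a triangle below each chord. -/
theorem exists_triangle_below {l r : α} (h : (l, r) ∈ H) (hw : ∃ w ∈ W, l < w ∧ w < r) :
    ∃ w, l < w ∧ w < r ∧ (l, w) ∈ H ∧ (w, r) ∈ H := by
  classical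
  obtain ⟨w₀, hw₀, hlw₀, hwr₀⟩ := hw
  have hl := hH.left_mem _ h
  have hr := hH.right_mem _ h
  obtain ⟨s, hs, hmin⟩ := (W.filter fun w => l < w).exists_min_image id
    ⟨w₀, Finset.mem_filter.2 ⟨hw₀, hlw₀⟩⟩
  obtain ⟨hsW, hls⟩ := Finset.mem_filter.1 hs
  have hmin' : ∀ w ∈ W, l < w → s ≤ w := fun w hw h => hmin w (Finset.mem_filter.2 ⟨hw, h⟩)
  have hlsH : (l, s) ∈ H := by
    refine hH.mem_of_forall_not_alternate hW hcard hl hsW hls ?_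
    rintro ⟨c, d⟩ he (⟨-, h2, h3⟩ | ⟨h1, h2, -⟩)
    · exact absurd (hmin' d (hH.right_mem _ he) h2) (not_le.2 h3)
    · exact absurd (hmin' c (hH.left_mem _ he) h1) (not_le.2 h2)
  -- The apex is the farthest partner of `l` before `r`: a chord of `H` crossing `(w, r)` would
  -- cross `(l, r)` or `(l, w)`, or start at `l` and end beyond `w`.
  obtain ⟨w, hw, hmax⟩ := (W.filter fun w => (l, w) ∈ H ∧ w < r).exists_max_image id
    ⟨s, Finset.mem_filter.2 ⟨hsW, hlsH, (hmin' w₀ hw₀ hlw₀).trans_lt hwr₀⟩⟩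
  obtain ⟨hwW, hlw, hwr⟩ := Finset.mem_filter.1 hw
  have hlw' : l < w := hH.lt _ hlw
  refine ⟨w, hlw', hwr, hlw, hH.mem_of_forall_not_alternate hW hcard hwW hr hwr ?_⟩
  rintro ⟨c, d⟩ he (⟨h1, h2, h3⟩ | ⟨h1, h2, h3⟩)
  · simp only at h1 h2 h3
    rcases lt_trichotomy c l with h4 | rfl | h4
    · exact hH.not_blocks' he h h4 (hlw'.trans h2) h3
    · exact absurd (hmax d (Finset.mem_filter.2 ⟨hH.right_mem _ he, he, h3⟩)) (not_le.2 h2)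
    · exact hH.not_blocks' hlw he h4 h1 h2
  · exact hH.not_blocks' h he (hlw'.trans h1) h2 h3

/-- In a triangulation there is a triangle above each chord that is not outermost. -/
theorem exists_triangle_above {x y : α} (h : (x, y) ∈ H) (hw : ∃ w ∈ W, y < w) :
    ∃ z, (z < x ∧ (z, x) ∈ H ∧ (z, y) ∈ H) ∨ (y < z ∧ (x, z) ∈ H ∧ (y, z) ∈ H) := by
  classical
  obtain ⟨w₀, hw₀, hyw₀⟩ := hw
  have hxy : x < y := hH.lt _ h
  have hx : x ∈ W := hH.left_mem _ h
  have hy : y ∈ W := hH.right_mem _ h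
  have hne : W.Nonempty := ⟨_, hw₀⟩
  have hout : (W.min' hne, W.max' hne) ∈ H := by
    refine hH.mem_of_forall_not_alternate hW hcard (W.min'_mem hne) (W.max'_mem hne)
      (W.min'_lt_max'_of_card (by omega)) ?_
    rintro ⟨c, d⟩ he (⟨h1, -, -⟩ | ⟨-, -, h1⟩)
    · exact absurd (W.min'_le _ (hH.left_mem _ he)) (not_le.2 h1)
    · exact absurd (W.le_max' _ (hH.right_mem _ he)) (not_le.2 h1)
  -- A chord of `H` properly above `(x, y)` is taken with fewest points beneath it; by minimality
  -- the triangle below it has `(x, y)` as a side.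
  let N : α × α → ℕ := fun e => (W.filter fun w => e.1 ≤ w ∧ w ≤ e.2).card
  obtain ⟨⟨c, d⟩, hcd, hmin⟩ := (H.filter fun e => e.1 ≤ x ∧ y ≤ e.2 ∧ e ≠ (x, y)).exists_min_image
    N ⟨_, Finset.mem_filter.2 ⟨hout, W.min'_le _ hx, W.le_max' _ hy, fun h' => by
      have := W.le_max' _ hw₀
      have h2 : W.max' hne = y := (Prod.ext_iff.1 h').2
      rw [h2] at this
      exact absurd hyw₀ (not_lt.2 this)⟩⟩
  obtain ⟨hcdH, hcx, hyd, hcdne⟩ := Finset.mem_filter.1 hcd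
  simp only at hcx hyd
  have hlt : ∀ p q, c ≤ p → q ≤ d → (∃ w ∈ W, c ≤ w ∧ w ≤ d ∧ (w < p ∨ q < w)) → (p, q) ∈ H →
      p ≤ x → y ≤ q → p = x ∧ q = y := by
    intro p q hcp hqd ⟨w, hw, h1, h2, h3⟩ hpq hpx hyq
    by_contra hne'
    refine absurd (hmin (p, q) (Finset.mem_filter.2 ⟨hpq, hpx, hyq, fun h' => hne'
      (by simpa using h')⟩)) (not_le.2 (Finset.card_lt_card ⟨?_, fun hsub => ?_⟩))
    · intro z hz
      obtain ⟨h4, h5, h6⟩ := Finset.mem_filter.1 hz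
      exact Finset.mem_filter.2 ⟨h4, hcp.trans h5, h6.trans hqd⟩
    · obtain ⟨-, h4, h5⟩ := Finset.mem_filter.1 (hsub (Finset.mem_filter.2 ⟨hw, h1, h2⟩))
      rcases h3 with h3 | h3
      · exact absurd h3 (not_lt.2 h4)
      · exact absurd h3 (not_lt.2 h5)
  have hcW := hH.left_mem _ hcdH
  have hdW := hH.right_mem _ hcdH
  have hcd' : c < d := hH.lt _ hcdH
  obtain ⟨w, hcw, hwd, hcwH, hwdH⟩ := hH.exists_triangle_below hW hcard hcdH (by
    rcases hcx.eq_or_lt with rfl | h1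
    · rcases hyd.eq_or_lt with rfl | h2
      · exact absurd rfl hcdne
      · exact ⟨y, hy, hxy, h2⟩
    · exact ⟨x, hx, h1, hxy.trans_le hyd⟩)
  rcases le_or_gt w x with h1 | h1
  · obtain ⟨rfl, rfl⟩ := hlt w d hcw.le le_rfl ⟨c, hcW, le_rfl, hcd'.le, Or.inl hcw⟩ hwdH h1 hyd
    exact ⟨c, Or.inl ⟨hcw, hcwH, hcdH⟩⟩
  rcases le_or_gt y w with h2 | h2
  · obtain ⟨rfl, rfl⟩ := hlt c w le_rfl hwd.le ⟨d, hdW, hcd'.le, le_rfl, Or.inr hwd⟩ hcwH hcx h2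
    exact ⟨d, Or.inr ⟨hwd, hcdH, hwdH⟩⟩
  · exfalso
    rcases hcx.eq_or_lt with rfl | h3
    · rcases hyd.eq_or_lt with rfl | h4
      · exact hcdne rfl
      · exact hH.not_blocks' h hwdH h1 h2 h4
    · exact hH.not_blocks' hcwH h h3 h1 h2

end IsNoncrossing

/-- A quadrilateral of chords of `H` with diagonals `(x, y)` in `H` and `(u, v)`. -/
structure IsQuad (H : Finset (α × α)) (x u y v : α) : Prop where
  lt₁ : x < u
  lt₂ : u < y
  lt₃ : y < v
  xy : (x, y) ∈ H
  xu : (x, u) ∈ H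
  uy : (u, y) ∈ H
  yv : (y, v) ∈ H
  xv : (x, v) ∈ H

namespace IsGreedy

variable {W : Finset α} {E H : Finset (α × α)} (hG : IsGreedy W E H)

include hG

/-- The two triangles of `H` at the outermost blocker `(x, y)` must have apexes `u` and `v`.
Otherwise a side of one of them also crosses `(u, v)` and shares an end with `(x, y)`. -/
theorem exists_isQuad (hW : 2 ≤ W.card) (hcard : H.card + 3 = 2 * W.card) {u v : α}
    (he : (u, v) ∈ E) (heH : (u, v) ∉ H) : ∃ x y, IsQuad H x u y v := by
  obtain ⟨⟨x, y⟩, hs⟩ := hG.exists_isOuter he heH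
  obtain ⟨h1, h2, h3⟩ := hs.blocks
  have hxy := hs.mem
  simp only at h1 h2 h3
  have hH := hG.isNoncrossing
  have hfan : ∀ {p q}, (p, q) ∈ H → Alternate (u, v) (p, q) →
      (∃ w, (w = p ∨ w = q) ∧ (w = x ∨ w = y)) → p = x ∧ q = y := by
    rintro p q hpq halt ⟨w, hw, hw'⟩
    exact Prod.ext_iff.1 (hG.fan _ he _ (hG.subset hpq) _ (hG.subset hxy) halt
      (Or.inr hs.blocks) w hw hw')
  obtain ⟨w, hxw, hwy, hxwH, hwyH⟩ := hH.exists_triangle_below hW hcard hxy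
    ⟨u, hG.left_mem _ he, h1, h2⟩
  have huw : u = w := by
    rcases lt_trichotomy u w with h | h | h
    · exact absurd (hfan hxwH (Or.inr ⟨h1, h, hwy.trans h3⟩) ⟨x, by simp⟩).2 hwy.ne
    · exact h
    · exact absurd (hfan hwyH (Or.inr ⟨h, h2, h3⟩) ⟨y, by simp⟩).1 hxw.ne'
  subst huw
  obtain ⟨z, hz⟩ := hH.exists_triangle_above hW hcard hxy ⟨v, hG.right_mem _ he, h3⟩
  refine ⟨x, y, ?_⟩
  rcases hz with ⟨hzx, -, hzy⟩ | ⟨hyz, hxz, hyzH⟩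
  · exact absurd (hfan hzy (Or.inr ⟨hzx.trans h1, h2, h3⟩) ⟨y, by simp⟩).1 hzx.ne
  · have hvz : v = z := by
      rcases lt_trichotomy v z with h | h | h
      · exact absurd (hfan hyzH (Or.inl ⟨h2, h3, h⟩) ⟨y, by simp⟩).1 (h1.trans h2).ne'
      · exact h
      · exact absurd (hfan hxz (Or.inr ⟨h1, h2.trans hyz, h⟩) ⟨x, by simp⟩).2 hyz.ne'
    subst hvz
    exact ⟨h1, h2, h3, hxy, hxwH, hwyH, hyzH, hxz⟩

/-- The diagonal of a quadrilateral crosses no other chord of `H`. -/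
theorem eq_of_alternate {x u y v c d : α} (hq : IsQuad H x u y v) (hcd : (c, d) ∈ H)
    (halt : Alternate (c, d) (u, v)) : c = x ∧ d = y := by
  have hH := hG.isNoncrossing
  obtain ⟨h1, h2, h3, hxy, hxu, huy, hyv, hxv⟩ := hq
  rcases halt with ⟨k1, k2, k3⟩ | ⟨k1, k2, k3⟩ <;> simp only at k1 k2 k3
  · have hc : c = x := by
      rcases lt_trichotomy c x with h | h | h
      · exact (hH.not_blocks' hcd hxv h (by order) k3).elim
      · exact h
      · exact (hH.not_blocks' hxu hcd h k1 k2).elim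
    subst hc
    refine ⟨rfl, ?_⟩
    rcases lt_trichotomy d y with h | h | h
    · exact (hH.not_blocks' hcd huy h1 k2 h).elim
    · exact h
    · exact (hH.not_blocks' hcd hyv (by order) h k3).elim
  · exfalso
    rcases lt_trichotomy c y with h | rfl | h
    · exact hH.not_blocks' huy hcd k1 h (by order)
    · exact hH.not_blocks' hxv hcd (by order) k2 k3
    · exact hH.not_blocks' hyv hcd h k2 k3

/-- In the extremal case the sides of a quadrilateral around a chord are not crossed. -/
theorem not_alternate_side (hW : 2 ≤ W.card) (hcard : H.card + 3 = 2 * W.card) {x u y v : α}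
    (he : (u, v) ∈ E) (heH : (u, v) ∉ H) (hq : IsQuad H x u y v) {a b : α}
    (hab : (a, b) = (x, u) ∨ (a, b) = (u, y) ∨ (a, b) = (y, v) ∨ (a, b) = (x, v)) :
    ∀ g ∈ E, ¬ Alternate g (a, b) := by
  have hH := hG.isNoncrossing
  have habH : (a, b) ∈ H := by
    rcases hab with h | h | h | h <;> rw [h]
    exacts [hq.xu, hq.uy, hq.yv, hq.xv]
  rintro ⟨p, q⟩ hg halt
  have hgH : (p, q) ∉ H := fun h => by
    rcases halt with h' | h'
    · exact hH.not_blocks _ h _ habH h'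
    · exact hH.not_blocks _ habH _ h h'
  -- The crossing chord has its own quadrilateral, with `(a, b)` as its diagonal in `H`. The sides
  -- of the latter either cross a chord of the first quadrilateral, or `(p, q)` ends at `y` and
  -- crosses both `(a, b)` and `(u, v)`, which share an end.
  obtain ⟨x', y', hq'⟩ := hG.exists_isQuad hW hcard hg hgH
  obtain ⟨rfl, rfl⟩ := hG.eq_of_alternate hq' habH halt.symm
  obtain ⟨h1, h2, h3, hxy, hxu, huy, hyv, hxv⟩ := hq
  obtain ⟨k1, k2, k3, -, hap, hpb, hbq, haq⟩ := hq'
  have hfan : ∀ {c d}, (a, b) = (c, d) → Alternate (p, q) (u, v) →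
      (∃ w, (w = u ∨ w = v) ∧ (w = a ∨ w = b)) → False := by
    rintro c d h halt' ⟨w, hw, hw'⟩
    have := hG.fan _ hg _ he _ (hG.subset habH) halt' halt w hw hw'
    exact heH (this ▸ habH)
  rcases hab with h | h | h | h <;> obtain ⟨rfl, rfl⟩ := Prod.ext_iff.1 h
  · rcases lt_trichotomy q y with h4 | rfl | h4
    · exact hH.not_blocks' haq huy h1 k3 h4
    · exact hfan rfl (Or.inl ⟨k2, k3, h3⟩) ⟨b, by simp⟩
    · exact hH.not_blocks' hxy (by assumption) h1 h2 h4
  · exact hH.not_blocks' hxy haq h1 h2 k3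
  · exact hH.not_blocks' hxv haq (by order) h3 k3
  · rcases lt_trichotomy p y with h4 | rfl | h4
    · exact hH.not_blocks' hxy hpb k1 h4 h3
    · exact hfan rfl (Or.inr ⟨h2, k2, k3⟩) ⟨b, by simp⟩
    · exact hH.not_blocks' hap hyv (by order) h4 k2

end IsGreedy

theorem IsFanFree.card_le [Finite α] {W : Finset α} {E : Finset (α × α)} (hE : IsFanFree W E)
    (hW : 2 ≤ W.card) : 2 * E.card + 8 ≤ 5 * W.card := by
  obtain ⟨H, hG⟩ := hE.exists_isGreedy
  exact hG.card_le hW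

/-- In the extremal case there is a `K₄` whose sides are not crossed. -/
theorem IsFanFree.exists_quad [Finite α] {W : Finset α} {E : Finset (α × α)} (hE : IsFanFree W E)
    (hW : 3 ≤ W.card) (hcard : 2 * E.card + 8 = 5 * W.card) :
    ∃ x u y v, (u, v) ∈ E ∧ IsQuad E x u y v ∧
      ∀ a b, ((a, b) = (x, u) ∨ (a, b) = (u, y) ∨ (a, b) = (y, v) ∨ (a, b) = (x, v)) →
        ∀ g ∈ E, ¬ Alternate g (a, b) := by
  classical
  obtain ⟨H, hG⟩ := hE.exists_isGreedy
  have hH := hG.card_add_three_eq (by omega) hcard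
  have h6 := Finset.card_sdiff_add_card_eq_card hG.subset
  obtain ⟨⟨u, v⟩, he⟩ : (E \ H).Nonempty := Finset.card_pos.1 (by omega)
  obtain ⟨he, heH⟩ := Finset.mem_sdiff.1 he
  obtain ⟨x, y, hq⟩ := hG.exists_isQuad (by omega) hH he heH
  have hs := hG.subset
  exact ⟨x, u, y, v, he, ⟨hq.lt₁, hq.lt₂, hq.lt₃, hs hq.xy, hs hq.xu, hs hq.uy, hs hq.yv, hs hq.xv⟩,
    fun a b hab => hG.not_alternate_side (by omega) hH he heH hq hab⟩

/-- A list of sets, each of which meets the union of the later ones in a pair of elements that is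
contained in one of these. -/
def IsChain : List (Finset α) → Prop
  | [] => True
  | Q :: L => IsChain L ∧ (L = [] ∨ ∃ a b, a < b ∧ (∃ P ∈ L, a ∈ P ∧ b ∈ P) ∧
      ∀ w, (w ∈ Q ∧ ∃ P ∈ L, w ∈ P) ↔ w = a ∨ w = b)

/-- `Q` spans a `K₄` of chords of `E`. -/
def IsK4 (E : Finset (α × α)) (Q : Finset α) : Prop :=
  Q.card = 4 ∧ ∀ a ∈ Q, ∀ b ∈ Q, a < b → (a, b) ∈ E

/-- An extremal fan-free set of chords is glued from `K₄`s along edges. The `K₄`s can be added to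
a given chain that meets `W` in a given edge. -/
theorem IsFanFree.exists_isChain [Finite α] (n : ℕ) : ∀ {W : Finset α} {E : Finset (α × α)},
    W.card = n → IsFanFree W E → 3 ≤ W.card → 2 * E.card + 8 = 5 * W.card →
    ∀ a b, (a, b) ∈ E → ∀ L : List (Finset α), IsChain L →
      (L = [] ∨ (∃ P ∈ L, a ∈ P ∧ b ∈ P) ∧ ∀ w ∈ W, ∀ P ∈ L, w ∈ P → w = a ∨ w = b) →
      ∃ M : List (Finset α), IsChain (M ++ L) ∧ (∀ Q ∈ M, Q ⊆ W ∧ IsK4 E Q) ∧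
        (∀ e ∈ E, ∃ Q ∈ M, e.1 ∈ Q ∧ e.2 ∈ Q) := by
  classical
  induction n using Nat.strong_induction_on with
  | _ n ih =>
  intro W E hn hE hW hcard a b hab L hL hLW
  obtain ⟨x, u, y, v, huv, hq, hcross⟩ := hE.exists_quad hW hcard
  have hxW := hE.left_mem _ hq.xy
  have huW := hE.left_mem _ huv
  have hyW := hE.right_mem _ hq.xy
  have hvW := hE.right_mem _ huv
  have l1 := hq.lt₁
  have l2 := hq.lt₂
  have l3 := hq.lt₃
  have hQ : ({x, u, y, v} : Finset α) ⊆ W := by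
    intro w hw
    simp only [Finset.mem_insert, Finset.mem_singleton] at hw
    rcases hw with rfl | rfl | rfl | rfl <;> assumption
  have hQ4 : ({x, u, y, v} : Finset α).card = 4 := by
    rw [Finset.card_insert_of_notMem (by simp [l1.ne, (l1.trans l2).ne, (l1.trans (l2.trans l3)).ne]),
      Finset.card_insert_of_notMem (by simp [l2.ne, (l2.trans l3).ne]), Finset.card_pair l3.ne]
  by_cases hWQ : W ⊆ {x, u, y, v}
  · have hWeq : W = {x, u, y, v} := Finset.Subset.antisymm hWQ hQ
    refine ⟨[W], ⟨hL, ?_⟩, ?_, ?_⟩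
    · rcases hLW with h | ⟨⟨P, hP, haP, hbP⟩, h⟩
      · exact Or.inl h
      · refine Or.inr ⟨a, b, hE.lt _ hab, ⟨P, hP, haP, hbP⟩, fun w => ⟨?_, ?_⟩⟩
        · rintro ⟨hw, P', hP', hwP'⟩
          exact h w hw P' hP' hwP'
        · rintro (rfl | rfl)
          · exact ⟨hE.left_mem _ hab, P, hP, haP⟩
          · exact ⟨hE.right_mem _ hab, P, hP, hbP⟩
    · intro Q hQ'
      rw [List.mem_singleton] at hQ'
      subst hQ'
      refine ⟨subset_rfl, by rw [hWeq, hQ4], fun c hc d hd hcd => ?_⟩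
      rw [hWeq] at hc hd
      simp only [Finset.mem_insert, Finset.mem_singleton] at hc hd
      obtain ⟨_, _, _, hxy, hxu, huy, hyv, hxv⟩ := hq
      rcases hc with rfl | rfl | rfl | rfl <;> rcases hd with rfl | rfl | rfl | rfl <;>
        first | assumption | (exfalso; order)
    · exact fun e he => ⟨W, List.mem_singleton_self W, hE.left_mem e he, hE.right_mem e he⟩
  · obtain ⟨t, htW, htQ⟩ := Finset.not_subset.1 hWQ
    simp only [Finset.mem_insert, Finset.mem_singleton, not_or] at htQ
    -- The cut is made along an uncrossed side with further points on both sides: the side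
    -- separating `t` from the quadrilateral.
    obtain ⟨c, d, hcdE, hcd, hcr, ⟨p, hpW, hcp, hpd⟩, ⟨q, hqW, hqo⟩⟩ : ∃ c d, (c, d) ∈ E ∧ c < d ∧
        (∀ g ∈ E, ¬ Alternate g (c, d)) ∧ (∃ p ∈ W, c < p ∧ p < d) ∧
        ∃ q ∈ W, q < c ∨ d < q := by
      obtain ⟨hx, hu, hy, hv⟩ := htQ
      by_cases h1 : x < t ∧ t < u
      · exact ⟨x, u, hq.xu, l1, hcross x u (by simp), ⟨t, htW, h1⟩, v, hvW, Or.inr (by order)⟩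
      by_cases h2 : u < t ∧ t < y
      · exact ⟨u, y, hq.uy, l2, hcross u y (by simp), ⟨t, htW, h2⟩, v, hvW, Or.inr (by order)⟩
      by_cases h3 : y < t ∧ t < v
      · exact ⟨y, v, hq.yv, l3, hcross y v (by simp), ⟨t, htW, h3⟩, x, hxW, Or.inl (by order)⟩
      refine ⟨x, v, hq.xv, by order, hcross x v (by simp), ⟨y, hyW, by order, by order⟩, t, htW, ?_⟩
      by_contra! h4
      have h5 : x < t := lt_of_le_of_ne h4.1 (Ne.symm hx)
      have h6 : u < t := lt_of_le_of_ne (not_lt.1 fun h => h1 ⟨h5, h⟩) (Ne.symm hu)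
      have h7 : y < t := lt_of_le_of_ne (not_lt.1 fun h => h2 ⟨h6, h⟩) (Ne.symm hy)
      exact h3 ⟨h7, lt_of_le_of_ne h4.2 hv⟩
    have hcW := hE.left_mem _ hcdE
    have hdW := hE.right_mem _ hcdE
    simp only at hcW hdW
    set W₁ := W.filter fun w => c ≤ w ∧ w ≤ d with hW₁
    set W₂ := W.filter fun w => w ≤ c ∨ d ≤ w with hW₂
    set E₁ := E.filter fun e => e.1 ∈ W₁ ∧ e.2 ∈ W₁ with hE₁
    set E₂ := E.filter fun e => e.1 ∈ W₂ ∧ e.2 ∈ W₂ with hE₂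
    have hfree : ∀ W' : Finset α, IsFanFree W' (E.filter fun e => e.1 ∈ W' ∧ e.2 ∈ W') :=
      fun W' => ⟨fun e he => hE.lt e (Finset.mem_filter.1 he).1,
        fun e he => (Finset.mem_filter.1 he).2.1, fun e he => (Finset.mem_filter.1 he).2.2,
        fun e he f hf g hg => hE.fan e (Finset.mem_filter.1 he).1 f (Finset.mem_filter.1 hf).1 g
          (Finset.mem_filter.1 hg).1⟩
    have hWi : ∀ w, w ∈ W₁ → w ∈ W₂ → w = c ∨ w = d := fun w h1 h2 => by
      obtain ⟨-, h3, h4⟩ := Finset.mem_filter.1 h1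
      obtain ⟨-, h5 | h5⟩ := Finset.mem_filter.1 h2
      · exact Or.inl (le_antisymm h5 h3)
      · exact Or.inr (le_antisymm h4 h5)
    have hc1 : c ∈ W₁ := Finset.mem_filter.2 ⟨hcW, le_rfl, hcd.le⟩
    have hd1 : d ∈ W₁ := Finset.mem_filter.2 ⟨hdW, hcd.le, le_rfl⟩
    have hc2 : c ∈ W₂ := Finset.mem_filter.2 ⟨hcW, Or.inl le_rfl⟩
    have hd2 : d ∈ W₂ := Finset.mem_filter.2 ⟨hdW, Or.inr le_rfl⟩
    have hp1 : p ∈ W₁ := Finset.mem_filter.2 ⟨hpW, hcp.le, hpd.le⟩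
    have hp2 : p ∉ W₂ := fun h => by
      rcases hWi p hp1 h with rfl | rfl
      · exact hcp.false
      · exact hpd.false
    have hq2 : q ∈ W₂ := Finset.mem_filter.2 ⟨hqW, hqo.imp le_of_lt le_of_lt⟩
    have hq1 : q ∉ W₁ := fun h => by
      rcases hWi q h hq2 with rfl | rfl <;> rcases hqo with h | h <;> order
    have hcardW : W₁.card + W₂.card = W.card + 2 := by
      rw [← Finset.card_union_add_card_inter]
      have h1 : W₁ ∪ W₂ = W := by
        ext w
        simp only [hW₁, hW₂, Finset.mem_union, Finset.mem_filter]
        constructor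
        · rintro (h | h) <;> exact h.1
        · intro hw
          rcases le_or_gt w c with h | h
          · exact Or.inr ⟨hw, Or.inl h⟩
          · rcases le_or_gt w d with h' | h'
            · exact Or.inl ⟨hw, h.le, h'⟩
            · exact Or.inr ⟨hw, Or.inr h'.le⟩
      have h2 : W₁ ∩ W₂ = {c, d} := by
        ext w
        simp only [Finset.mem_inter, Finset.mem_insert, Finset.mem_singleton]
        exact ⟨fun h => hWi w h.1 h.2, by rintro (rfl | rfl) <;> exact ⟨by assumption, by assumption⟩⟩
      rw [h1, h2, Finset.card_pair hcd.ne]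
    have hEor : ∀ e ∈ E, e ∈ E₁ ∨ e ∈ E₂ := by
      rintro ⟨r, s⟩ he
      have hr := hE.left_mem _ he
      have hs := hE.right_mem _ he
      have hrs := hE.lt _ he
      have hno := hcr _ he
      simp only at hr hs hrs
      simp only [hE₁, hE₂, hW₁, hW₂, Finset.mem_filter, he, hr, hs, true_and]
      by_contra! hcon
      obtain ⟨h1, h2⟩ := hcon
      apply hno
      simp only [Alternate, Blocks]
      by_cases h3 : c < r ∧ r < d
      · right
        exact ⟨h3.1, h3.2, h1 ⟨h3.1.le, h3.2.le⟩ (by order)⟩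
      · have h4 : r ≤ c ∨ d ≤ r := by
          by_contra! h; exact h3 h
        have h5 := h2 h4
        left
        refine ⟨?_, h5.1, h5.2⟩
        rcases h4 with h4 | h4
        · refine lt_of_le_of_ne h4 ?_
          rintro rfl
          exact absurd (h1 ⟨le_rfl, hcd.le⟩ hrs.le) (not_lt.2 h5.2.le)
        · order
    have hcardE : E₁.card + E₂.card = E.card + 1 := by
      rw [← Finset.card_union_add_card_inter]
      have h1 : E₁ ∪ E₂ = E := by
        ext e
        exact ⟨fun h => (Finset.mem_union.1 h).elim (fun h => (Finset.mem_filter.1 h).1)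
          fun h => (Finset.mem_filter.1 h).1, fun h => Finset.mem_union.2 (hEor e h)⟩
      have h2 : E₁ ∩ E₂ = {(c, d)} := by
        ext ⟨r, s⟩
        simp only [Finset.mem_inter, Finset.mem_singleton]
        constructor
        · rintro ⟨h3, h4⟩
          obtain ⟨he, hr1, hs1⟩ := Finset.mem_filter.1 h3
          obtain ⟨-, hr2, hs2⟩ := Finset.mem_filter.1 h4
          have hrs := hE.lt _ he
          simp only at hr1 hs1 hr2 hs2 hrs
          rcases hWi r hr1 hr2 with rfl | rfl <;> rcases hWi s hs1 hs2 with rfl | rfl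
          · exact absurd hrs (lt_irrefl _)
          · rfl
          · exact absurd hrs (not_lt.2 hcd.le)
          · exact absurd hrs (lt_irrefl _)
        · intro h
          rw [h]
          exact ⟨Finset.mem_filter.2 ⟨hcdE, hc1, hd1⟩, Finset.mem_filter.2 ⟨hcdE, hc2, hd2⟩⟩
      rw [h1, h2, Finset.card_singleton]
    have three : ∀ (S : Finset α) (r : α), c ∈ S → d ∈ S → r ∈ S → r ≠ c → r ≠ d →
        3 ≤ S.card := fun S r h1 h2 h3 h4 h5 => by
      refine Finset.two_lt_card.2 ⟨c, h1, d, h2, r, h3, hcd.ne, h4.symm, h5.symm⟩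
    have h31 : 3 ≤ W₁.card := three W₁ p hc1 hd1 hp1 hcp.ne' hpd.ne
    have h32 : 3 ≤ W₂.card := three W₂ q hc2 hd2 hq2 (fun h => hq1 (h ▸ hc1))
      fun h => hq1 (h ▸ hd1)
    have hlt1 : W₁.card < n := hn ▸ Finset.card_lt_card ⟨Finset.filter_subset _ _, fun h => hq1 (h hqW)⟩
    have hlt2 : W₂.card < n := hn ▸ Finset.card_lt_card ⟨Finset.filter_subset _ _, fun h => hp2 (h hpW)⟩
    have hb1 : 2 * E₁.card + 8 ≤ 5 * W₁.card := (hfree W₁).card_le (by omega)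
    have hb2 : 2 * E₂.card + 8 ≤ 5 * W₂.card := (hfree W₂).card_le (by omega)
    -- The parts share two points and one chord, so the two bounds add up to exactly the assumed
    -- equality and both are tight.
    have ht1 : 2 * E₁.card + 8 = 5 * W₁.card := by omega
    have ht2 : 2 * E₂.card + 8 = 5 * W₂.card := by omega
    have hcd1 : (c, d) ∈ E₁ := Finset.mem_filter.2 ⟨hcdE, hc1, hd1⟩
    have hcd2 : (c, d) ∈ E₂ := Finset.mem_filter.2 ⟨hcdE, hc2, hd2⟩
    -- glue a decomposition of one side containing `(a, b)` with one of the other side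
    have glue : ∀ U U' : Finset α, U ⊆ W → U' ⊆ W → (∀ w, w ∈ U → w ∈ U' → w = c ∨ w = d) →
        U.card < n → U'.card < n → 3 ≤ U.card → 3 ≤ U'.card →
        2 * (E.filter fun e => e.1 ∈ U ∧ e.2 ∈ U).card + 8 = 5 * U.card →
        2 * (E.filter fun e => e.1 ∈ U' ∧ e.2 ∈ U').card + 8 = 5 * U'.card →
        (c, d) ∈ (E.filter fun e => e.1 ∈ U ∧ e.2 ∈ U) →
        (c, d) ∈ (E.filter fun e => e.1 ∈ U' ∧ e.2 ∈ U') →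
        (a, b) ∈ (E.filter fun e => e.1 ∈ U ∧ e.2 ∈ U) →
        (∀ e ∈ E, e ∈ (E.filter fun e => e.1 ∈ U ∧ e.2 ∈ U) ∨
          e ∈ (E.filter fun e => e.1 ∈ U' ∧ e.2 ∈ U')) →
        ∃ M : List (Finset α), IsChain (M ++ L) ∧ (∀ Q ∈ M, Q ⊆ W ∧ IsK4 E Q) ∧
          (∀ e ∈ E, ∃ Q ∈ M, e.1 ∈ Q ∧ e.2 ∈ Q) := by
      intro U U' hU hU' hUU hlt hlt' h3 h3' ht ht' hcdU hcdU' habU hor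
      obtain ⟨M, hM1, hM2, hM3⟩ := ih U.card hlt rfl (hfree U) h3 ht a b habU L hL
        (hLW.imp id fun h => ⟨h.1, fun w hw => h.2 w (hU hw)⟩)
      -- The second part is attached along `(c, d)`. A point of `U'` in a member of `L` is `a` or
      -- `b`, hence lies in `U` and is `c` or `d`.
      obtain ⟨M', hM1', hM2', hM3'⟩ := ih U'.card hlt' rfl (hfree U') h3' ht' c d hcdU' (M ++ L) hM1
        (Or.inr ⟨by
          obtain ⟨Q, hQ, h⟩ := hM3 _ hcdU
          exact ⟨Q, List.mem_append_left _ hQ, h⟩, fun w hw P hP hwP => by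
          rcases List.mem_append.1 hP with hP | hP
          · exact hUU w ((hM2 P hP).1 hwP) hw
          · rcases hLW with h | h
            · rw [h] at hP; exact absurd hP List.not_mem_nil
            · have h1 := h.2 w (hU' hw) P hP hwP
              refine hUU w ?_ hw
              rcases h1 with rfl | rfl
              · exact (Finset.mem_filter.1 habU).2.1
              · exact (Finset.mem_filter.1 habU).2.2⟩)
      refine ⟨M' ++ M, by rwa [List.append_assoc], fun Q hQ => ?_, fun e he => ?_⟩
      · rcases List.mem_append.1 hQ with hQ | hQ
        · exact ⟨(hM2' Q hQ).1.trans hU', (hM2' Q hQ).2.1, fun r hr s hs hrs =>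
            (Finset.mem_filter.1 ((hM2' Q hQ).2.2 r hr s hs hrs)).1⟩
        · exact ⟨(hM2 Q hQ).1.trans hU, (hM2 Q hQ).2.1, fun r hr s hs hrs =>
            (Finset.mem_filter.1 ((hM2 Q hQ).2.2 r hr s hs hrs)).1⟩
      · rcases hor e he with h | h
        · obtain ⟨Q, hQ, h⟩ := hM3 e h
          exact ⟨Q, List.mem_append_right _ hQ, h⟩
        · obtain ⟨Q, hQ, h⟩ := hM3' e h
          exact ⟨Q, List.mem_append_left _ hQ, h⟩
    rcases hEor _ hab with h | h
    · exact glue W₁ W₂ (Finset.filter_subset _ _) (Finset.filter_subset _ _) hWi hlt1 hlt2 h31 h32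
        ht1 ht2 hcd1 hcd2 h hEor
    · exact glue W₂ W₁ (Finset.filter_subset _ _) (Finset.filter_subset _ _)
        (fun w h1 h2 => hWi w h2 h1) hlt2 hlt1 h32 h31 ht2 ht1 hcd2 hcd1 h
        fun e he => (hEor e he).symm

end Combinatorics
end OuterRAC

/-! ### A square with its diagonals: `K₄` as a bounded block graph. -/

namespace OuterRAC

section Square

open Set

/-- The first coordinates of the corners of a square. -/
def sqX : Fin 4 → ℝ := ![1, -1, -1, 1]

/-- The second coordinates of the corners of a square. -/
def sqY : Fin 4 → ℝ := ![1, 1, -1, -1]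

/-- The corners of a square. -/
def sq (i : Fin 4) : Plane := !₂[sqX i, sqY i]

theorem sq_zero (i : Fin 4) : sq i 0 = sqX i := rfl
theorem sq_one (i : Fin 4) : sq i 1 = sqY i := rfl

theorem plane_ext {p q : Plane} (h0 : p 0 = q 0) (h1 : p 1 = q 1) : p = q := by
  ext i
  fin_cases i
  · exact h0
  · exact h1

theorem mem_segment_sq {i j : Fin 4} {p : Plane} :
    p ∈ segment ℝ (sq i) (sq j) ↔ ∃ t : ℝ, 0 ≤ t ∧ t ≤ 1 ∧
      p 0 = (1 - t) * sqX i + t * sqX j ∧ p 1 = (1 - t) * sqY i + t * sqY j := by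
  rw [segment_eq_image]
  constructor
  · rintro ⟨t, ⟨h0, h1⟩, rfl⟩
    exact ⟨t, h0, h1, by simp [sq_zero], by simp [sq_one]⟩
  · rintro ⟨t, h0, h1, h2, h3⟩
    exact ⟨t, ⟨h0, h1⟩, plane_ext (by simp [sq_zero, h2]) (by simp [sq_one, h3])⟩

theorem sq_mem_segment {i j k : Fin 4} (h : sq k ∈ segment ℝ (sq i) (sq j)) : k = i ∨ k = j := by
  obtain ⟨t, h0, h1, h2, h3⟩ := mem_segment_sq.1 h
  rw [sq_zero] at h2
  rw [sq_one] at h3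
  fin_cases i <;> fin_cases j <;> fin_cases k <;> simp [sqX, sqY] at h2 h3 ⊢ <;> linarith

/-- The sides of the square. -/
def IsSide (i j : Fin 4) : Prop :=
  (i = 0 ∧ j = 1) ∨ (i = 1 ∧ j = 2) ∨ (i = 2 ∧ j = 3) ∨ (i = 3 ∧ j = 0)

theorem eq_sq_of_mem_side {i j k l : Fin 4} (hij : IsSide i j) (hkl : k ≠ l)
    (hne : s(i, j) ≠ s(k, l)) {p : Plane} (h : p ∈ segment ℝ (sq i) (sq j))
    (h' : p ∈ segment ℝ (sq k) (sq l)) : p = sq i ∨ p = sq j := by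
  obtain ⟨t, h0, h1, h2, h3⟩ := mem_segment_sq.1 h
  obtain ⟨s, k0, k1, k2, k3⟩ := mem_segment_sq.1 h'
  have key : (p 0 = sqX i ∧ p 1 = sqY i) ∨ (p 0 = sqX j ∧ p 1 = sqY j) := by
    rcases hij with ⟨rfl, rfl⟩ | ⟨rfl, rfl⟩ | ⟨rfl, rfl⟩ | ⟨rfl, rfl⟩ <;> fin_cases k <;>
      fin_cases l <;> simp [sqX, sqY] at h2 h3 k2 k3 hkl hne ⊢ <;>
      first
      | exact Or.inl ⟨by linarith, by linarith⟩
      | exact Or.inr ⟨by linarith, by linarith⟩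
  exact key.imp (fun h => plane_ext h.1 h.2) fun h => plane_ext h.1 h.2

theorem isSide_or (i j : Fin 4) (hij : i ≠ j) : IsSide i j ∨ IsSide j i ∨
    s(i, j) = s(0, 2) ∨ s(i, j) = s(1, 3) := by
  revert i j
  unfold IsSide
  decide

/-- The maximum norm. -/
def supNorm (p : Plane) : ℝ := max |p 0| |p 1|

theorem continuous_supNorm : Continuous supNorm := by
  unfold supNorm; fun_prop

theorem supNorm_smul (t : ℝ) (p : Plane) : supNorm (t • p) = |t| * supNorm p := by
  simp [supNorm, abs_mul, mul_max_of_nonneg]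

theorem supNorm_le_one_of_mem {i j : Fin 4} {p : Plane} (h : p ∈ segment ℝ (sq i) (sq j)) :
    supNorm p ≤ 1 := by
  obtain ⟨t, h0, h1, h2, h3⟩ := mem_segment_sq.1 h
  have hX : ∀ i, sqX i ≤ 1 ∧ -1 ≤ sqX i := fun i => by fin_cases i <;> simp [sqX]
  have hY : ∀ i, sqY i ≤ 1 ∧ -1 ≤ sqY i := fun i => by fin_cases i <;> simp [sqY]
  refine max_le (abs_le.2 ⟨?_, ?_⟩) (abs_le.2 ⟨?_, ?_⟩) <;>
    nlinarith [hX i, hX j, hY i, hY j, (hX i).1, (hX i).2, (hX j).1, (hX j).2,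
      (hY i).1, (hY i).2, (hY j).1, (hY j).2]

theorem supNorm_eq_one_iff {p : Plane} :
    supNorm p = 1 ↔ ∃ i j, IsSide i j ∧ p ∈ segment ℝ (sq i) (sq j) := by
  constructor
  · intro h
    have h0 : |p 0| ≤ 1 := h ▸ le_max_left _ _
    have h1 : |p 1| ≤ 1 := h ▸ le_max_right _ _
    rw [abs_le] at h0 h1
    have hor : (p 1 = 1 ∨ p 0 = -1) ∨ (p 1 = -1 ∨ p 0 = 1) := by
      rcases max_choice |p 0| |p 1| with h' | h' <;>
        rw [supNorm, h', abs_eq zero_le_one] at h <;> tauto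
    rcases hor with (h | h) | (h | h)
    · exact ⟨0, 1, by simp [IsSide], mem_segment_sq.2 ⟨(1 - p 0) / 2, by linarith, by linarith,
        by simp [sqX]; ring, by simp [sqY, h]⟩⟩
    · exact ⟨1, 2, by simp [IsSide], mem_segment_sq.2 ⟨(1 - p 1) / 2, by linarith, by linarith,
        by simp [sqX, h]; ring, by simp [sqY]; ring⟩⟩
    · exact ⟨2, 3, by simp [IsSide], mem_segment_sq.2 ⟨(1 + p 0) / 2, by linarith, by linarith,
        by simp [sqX]; ring, by simp [sqY, h]; ring⟩⟩
    · exact ⟨3, 0, by simp [IsSide], mem_segment_sq.2 ⟨(1 + p 1) / 2, by linarith, by linarith,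
        by simp [sqX, h], by simp [sqY]; ring⟩⟩
  · rintro ⟨i, j, hij, hp⟩
    refine le_antisymm (supNorm_le_one_of_mem hp) ?_
    obtain ⟨t, -, -, h2, h3⟩ := mem_segment_sq.1 hp
    rcases hij with ⟨rfl, rfl⟩ | ⟨rfl, rfl⟩ | ⟨rfl, rfl⟩ | ⟨rfl, rfl⟩ <;>
      simp [sqX, sqY] at h2 h3
    · exact le_max_of_le_right (by rw [h3]; simp)
    · exact le_max_of_le_left (by rw [h2]; ring_nf; simp)
    · exact le_max_of_le_right (by rw [h3]; ring_nf; simp)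
    · exact le_max_of_le_left (by rw [h2]; simp)

/-- A segment is a simple arc. -/
theorem isArcBetween_segment {p q : Plane} (h : p ≠ q) : IsArcBetween p q (segment ℝ p q) := by
  refine ⟨fun t => AffineMap.lineMap p q (t : ℝ), ?_, ?_, by simp, by simp, ?_⟩
  · exact AffineMap.lineMap_continuous.comp continuous_subtype_val
  · intro s t hst
    exact Subtype.ext (AffineMap.lineMap_injective ℝ h hst)
  · rw [segment_eq_image_lineMap]
    ext x
    simp [unitInterval]

variable {V : Type*} {G : SimpleGraph V}

/-- The drawing of a graph with four vertices as a square with its diagonals. -/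
def squareDrawing (G : SimpleGraph V) (φ : V ≃ Fin 4) : Drawing G where
  pos v := sq (φ v)
  arc := Sym2.lift ⟨fun u v => segment ℝ (sq (φ u)) (sq (φ v)), fun _ _ => segment_symm _ _ _⟩
  pos_injective u v h := by
    have h' : sq (φ u) = sq (φ v) := h
    have : sq (φ u) ∈ segment ℝ (sq (φ v)) (sq (φ v)) := by rw [h', segment_same]; rfl
    exact φ.injective ((sq_mem_segment this).elim id id)
  isArc u v huv := by
    refine isArcBetween_segment fun h => huv.ne ?_
    have : sq (φ u) ∈ segment ℝ (sq (φ v)) (sq (φ v)) := by rw [h, segment_same]; rfl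
    exact φ.injective ((sq_mem_segment this).elim id id)
  vertex_on_arc u v w _ h := (sq_mem_segment h).imp (fun h => φ.injective h)
    fun h => φ.injective h

theorem squareDrawing_pos (φ : V ≃ Fin 4) (v : V) : (squareDrawing G φ).pos v = sq (φ v) := rfl

theorem squareDrawing_arc (φ : V ≃ Fin 4) (u v : V) :
    (squareDrawing G φ).arc s(u, v) = segment ℝ (sq (φ u)) (sq (φ v)) := rfl

theorem supNorm_le_one_of_mem_carrier (φ : V ≃ Fin 4) {p : Plane}
    (hp : p ∈ (squareDrawing G φ).carrier) : supNorm p ≤ 1 := by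
  rcases hp with ⟨v, rfl⟩ | hp
  · exact supNorm_le_one_of_mem (i := φ v) (j := φ v) (by rw [segment_same]; rfl)
  · obtain ⟨e, he, hp⟩ := mem_iUnion₂.1 hp
    induction e with
    | _ u v => exact supNorm_le_one_of_mem hp

theorem mem_carrier_of_supNorm_eq_one (φ : V ≃ Fin 4) (hadj : ∀ u v, u ≠ v → G.Adj u v)
    {p : Plane} (hp : supNorm p = 1) : p ∈ (squareDrawing G φ).carrier := by
  obtain ⟨i, j, hij, h⟩ := supNorm_eq_one_iff.1 hp
  refine Or.inr (mem_iUnion₂.2 ⟨s(φ.symm i, φ.symm j), hadj _ _ ?_, ?_⟩)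
  · intro h'
    have := φ.symm.injective h'
    rcases hij with ⟨rfl, rfl⟩ | ⟨rfl, rfl⟩ | ⟨rfl, rfl⟩ | ⟨rfl, rfl⟩ <;> simp at this
  · rw [squareDrawing_arc, φ.apply_symm_apply, φ.apply_symm_apply]
    exact h

theorem outerCell_squareDrawing (φ : V ≃ Fin 4) (hadj : ∀ u v, u ≠ v → G.Adj u v) :
    (squareDrawing G φ).outerCell = {p | 1 < supNorm p} := by
  set K := (squareDrawing G φ).carrier with hK
  ext p
  constructor
  · rintro ⟨hp, hpb⟩
    by_contra hcon
    have hlt : supNorm p < 1 := lt_of_le_of_ne (not_lt.1 hcon) fun h =>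
      hp (mem_carrier_of_supNorm_eq_one φ hadj h)
    -- The unit sphere of the maximum norm consists of the drawn sides, so no component can pass
    -- from inside to outside.
    have hsub : connectedComponentIn Kᶜ p ⊆ {q | supNorm q < 1} := by
      refine isPreconnected_connectedComponentIn.subset_left_of_subset_union
        (v := {q | 1 < supNorm q}) (isOpen_lt continuous_supNorm continuous_const)
        (isOpen_lt continuous_const continuous_supNorm)
        (Set.disjoint_left.2 fun q (h1 : supNorm q < 1) (h2 : 1 < supNorm q) => lt_asymm h1 h2) (fun q hq => ?_)
        ⟨p, mem_connectedComponentIn hp, hlt⟩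
      have hqK := connectedComponentIn_subset _ _ hq
      rcases lt_trichotomy (supNorm q) 1 with h | h | h
      · exact Or.inl h
      · exact absurd (mem_carrier_of_supNorm_eq_one φ hadj h) hqK
      · exact Or.inr h
    refine hpb ((isBounded_iff_forall_norm_le.2 ⟨2, fun q hq => ?_⟩).subset hsub)
    have h0 : |q 0| < 1 := (le_max_left _ _).trans_lt hq
    have h1 : |q 1| < 1 := (le_max_right _ _).trans_lt hq
    rw [EuclideanSpace.norm_eq, Fin.sum_univ_two, Real.norm_eq_abs, Real.norm_eq_abs]
    refine Real.sqrt_le_iff.2 ⟨by norm_num, ?_⟩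
    nlinarith [abs_nonneg (q 0), abs_nonneg (q 1)]
  · intro hp
    have hp' : 1 < supNorm p := hp
    have hS : (fun t : ℝ => t • p) '' Ici 1 ⊆ Kᶜ := by
      rintro _ ⟨t, ht, rfl⟩ htK
      have := supNorm_le_one_of_mem_carrier φ htK
      simp only [supNorm_smul] at this
      have ht' : (1 : ℝ) ≤ t := ht
      rw [abs_of_nonneg (by linarith)] at this
      nlinarith
    have hpS : p ∈ (fun t : ℝ => t • p) '' Ici 1 := ⟨1, self_mem_Ici, one_smul _ _⟩
    refine ⟨hS hpS, fun hb => ?_⟩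
    have hpre : IsPreconnected ((fun t : ℝ => t • p) '' Ici 1) :=
      isPreconnected_Ici.image _ (by fun_prop)
    obtain ⟨M, hM⟩ := (hb.subset (hpre.subset_connectedComponentIn hpS hS)).exists_norm_le
    have hp0 : 0 < ‖p‖ := by
      rw [norm_pos_iff]
      rintro rfl
      simp [supNorm] at hp'
      linarith
    have h1 := hM _ ⟨max 1 ((M + 1) / ‖p‖), Set.mem_Ici.2 (le_max_left _ _), rfl⟩
    simp only [norm_smul, Real.norm_eq_abs] at h1
    have h2 : (M + 1) / ‖p‖ ≤ |max 1 ((M + 1) / ‖p‖)| :=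
      (le_max_right _ _).trans (le_abs_self _)
    have h3 : (M + 1) / ‖p‖ * ‖p‖ = M + 1 := by field_simp
    nlinarith

theorem frontier_one_lt_supNorm : frontier {p | 1 < supNorm p} = {p | supNorm p = 1} := by
  apply Subset.antisymm
  · intro p hp
    exact (frontier_lt_subset_eq continuous_const continuous_supNorm hp).symm
  · intro p (hp : supNorm p = 1)
    rw [(isOpen_lt continuous_const continuous_supNorm).frontier_eq]
    refine ⟨?_, by simp [hp]⟩
    have h1 : (1 : ℝ) ∈ closure (Ioi (1 : ℝ)) := by rw [closure_Ioi]; exact self_mem_Ici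
    have h2 : MapsTo (fun t : ℝ => t • p) (Ioi 1) {p | 1 < supNorm p} := by
      intro t (ht : 1 < t)
      simp only [mem_ofPred_eq, supNorm_smul, hp, mul_one]
      rwa [abs_of_pos (by linarith)]
    have h3 : Continuous fun t : ℝ => t • p := by fun_prop
    simpa using map_mem_closure h3 h1 h2

/-- Graphs isomorphic to `K₄` are bounded block graphs. -/
theorem isBoundedBlockGraph_of_iso (φ' : G ≃g (⊤ : SimpleGraph (Fin 4))) :
    IsBoundedBlockGraph G := by
  classical
  let φ : V ≃ Fin 4 := φ'.toEquiv
  have hadj : ∀ u v, u ≠ v → G.Adj u v := fun u v h => by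
    rw [← φ'.map_adj_iff, SimpleGraph.top_adj]
    exact fun h' => h (φ'.injective h')
  let w : Fin 4 → V := φ.symm
  have hwφ : ∀ v, w (φ v) = v := φ.symm_apply_apply
  have hφw : ∀ i, φ (w i) = i := φ.apply_symm_apply
  have hw : ∀ i j, i ≠ j → w i ≠ w j := fun i j h h' => h (φ.symm.injective h')
  have hA : ∀ i j, i ≠ j → G.Adj (w i) (w j) := fun i j h => hadj _ _ (hw i j h)
  let H : G.Walk (w 0) (w 0) :=
    .cons (hA 0 1 (by decide)) (.cons (hA 1 2 (by decide)) (.cons (hA 2 3 (by decide))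
      (.cons (hA 3 0 (by decide)) .nil)))
  have hHe : H.edges = [s(w 0, w 1), s(w 1, w 2), s(w 2, w 3), s(w 3, w 0)] := rfl
  have hside : ∀ {i j}, IsSide i j → s(w i, w j) ∈ H.edges := by
    rintro i j (⟨rfl, rfl⟩ | ⟨rfl, rfl⟩ | ⟨rfl, rfl⟩ | ⟨rfl, rfl⟩) <;> simp [hHe]
  have hside' : ∀ {e}, e ∈ H.edges → ∃ i j, IsSide i j ∧ e = s(w i, w j) := by
    intro e he
    simp only [hHe, List.mem_cons, List.not_mem_nil, or_false] at he
    rcases he with rfl | rfl | rfl | rfl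
    · exact ⟨0, 1, by simp [IsSide], rfl⟩
    · exact ⟨1, 2, by simp [IsSide], rfl⟩
    · exact ⟨2, 3, by simp [IsSide], rfl⟩
    · exact ⟨3, 0, by simp [IsSide], rfl⟩
  have harc : ∀ i j, (squareDrawing G φ).arc s(w i, w j) = segment ℝ (sq i) (sq j) :=
    fun i j => by rw [squareDrawing_arc, hφw, hφw]
  have hdiag : ∀ u v, G.Adj u v → s(u, v) ∉ H.edges →
      s(φ u, φ v) = s(0, 2) ∨ s(φ u, φ v) = s(1, 3) := by
    intro u v huv h
    rcases isSide_or (φ u) (φ v) fun h' => huv.ne (φ.injective h') with h' | h' | h'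
    · exact absurd (hside h') (by rwa [hwφ, hwφ])
    · exact absurd (hside h') (by rwa [hwφ, hwφ, Sym2.eq_swap])
    · exact h'
  have hfree : ∀ e f : G.edgeSet, (e : Sym2 V) ∈ H.edges →
      ¬ (squareDrawing G φ).crossingGraph.Adj e f := by
    rintro ⟨e, he⟩ ⟨f, hf⟩ heH ⟨hef, p, hpe, hpf, hp⟩
    obtain ⟨i, j, hij, rfl⟩ := hside' heH
    induction f with
    | _ u v =>
      simp only [harc, squareDrawing_arc] at hpe hpf
      have hne : s(i, j) ≠ s(φ u, φ v) := fun h => hef (Subtype.ext (by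
        have := congrArg (Sym2.map w) h
        simpa [hwφ] using this))
      rcases eq_sq_of_mem_side hij (fun h => (SimpleGraph.mem_edgeSet G |>.1 hf).ne (φ.injective h))
        hne hpe hpf with rfl | rfl
      · exact hp ⟨w i, by rw [squareDrawing_pos, hφw]⟩
      · exact hp ⟨w j, by rw [squareDrawing_pos, hφw]⟩
  refine ⟨w 0, H, squareDrawing G φ, ?_, ?_, ?_, hfree, ?_, ?_⟩
  · have : Fintype V := Fintype.ofEquiv _ φ.symm
    rw [SimpleGraph.Walk.isHamiltonianCycle_iff_isCycle_and_length_eq]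
    refine ⟨?_, by rw [Fintype.card_congr φ]; rfl⟩
    rw [SimpleGraph.Walk.cons_isCycle_iff]
    constructor
    · simp [SimpleGraph.Walk.isPath_def, hw]
    · simp [hw]
  · rintro e - - u v rfl
    rfl
  · intro u v x y h h' hcross
    have hu := hdiag u v h fun hm => hfree _ _ hm hcross
    have hx := hdiag x y h' fun hm => hfree _ _ hm hcross.symm
    have hne : s(φ u, φ v) ≠ s(φ x, φ y) := fun hh => hcross.1 (Subtype.ext (by
      have := congrArg (Sym2.map w) hh
      simpa [hwφ] using this))
    simp only [squareDrawing_pos]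
    simp only [Sym2.eq_iff] at hu hx
    rcases hu with (⟨h1, h2⟩ | ⟨h1, h2⟩) | (⟨h1, h2⟩ | ⟨h1, h2⟩) <;>
      rcases hx with (⟨h3, h4⟩ | ⟨h3, h4⟩) | (⟨h3, h4⟩ | ⟨h3, h4⟩) <;>
      simp [h1, h2, h3, h4] at hne <;>
      simp [h1, h2, h3, h4, PiLp.inner_apply, Fin.sum_univ_two, sq_zero, sq_one, sqX, sqY] <;>
      norm_num
  · rw [outerCell_squareDrawing φ hadj, frontier_one_lt_supNorm]
    ext p
    simp only [mem_ofPred_eq, supNorm_eq_one_iff, mem_iUnion₂]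
    constructor
    · rintro ⟨i, j, hij, hp⟩
      exact ⟨_, hside hij, by rwa [harc]⟩
    · rintro ⟨e, he, hp⟩
      obtain ⟨i, j, hij, rfl⟩ := hside' he
      exact ⟨i, j, hij, by rwa [harc] at hp⟩
  · refine ⟨(squareDrawing G φ).crossingGraph.connectedComponentMk
      ⟨s(w 0, w 2), hA 0 2 (by decide)⟩, ?_⟩
    rintro ⟨e, he⟩ heH
    rw [SimpleGraph.ConnectedComponent.mem_supp_iff, SimpleGraph.ConnectedComponent.eq]
    induction e with
    | _ u v =>
      rcases hdiag u v he heH with h | h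
      · have h' : s(u, v) = s(w 0, w 2) := by
          have := congrArg (Sym2.map w) h
          simpa [hwφ] using this
        simp only [h']
        exact SimpleGraph.Reachable.refl _
      · have h' : s(u, v) = s(w 1, w 3) := by
          have := congrArg (Sym2.map w) h
          simpa [hwφ] using this
        simp only [h']
        apply SimpleGraph.Adj.reachable
        -- The two diagonals cross at the origin, the midpoint of both and not a corner.
        refine ⟨fun hh => ?_, 0, ?_, ?_, ?_⟩
        · have := congrArg (Sym2.map φ) (Subtype.ext_iff.1 hh)
          simp [hφw] at this
        · simp only [harc]
          exact mem_segment_sq.2 ⟨1 / 2, by norm_num, by norm_num, by simp [sqX]; norm_num,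
            by simp [sqY]; norm_num⟩
        · simp only [harc]
          exact mem_segment_sq.2 ⟨1 / 2, by norm_num, by norm_num, by simp [sqX]; norm_num,
            by simp [sqY]; norm_num⟩
        · rintro ⟨v, hv⟩
          have := congrArg (fun p : Plane => p 0) hv
          simp only [squareDrawing_pos, sq_zero] at this
          generalize φ v = i at this
          fin_cases i <;> simp [sqX] at this

end Square
end OuterRAC

/-! ### Geometry of outer-RAC drawings. -/

namespace OuterRAC

section Geometry

open Set

namespace Drawing

variable {V : Type*} {G : SimpleGraph V} {D : Drawing G}

theorem IsOuterRAC.arc_eq (hD : D.IsOuterRAC) {u v : V} (h : G.Adj u v) :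
    D.arc s(u, v) = segment ℝ (D.pos u) (D.pos v) :=
  hD.straight _ h u v rfl

theorem IsOuterRAC.eq_or_eq_of_mem (hD : D.IsOuterRAC) {u v w : V} (h : G.Adj u v)
    (hw : D.pos w ∈ segment ℝ (D.pos u) (D.pos v)) : w = u ∨ w = v :=
  D.vertex_on_arc u v w h (by rwa [hD.arc_eq h])

theorem pos_mem_carrier (v : V) : D.pos v ∈ D.carrier := Or.inl ⟨v, rfl⟩

theorem IsOuterRAC.segment_subset_carrier (hD : D.IsOuterRAC) {u v : V} (h : G.Adj u v) :
    segment ℝ (D.pos u) (D.pos v) ⊆ D.carrier := fun x hx =>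
  Or.inr (mem_iUnion₂.2 ⟨s(u, v), h, by rwa [hD.arc_eq h]⟩)

theorem isCompact_arc {e : Sym2 V} (he : e ∈ G.edgeSet) : IsCompact (D.arc e) := by
  induction e with
  | _ u v =>
    obtain ⟨γ, hγ, -, -, -, h⟩ := D.isArc u v he
    rw [← h]
    exact isCompact_range hγ

theorem isCompact_carrier [Finite V] (D : Drawing G) : IsCompact D.carrier :=
  (finite_range D.pos).isCompact.union ((toFinite G.edgeSet).isCompact_biUnion fun _ he =>
    isCompact_arc he)

/-- Every vertex of an outer-RAC drawing is the end of a segment that otherwise runs in the outer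
cell. -/
theorem IsOuterRAC.exists_segment [Finite V] (hD : D.IsOuterRAC) (v : V) :
    ∃ q, q ≠ D.pos v ∧ ∀ x ∈ segment ℝ (D.pos v) q, x ≠ D.pos v → x ∈ D.outerCell := by
  -- Everything in the drawing that does not touch `v`; away from `F` the drawing is a star of
  -- segments at `v`.
  set F : Set Plane := D.pos '' {w | w ≠ v} ∪ ⋃ e ∈ {e ∈ G.edgeSet | v ∉ e}, D.arc e with hF
  have hFc : IsClosed F := ((toFinite _).isCompact.union
    ((toFinite {e ∈ G.edgeSet | v ∉ e}).isCompact_biUnion fun e he =>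
      isCompact_arc he.1)).isClosed
  have hvF : D.pos v ∉ F := by
    rintro (⟨w, hw, h⟩ | h)
    · exact hw (D.pos_injective h)
    · obtain ⟨e, ⟨he, hve⟩, h⟩ := mem_iUnion₂.1 h
      induction e with
      | _ a b =>
        refine hve ?_
        rcases D.vertex_on_arc a b v he h with rfl | rfl <;> simp
  obtain ⟨ε, hε, hεF⟩ := Metric.isOpen_iff.1 hFc.isOpen_compl _ hvF
  obtain ⟨z, hz, hzε⟩ := Metric.mem_closure_iff.1 (hD.outer v) ε hε
  rw [dist_comm] at hzε
  have hzv : z ≠ D.pos v := fun h => hz.1 (h ▸ pos_mem_carrier v)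
  have hS : (fun t : ℝ => AffineMap.lineMap (D.pos v) z t) '' Ioc 0 1 ⊆ D.carrierᶜ := by
    rintro _ ⟨t, ⟨ht0, ht1⟩, rfl⟩ hx
    simp only at hx
    set x : Plane := AffineMap.lineMap (D.pos v) z t with hxdef
    have hxv : x - D.pos v = t • (z - D.pos v) := by
      simp [hxdef, AffineMap.lineMap_apply]
    have hxF : x ∉ F := hεF (by
      rw [Metric.mem_ball, dist_eq_norm, hxv, norm_smul, Real.norm_eq_abs, abs_of_pos ht0]
      rw [dist_eq_norm] at hzε
      nlinarith [norm_nonneg (z - D.pos v)])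
    rcases hx with ⟨w, hw⟩ | hx
    · by_cases hwv : w = v
      · rw [← hw, hwv, sub_self, eq_comm, smul_eq_zero, sub_eq_zero] at hxv
        exact hxv.elim ht0.ne' hzv
      · exact hxF (Or.inl ⟨w, hwv, hw⟩)
    · obtain ⟨e, he, hxe⟩ := mem_iUnion₂.1 hx
      by_cases hve : v ∈ e
      · obtain ⟨w, rfl⟩ := hve
        rw [hD.arc_eq he, segment_eq_image_lineMap] at hxe
        obtain ⟨s, ⟨hs0, hs1⟩, hs⟩ := hxe
        have hxw : t • (z - D.pos v) = s • (D.pos w - D.pos v) := by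
          rw [← hxv, ← hs]
          simp [AffineMap.lineMap_apply]
        -- A neighbour of `v` lies farther away than `z`, so an edge at `v` that meets the segment
        -- to `z` would contain `z` itself.
        have hwε : ε ≤ ‖D.pos w - D.pos v‖ := by
          rw [← dist_eq_norm]
          by_contra hlt
          exact hεF (not_le.1 hlt) (Or.inl ⟨w, (SimpleGraph.Adj.ne' he), rfl⟩)
        rw [dist_eq_norm] at hzε
        have hnorm := congrArg norm hxw
        rw [norm_smul, norm_smul, Real.norm_eq_abs, Real.norm_eq_abs, abs_of_pos ht0,
          abs_of_nonneg hs0] at hnorm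
        have hst : s ≤ t := by
          by_contra hlt
          nlinarith [norm_nonneg (z - D.pos v)]
        refine hz.1 (hD.segment_subset_carrier he ?_)
        rw [segment_eq_image_lineMap]
        refine ⟨s / t, ⟨by positivity, (div_le_one ht0).2 hst⟩, ?_⟩
        rw [AffineMap.lineMap_apply, vsub_eq_sub, vadd_eq_add, ← eq_sub_iff_add_eq, div_eq_inv_mul,
          mul_smul, ← hxw, smul_smul, inv_mul_cancel₀ ht0.ne', one_smul]
      · exact hxF (Or.inr (mem_iUnion₂.2 ⟨e, ⟨he, hve⟩, hxe⟩))
  refine ⟨z, hzv, fun x hx hxv => ?_⟩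
  have hxS : x ∈ (fun t : ℝ => AffineMap.lineMap (D.pos v) z t) '' Ioc 0 1 := by
    rw [segment_eq_image_lineMap] at hx
    obtain ⟨t, ⟨h0, h1⟩, rfl⟩ := hx
    refine ⟨t, ⟨h0.lt_of_ne ?_, h1⟩, rfl⟩
    rintro rfl
    simp at hxv
  refine ⟨hS hxS, ?_⟩
  have hpre : IsPreconnected ((fun t : ℝ => AffineMap.lineMap (D.pos v) z t) '' Ioc 0 1) :=
    isPreconnected_Ioc.image _ AffineMap.lineMap_continuous.continuousOn
  have hzS : z ∈ (fun t : ℝ => AffineMap.lineMap (D.pos v) z t) '' Ioc 0 1 :=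
    ⟨1, ⟨one_pos, le_rfl⟩, by simp⟩
  rw [← connectedComponentIn_eq (hpre.subset_connectedComponentIn hzS hS hxS)]
  exact hz.2

/-- The circular order of the vertices of an outer-RAC drawing. -/
theorem IsOuterRAC.exists_order [Fintype V] (hD : D.IsOuterRAC) :
    ∃ f : V → ℝ, Function.Injective f ∧ ∀ a b c d, G.Adj a b → G.Adj c d →
      f a < f c → f c < f b → f b < f d →
        ∃ p, p ∈ segment ℝ (D.pos a) (D.pos b) ∧ p ∈ segment ℝ (D.pos c) (D.pos d) := by
  let φ : Plane ≃ₗᵢ[ℝ] ℂ := Complex.orthonormalBasisOneI.repr.symm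
  have hφK : φ '' D.carrierᶜ = (φ '' D.carrier)ᶜ := image_compl_eq φ.bijective
  have hout : ∀ x ∈ D.outerCell, φ x ∈ unboundedPart (φ '' D.carrier) := by
    intro x hx
    refine ⟨hφK ▸ mem_image_of_mem φ hx.1, fun hb => hx.2 ?_⟩
    have h : φ '' connectedComponentIn D.carrierᶜ x = connectedComponentIn (φ '' D.carrierᶜ) (φ x) :=
      φ.toHomeomorph.image_connectedComponentIn hx.1
    rw [← hφK, ← h] at hb
    exact (φ.isometry.antilipschitz.isBounded_preimage hb).subset (subset_preimage_image _ _)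
  have hseg : ∀ p q : Plane, φ '' segment ℝ p q = segment ℝ (φ p) (φ q) := fun p q =>
    image_segment ℝ φ.toLinearEquiv.toLinearMap.toAffineMap p q
  obtain ⟨f, hf, h⟩ := exists_circular_order (K := φ '' D.carrier) (pos := fun v => φ (D.pos v))
    (D.isCompact_carrier.image φ.continuous) (φ.injective.comp D.pos_injective)
    (fun v => mem_image_of_mem φ (pos_mem_carrier v)) (fun v => by
      obtain ⟨q, hq, hq'⟩ := hD.exists_segment v
      refine ⟨φ q, φ.injective.ne hq, ?_⟩
      rw [← hseg]
      rintro _ ⟨x, hx, rfl⟩ hxv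
      exact hout x (hq' x hx fun h => hxv (by rw [h])))
  refine ⟨f, hf, fun a b c d hab hcd hac hcb hbd => ?_⟩
  have hmem : ∀ {u v w : V}, G.Adj u v → w ≠ u → w ≠ v →
      φ (D.pos w) ∉ segment ℝ (φ (D.pos u)) (φ (D.pos v)) := by
    rintro u v w huv hu hv hw
    rw [← hseg] at hw
    obtain ⟨x, hx, hxw⟩ := hw
    rw [φ.injective hxw] at hx
    exact (hD.eq_or_eq_of_mem huv hx).elim hu hv
  have hsub : ∀ {u v : V}, G.Adj u v →
      segment ℝ (φ (D.pos u)) (φ (D.pos v)) ⊆ φ '' D.carrier := fun huv => by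
    rw [← hseg]
    exact image_mono (hD.segment_subset_carrier huv)
  have nca : c ≠ a := fun h => by simp [h] at hac
  have ncb : c ≠ b := fun h => by simp [h] at hcb
  have ndb : d ≠ b := fun h => by simp [h] at hbd
  have nda : d ≠ a := fun h => by rw [h] at hbd; linarith
  obtain ⟨_, hx, hx'⟩ := not_disjoint_iff.1 (h a b c d (segment ℝ (φ (D.pos a)) (φ (D.pos b)))
    (segment ℝ (φ (D.pos c)) (φ (D.pos d))) hac hcb hbd (isCompact_segment _ _)
    (convex_segment _ _).isPreconnected (convex_segment _ _).isPreconnected (hsub hab) (hsub hcd)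
    (left_mem_segment _ _ _) (right_mem_segment _ _ _) (left_mem_segment _ _ _)
    (right_mem_segment _ _ _) (hmem hab nca ncb) (hmem hab nda ndb) (hmem hcd nca.symm nda.symm)
    (hmem hcd ncb.symm ndb.symm))
  rw [← hseg] at hx hx'
  obtain ⟨p, hp, rfl⟩ := hx
  obtain ⟨q, hq, hqp⟩ := hx'
  rw [φ.injective hqp] at hq
  exact ⟨p, hp, hq⟩

/-- The segments between `a` and `b` and between `c` and `d` cross at a right angle. -/
def CrossAt (D : Drawing G) (a b c d : V) (p : Plane) : Prop :=
  p ∈ segment ℝ (D.pos a) (D.pos b) ∧ p ∈ segment ℝ (D.pos c) (D.pos d) ∧ p ∉ range D.pos ∧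
    inner ℝ (D.pos b - D.pos a) (D.pos d - D.pos c) = 0

theorem CrossAt.swap {a b c d : V} {p : Plane} (h : D.CrossAt a b c d p) :
    D.CrossAt a b d c p := by
  obtain ⟨h1, h2, h3, h4⟩ := h
  refine ⟨h1, segment_symm ℝ (D.pos c) (D.pos d) ▸ h2, h3, ?_⟩
  rw [← neg_sub (D.pos d), inner_neg_right, h4, neg_zero]

theorem CrossAt.comm {a b c d : V} {p : Plane} (h : D.CrossAt a b c d p) :
    D.CrossAt c d a b p :=
  ⟨h.2.1, h.1, h.2.2.1, by rw [real_inner_comm]; exact h.2.2.2⟩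

theorem IsOuterRAC.crossAt (hD : D.IsOuterRAC) {a b c d : V} (hab : G.Adj a b) (hcd : G.Adj c d)
    (h1 : c ≠ a) (h2 : c ≠ b) (h3 : d ≠ a) (h4 : d ≠ b) {p : Plane}
    (hp : p ∈ segment ℝ (D.pos a) (D.pos b)) (hp' : p ∈ segment ℝ (D.pos c) (D.pos d)) :
    D.CrossAt a b c d p := by
  have hpv : p ∉ range D.pos := by
    rintro ⟨w, rfl⟩
    rcases hD.eq_or_eq_of_mem hab hp with rfl | rfl <;>
      rcases hD.eq_or_eq_of_mem hcd hp' with rfl | rfl <;> contradiction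
  refine ⟨hp, hp', hpv, hD.right_angle a b c d hab hcd ⟨fun h => ?_, p, ?_, ?_, hpv⟩⟩
  · rcases Sym2.eq_iff.1 (Subtype.ext_iff.1 h) with ⟨rfl, -⟩ | ⟨rfl, -⟩ <;> contradiction
  · simpa only [hD.arc_eq hab] using hp
  · simpa only [hD.arc_eq hcd] using hp'

/-- On a common ray from `u`, the end `d` is the nearer one and would lie on the edge from `u` to
`c`. -/
theorem IsOuterRAC.eq_of_smul_eq (hD : D.IsOuterRAC) {u c d : V} (hc : G.Adj u c)
    (hd : G.Adj u d) {s t : ℝ} (hs : 0 ≤ s) (ht : 0 < t) (hst : s ≤ t)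
    (h : s • (D.pos c - D.pos u) = t • (D.pos d - D.pos u)) : c = d := by
  have hmem : D.pos d ∈ segment ℝ (D.pos u) (D.pos c) := by
    rw [segment_eq_image_lineMap]
    refine ⟨s / t, ⟨by positivity, (div_le_one ht).2 hst⟩, ?_⟩
    rw [AffineMap.lineMap_apply, vsub_eq_sub, vadd_eq_add, ← eq_sub_iff_add_eq, div_eq_inv_mul,
      mul_smul, h, smul_smul, inv_mul_cancel₀ ht.ne', one_smul]
  exact ((hD.eq_or_eq_of_mem hc hmem).resolve_left hd.ne').symm

/-- An edge does not cross two edges with a common end. -/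
theorem IsOuterRAC.eq_of_crossAt (hD : D.IsOuterRAC) {a b u c d : V} (hab : G.Adj a b)
    (hc : G.Adj u c) (hd : G.Adj u d) {p q : Plane} (hp : D.CrossAt a b u c p)
    (hq : D.CrossAt a b u d q) : c = d := by
  obtain ⟨hp1, hp2, hp3, hp4⟩ := hp
  obtain ⟨hq1, hq2, hq3, hq4⟩ := hq
  rw [segment_eq_image_lineMap] at hp1 hp2 hq1 hq2
  obtain ⟨k, -, hk⟩ := hp1
  obtain ⟨l, -, hl⟩ := hq1
  obtain ⟨s, ⟨hs, -⟩, hs'⟩ := hp2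
  obtain ⟨t, ⟨ht, -⟩, ht'⟩ := hq2
  rw [AffineMap.lineMap_apply, vsub_eq_sub, vadd_eq_add] at hk hl hs' ht'
  -- Both crossing points lie on the line through `a` and `b` in a direction from `u` perpendicular
  -- to it, so they are the same foot.
  have h1 : inner ℝ (D.pos b - D.pos a) (p - D.pos u) = 0 := by
    rw [← hs', add_sub_cancel_right, inner_smul_right, hp4, mul_zero]
  have h2 : inner ℝ (D.pos b - D.pos a) (q - D.pos u) = 0 := by
    rw [← ht', add_sub_cancel_right, inner_smul_right, hq4, mul_zero]
  have h3 : inner ℝ (D.pos b - D.pos a) ((k - l) • (D.pos b - D.pos a)) = 0 := by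
    have : (k - l) • (D.pos b - D.pos a) = (p - D.pos u) - (q - D.pos u) := by
      rw [← hk, ← hl]; module
    rw [this, inner_sub_right, h1, h2, sub_zero]
  rw [inner_smul_right, mul_eq_zero, inner_self_eq_zero, sub_eq_zero, sub_eq_zero] at h3
  have hkl : k = l := h3.resolve_right fun h => hab.ne' (D.pos_injective h)
  have hpq : p = q := by rw [← hk, ← hl, hkl]
  subst hpq
  have hst : s • (D.pos c - D.pos u) = t • (D.pos d - D.pos u) :=
    add_right_cancel (hs'.trans ht'.symm)
  have hs0 : 0 < s := hs.lt_of_ne (by rintro rfl; exact hp3 ⟨u, by simpa using hs'⟩)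
  have ht0 : 0 < t := ht.lt_of_ne (by rintro rfl; exact hp3 ⟨u, by simpa using ht'⟩)
  rcases le_total s t with h | h
  · exact hD.eq_of_smul_eq hc hd hs ht0 h hst
  · exact (hD.eq_of_smul_eq hd hc ht hs0 h hst.symm).symm

end Drawing

end Geometry
end OuterRAC

/-! ### From drawings to chords, and from chains to decompositions. -/

namespace OuterRAC

section Main

variable {V : Type*}

theorem IsChain.getElem {α : Type*} [LinearOrder α] : ∀ {L : List (Finset α)}, IsChain L →
    ∀ (i : ℕ) (hi : i < L.length), L.drop (i + 1) = [] ∨ ∃ a b, a < b ∧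
      (∃ P ∈ L.drop (i + 1), a ∈ P ∧ b ∈ P) ∧
      ∀ w, (w ∈ L[i] ∧ ∃ P ∈ L.drop (i + 1), w ∈ P) ↔ w = a ∨ w = b
  | [], _, _, hi => absurd hi (Nat.not_lt_zero _)
  | _ :: _, h, 0, _ => h.2
  | _ :: _, h, i + 1, hi => h.1.getElem i (Nat.lt_of_succ_lt_succ hi)

/-- A complete induced subgraph on four vertices is a `K₄`. -/
theorem nonempty_iso_of_isClique {G : SimpleGraph V} {Q : Finset V} (hQ : Q.card = 4)
    (h : ∀ a ∈ Q, ∀ b ∈ Q, a ≠ b → G.Adj a b) :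
    Nonempty (((⊤ : G.Subgraph).induce Q).coe ≃g (⊤ : SimpleGraph (Fin 4))) := by
  let φ : Q ≃ Fin 4 := Q.equivFinOfCardEq hQ
  refine ⟨⟨φ, ?_⟩⟩
  rintro ⟨a, ha⟩ ⟨b, hb⟩
  rw [SimpleGraph.top_adj]
  constructor
  · intro hne
    exact ⟨ha, hb, h a ha b hb fun h => hne (congrArg φ (Subtype.ext h))⟩
  · intro hab h'
    exact SimpleGraph.Adj.ne (hab : _ ∧ _ ∧ _).2.2 (congrArg Subtype.val (φ.injective h'))

/-- A chain of `K₄`s that covers a graph is a decomposition. -/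
theorem exists_isK4BlockDecomposition [LinearOrder V] {G : SimpleGraph V} {E : Finset (V × V)}
    (hE : ∀ e, e ∈ E ↔ e.1 < e.2 ∧ G.Adj e.1 e.2) {M : List (Finset V)} (hM : IsChain M)
    (hK4 : ∀ Q ∈ M, IsK4 E Q) (hedge : ∀ e ∈ E, ∃ Q ∈ M, e.1 ∈ Q ∧ e.2 ∈ Q)
    (hvert : ∀ v, ∃ Q ∈ M, v ∈ Q) :
    ∃ (k : ℕ) (B : Fin k → G.Subgraph), IsK4BlockDecomposition G B := by
  have hclique : ∀ Q ∈ M, ∀ a ∈ Q, ∀ b ∈ Q, a ≠ b → G.Adj a b := by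
    intro Q hQ a ha b hb hab
    rcases hab.lt_or_gt with h | h
    · exact ((hE _).1 ((hK4 Q hQ).2 a ha b hb h)).2
    · exact ((hE _).1 ((hK4 Q hQ).2 b hb a ha h)).2.symm
  have hedge' : ∀ a b, G.Adj a b → ∃ Q ∈ M, a ∈ Q ∧ b ∈ Q := by
    intro a b hab
    rcases hab.ne.lt_or_gt with h | h
    · exact hedge (a, b) ((hE _).2 ⟨h, hab⟩)
    · obtain ⟨Q, hQ, h1, h2⟩ := hedge (b, a) ((hE _).2 ⟨h, hab.symm⟩)
      exact ⟨Q, hQ, h2, h1⟩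
  have hget : ∀ Q ∈ M, ∃ i : Fin M.length, M.get i.rev = Q := fun Q hQ => by
    obtain ⟨i, rfl⟩ := List.get_of_mem hQ
    exact ⟨i.rev, by rw [Fin.rev_rev]⟩
  have hiso : ∀ i : Fin M.length,
      Nonempty (((⊤ : G.Subgraph).induce (M.get i.rev : Set V)).coe ≃g
        (⊤ : SimpleGraph (Fin 4))) := fun i =>
    nonempty_iso_of_isClique (hK4 _ (List.get_mem _ _)).1 (hclique _ (List.get_mem _ _))
  -- In a chain each member is glued to the later ones, so the indexing is reversed by `rev` to
  -- obtain gluing to the earlier blocks.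
  refine ⟨M.length, fun i => (⊤ : G.Subgraph).induce (M.get i.rev), ⟨?_, ?_, hiso, ?_⟩⟩
  · refine SimpleGraph.Subgraph.ext ?_ ?_
    · ext v
      obtain ⟨Q, hQ, hv⟩ := hvert v
      obtain ⟨i, rfl⟩ := hget Q hQ
      simpa using ⟨i, by simpa using hv⟩
    · ext a b
      rw [SimpleGraph.Subgraph.iSup_adj, SimpleGraph.Subgraph.top_adj]
      constructor
      · rintro ⟨i, -, -, h⟩
        exact h
      · intro hab
        obtain ⟨Q, hQ, ha, hb⟩ := hedge' a b hab
        obtain ⟨i, rfl⟩ := hget Q hQ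
        exact ⟨i, ha, hb, hab⟩
  · intro i
    obtain ⟨φ⟩ := hiso i
    exact isBoundedBlockGraph_of_iso φ
  · intro i hi
    have hdrop : ∀ P, P ∈ M.drop ((i.rev : ℕ) + 1) ↔ ∃ j : Fin M.length, j < i ∧ M.get j.rev = P := by
      intro P
      rw [List.mem_drop_iff_getElem]
      constructor
      · rintro ⟨n, hn, rfl⟩
        refine ⟨Fin.rev ⟨(i.rev : ℕ) + 1 + n, by omega⟩, ?_, by rw [Fin.rev_rev]; rfl⟩
        have h1 := Fin.val_rev i
        rw [Fin.lt_def, Fin.val_rev]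
        simp only
        omega
      · rintro ⟨j, hj, rfl⟩
        rw [Fin.lt_def] at hj
        have h1 := Fin.val_rev i
        have h2 := Fin.val_rev j
        refine ⟨(j.rev : ℕ) - (i.rev + 1), by omega, ?_⟩
        rw [List.get_eq_getElem]
        congr 1
        omega
    obtain h | ⟨a, b, hab, ⟨P, hP, haP, hbP⟩, hw⟩ := hM.getElem i.rev i.rev.isLt
    · exact absurd ((hdrop _).2 ⟨⟨0, by omega⟩, hi, rfl⟩) (by rw [h]; exact List.not_mem_nil)
    have haQ := ((hw a).2 (Or.inl rfl)).1
    have hbQ := ((hw b).2 (Or.inr rfl)).1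
    have hadj : G.Adj a b := hclique _ (List.getElem_mem _) a haQ b hbQ hab.ne
    have hw' : ∀ w, (w ∈ M.get i.rev ∧ ∃ j < i, w ∈ M.get j.rev) ↔ w = a ∨ w = b := by
      intro w
      rw [← hw, List.get_eq_getElem]
      refine and_congr_right fun _ => ⟨?_, ?_⟩
      · rintro ⟨j, hj, h⟩
        exact ⟨_, (hdrop _).2 ⟨j, hj, rfl⟩, h⟩
      · rintro ⟨P, hP, h⟩
        obtain ⟨j, hj, rfl⟩ := (hdrop P).1 hP
        exact ⟨j, hj, h⟩
    refine ⟨a, b, hadj, SimpleGraph.Subgraph.ext ?_ ?_⟩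
    · ext w
      simpa using hw' w
    · ext v w
      simp only [SimpleGraph.Subgraph.inf_adj, SimpleGraph.Subgraph.iSup_adj,
        SimpleGraph.Subgraph.induce_adj, SimpleGraph.Subgraph.top_adj,
        SimpleGraph.subgraphOfAdj_adj, Finset.mem_coe]
      constructor
      · rintro ⟨⟨hv, hwQ, hvw⟩, j, hj, hvj, hwj, -⟩
        have hne := hvw.ne
        rcases (hw' v).1 ⟨hv, j, hj, hvj⟩ with rfl | rfl <;>
          rcases (hw' w).1 ⟨hwQ, j, hj, hwj⟩ with rfl | rfl
        · exact absurd rfl hne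
        · rfl
        · exact Sym2.eq_swap
        · exact absurd rfl hne
      · intro h
        obtain ⟨j, hj, rfl⟩ := (hdrop P).1 hP
        rcases Sym2.eq_iff.1 h with ⟨rfl, rfl⟩ | ⟨rfl, rfl⟩
        · exact ⟨⟨haQ, hbQ, hadj⟩, j, hj, haP, hbP, hadj⟩
        · exact ⟨⟨hbQ, haQ, hadj.symm⟩, j, hj, hbP, haP, hadj.symm⟩

/-- The edges of an outer-RAC graph form a fan-free set of chords for some order of the
vertices. -/
theorem Drawing.IsOuterRAC.exists_isFanFree [Fintype V] {G : SimpleGraph V} {D : Drawing G}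
    (hD : D.IsOuterRAC) : ∃ (_ : LinearOrder V) (E : Finset (V × V)),
      (∀ e, e ∈ E ↔ e.1 < e.2 ∧ G.Adj e.1 e.2) ∧ IsFanFree Finset.univ E := by
  classical
  obtain ⟨f, hf, h⟩ := hD.exists_order
  let : LinearOrder V := LinearOrder.lift' f hf
  have hE : ∀ e, e ∈ Finset.univ.filter (fun e : V × V => e.1 < e.2 ∧ G.Adj e.1 e.2) ↔
      e.1 < e.2 ∧ G.Adj e.1 e.2 := by simp
  refine ⟨inferInstance, _, hE, fun e he => ((hE e).1 he).1, fun _ _ => Finset.mem_univ _,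
    fun _ _ => Finset.mem_univ _, ?_⟩
  have hblocks : ∀ {a b c d : V}, G.Adj a b → G.Adj c d → Blocks (a, b) (c, d) →
      ∃ p, D.CrossAt a b c d p := by
    rintro a b c d hab hcd ⟨h1, h2, h3⟩
    obtain ⟨p, hp, hp'⟩ := h a b c d hab hcd h1 h2 h3
    exact ⟨p, hD.crossAt hab hcd h1.ne' h2.ne ((h1.trans h2).trans h3).ne' h3.ne' hp hp'⟩
  have hcross : ∀ {a b c d : V}, G.Adj a b → G.Adj c d → Alternate (a, b) (c, d) →
      ∃ p, D.CrossAt a b c d p := by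
    rintro a b c d hab hcd (h | h)
    · exact hblocks hab hcd h
    · obtain ⟨p, hp⟩ := hblocks hcd hab h
      exact ⟨p, hp.comm⟩
  rintro ⟨a, b⟩ he ⟨c, d⟩ hf ⟨c', d'⟩ hg hef heg v hvf hvg
  obtain ⟨-, hab⟩ := (hE _).1 he
  obtain ⟨hcd, hcd'⟩ := (hE _).1 hf
  obtain ⟨hcd₂, hcd₂'⟩ := (hE _).1 hg
  obtain ⟨p, hp⟩ := hcross hab hcd' hef
  obtain ⟨q, hq⟩ := hcross hab hcd₂' heg
  simp only at hvf hvg hab hcd hcd' hcd₂ hcd₂'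
  rcases hvf with rfl | rfl <;> rcases hvg with rfl | rfl
  · rw [hD.eq_of_crossAt hab hcd' hcd₂' hp hq]
  · exact absurd (hD.eq_of_crossAt hab hcd' hcd₂'.symm hp hq.swap) (hcd₂.trans hcd).ne'
  · exact absurd (hD.eq_of_crossAt hab hcd'.symm hcd₂' hp.swap hq) (hcd.trans hcd₂).ne
  · rw [hD.eq_of_crossAt hab hcd'.symm hcd₂'.symm hp.swap hq.swap]

theorem ncard_edgeSet [LinearOrder V] {G : SimpleGraph V} {E : Finset (V × V)}
    (hE : ∀ e, e ∈ E ↔ e.1 < e.2 ∧ G.Adj e.1 e.2) : G.edgeSet.ncard = E.card := by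
  have h : G.edgeSet = (fun e : V × V => s(e.1, e.2)) '' E := by
    ext e
    induction e with
    | _ a b =>
      constructor
      · intro hab
        rcases (SimpleGraph.Adj.ne hab).lt_or_gt with h | h
        · exact ⟨(a, b), (hE _).2 ⟨h, hab⟩, rfl⟩
        · exact ⟨(b, a), (hE _).2 ⟨h, SimpleGraph.Adj.symm hab⟩, Sym2.eq_swap⟩
      · rintro ⟨e, he, h⟩
        rw [← h]
        exact ((hE e).1 he).2
  rw [h, Set.InjOn.ncard_image, Set.ncard_coe_finset]
  rintro ⟨a, b⟩ he ⟨c, d⟩ hf h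
  have h1 := ((hE _).1 he).1
  have h2 := ((hE _).1 hf).1
  rcases Sym2.eq_iff.1 h with ⟨rfl, rfl⟩ | ⟨rfl, rfl⟩
  · rfl
  · exact absurd h1 h2.not_gt

end Main

end OuterRAC

theorem mainTheorem1 {V : Type*} [Fintype V] (G : SimpleGraph V)
    (hn : 2 ≤ Fintype.card V) (hG : OuterRAC.IsOuterRACGraph G) :
    (G.edgeSet.ncard : ℝ) ≤ 5 / 2 * (Fintype.card V : ℝ) - 4 ∧
      (3 ≤ Fintype.card V →
        (G.edgeSet.ncard : ℝ) = 5 / 2 * (Fintype.card V : ℝ) - 4 →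
          ∃ (k : ℕ) (B : Fin k → G.Subgraph), OuterRAC.IsK4BlockDecomposition G B) := by
  classical
  obtain ⟨D, hD⟩ := hG
  obtain ⟨_, E, hE, hF⟩ := hD.exists_isFanFree
  rw [OuterRAC.ncard_edgeSet hE]
  constructor
  · have h : 2 * (E.card : ℝ) + 8 ≤ 5 * Fintype.card V := by exact_mod_cast hF.card_le hn
    linarith
  · intro hn3 hm
    have hcard : 2 * E.card + 8 = 5 * Fintype.card V := by
      have h : 2 * (E.card : ℝ) + 8 = 5 * Fintype.card V := by linarith
      exact_mod_cast h
    obtain ⟨⟨a, b⟩, hab⟩ : E.Nonempty := Finset.card_pos.1 (by omega)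
    obtain ⟨M, hM, hK4, hedge⟩ := hF.exists_isChain _ rfl hn3 hcard a b hab [] trivial (Or.inl rfl)
    rw [List.append_nil] at hM
    refine OuterRAC.exists_isK4BlockDecomposition hE hM (fun Q hQ => (hK4 Q hQ).2) hedge fun v => ?_
    -- A vertex in no `K₄` would be isolated, so all of `E` would live on one point fewer and exceed
    -- the bound there.
    by_contra! hv
    have hF' : OuterRAC.IsFanFree (Finset.univ.erase v) E := by
      refine ⟨hF.lt, fun e he => ?_, fun e he => ?_, hF.fan⟩ <;>
        obtain ⟨Q, hQ, h1, h2⟩ := hedge e he <;>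
        refine Finset.mem_erase.2 ⟨?_, Finset.mem_univ _⟩ <;> rintro rfl
      exacts [hv Q hQ h1, hv Q hQ h2]
    have hc : (Finset.univ.erase v).card = Fintype.card V - 1 := by
      rw [Finset.card_erase_of_mem (Finset.mem_univ v), Finset.card_univ]
    have := hF'.card_le (by omega)
    omega
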